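/- Let $d\ge 2$, let $\sigma$ be the surface measure on the unit sphere $\mathbb S^{d-1}\subset\mathbb R^d$, and for $f:\mathbb R^d\times\mathbb S^{d-1}\to\mathbb C$ let $$\rho f(x,t)=\int_{\mathbb S^{d-1}} f(x-tv,v)\,\mathrm d\sigma(v),\qquad (x,t)\in\mathbb R^d\times\mathbb R .$$ Let $D_+^{\beta_+}D_-^{\beta_-}$ be the space-time Fourier multiplier operator with symbol $(|\xi|+|\tau|)^{\beta_+}\,\big||\xi|-|\tau|\big|^{\beta_-}$, where $(\xi,\tau)$ is dual to $(x,t)$ and the Fourier transform has kernel $e^{-i(x\cdot\xi+t\tau)}$. Let $\Delta$ be the Laplace--Beltrami operator on $\mathbb S^{d-1}$, acting on the velocity variable $v$, and let $(1-\Delta)^{s/2}$ be defined by the spectral theorem in $L^2(\mathbb S^{d-1},\sigma)$. Suppose that $s\in[-\frac{d-2}{2},0]$, $\beta_++\beta_-=\frac12$ and $\beta_->-s-\frac{d-2}{2}$. Then there is a constant $C<\infty$, depending only on $d,s,\beta_+,\beta_-$, such that for every $f\in L^2(\mathbb R^d\times\mathbb S^{d-1},\mathrm dx\,\mathrm d\sigma)$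 which is radially symmetric in the spatial variable (that is, $f(x,v)$ depends only on $|x|$ and $v$, up to null sets), $D_+^{\beta_+}D_-^{\beta_-}\rho f$ exists as an element of $L^2(\mathbb R^{d+1})$ and $$\|D_+^{\beta_+}D_-^{\beta_-}\rho f\|_{L^2(\mathbb R^{d+1})}\le C\,\|(1-\Delta)^{s/2}f\|_{L^2(\mathbb R^d\times\mathbb S^{d-1})}.$$ -/

import Mathlib

open MeasureTheory
open scoped ENNReal NNReal FourierTransform SchwartzMap ContDiff

noncomputable section

namespace KineticTransport

/-- The spatial domain `ℝ^d`, with its Euclidean norm. -/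
abbrev Space (d : ℕ) : Type := EuclideanSpace ℝ (Fin d)

/-- The velocity domain: the unit sphere of `ℝ^d`. -/
abbrev Sph (d : ℕ) : Type := Metric.sphere (0 : Space d) 1

/-- The induced Lebesgue (surface) measure on the unit sphere, of total mass `|𝕊^{d-1}|`. -/
def surf (d : ℕ) : Measure (Sph d) := (volume : Measure (Space d)).toSphere

instance (d : ℕ) : IsFiniteMeasure (surf d) :=
  inferInstanceAs (IsFiniteMeasure (volume : Measure (Space d)).toSphere)

/-- The measure `dx dσ(v)` on phase space `ℝ^d × 𝕊^{d-1}`. -/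
def phase (d : ℕ) : Measure (Space d × Sph d) := (volume : Measure (Space d)).prod (surf d)

/-- Space-time `ℝ^d × ℝ = ℝ^{d+1}`, with its Euclidean structure and Lebesgue measure; the first
component of a point is the spatial one, the second is time (or, on the Fourier side, `(ξ, τ)`). -/
abbrev SpaceTime (d : ℕ) : Type := WithLp 2 (Space d × ℝ)

/-- The velocity average `ρ f (x, t) = ∫ f (x - t v, v) dσ(v)`. -/
def rho (d : ℕ) (f : Space d × Sph d → ℂ) (z : SpaceTime d) : ℂ :=
  ∫ v : Sph d, f (z.fst - z.snd • (v : Space d), v) ∂(surf d)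

/-- `f` is (almost everywhere) radially symmetric in the spatial variable. -/
def IsRadialInSpace (d : ℕ) (f : Space d × Sph d → ℂ) : Prop :=
  ∃ F : ℝ → Sph d → ℂ, ∀ᵐ p ∂(phase d), f p = F ‖p.1‖ p.2

/-! ### Fourier multipliers on space-time -/

/-- The tempered distribution given by the function `g` has as its Fourier transform the
distribution given by the function `G`: `⟨g, 𝓕 φ⟩ = ⟨G, φ⟩` for all Schwartz functions `φ`, where all
the pairings converge absolutely. Here `𝓕 φ (ζ) = ∫ φ(z) e^{-2πi ⟨z, ζ⟩} dz`, so that `G(ζ)` is the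
value at `2πζ` of the Fourier transform with kernel `e^{-i⟨z, ζ⟩}`. -/
def HasFourierTransform (d : ℕ) (g G : SpaceTime d → ℂ) : Prop :=
  ∀ φ : 𝓢(SpaceTime d, ℂ),
    Integrable (fun z => g z * 𝓕 φ z) ∧ Integrable (fun ζ => G ζ * φ ζ) ∧
      ∫ z, g z * 𝓕 φ z = ∫ ζ, G ζ * φ ζ

/-- The symbol `(|ξ| + |τ|)^{β₊} ||ξ| - |τ||^{β₋}` of `D₊^{β₊} D₋^{β₋}`, in the convention where the
Fourier transform has kernel `e^{-i(x·ξ + tτ)}`. -/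
def hypSymbol (d : ℕ) (βp βm : ℝ) (ζ : SpaceTime d) : ℝ :=
  (‖ζ.fst‖ + |ζ.snd|) ^ βp * (abs (‖ζ.fst‖ - |ζ.snd|)) ^ βm

/-- `u = D₊^{β₊} D₋^{β₋} g`: the (tempered) Fourier transform of `g` is a function, and multiplying it
by the symbol yields the Fourier transform of `u`. The symbol is evaluated at `2πζ` because of the
normalisation of `𝓕`. Given `g`, such a `u` is unique up to null sets. -/
def IsHypDeriv (d : ℕ) (βp βm : ℝ) (g u : SpaceTime d → ℂ) : Prop :=
  ∃ G : SpaceTime d → ℂ, HasFourierTransform d g G ∧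
    HasFourierTransform d u (fun ζ => (hypSymbol d βp βm ((2 * Real.pi) • ζ) : ℂ) * G ζ)

/-! ### The Laplace-Beltrami operator on the sphere and its functional calculus -/

open Classical in
/-- The extension of a function on the sphere that is homogeneous of degree `0`:
`x ↦ φ (x / |x|)` for `x ≠ 0` (and `0` at the origin). -/
def homExt (d : ℕ) (φ : Sph d → ℂ) (x : Space d) : ℂ :=
  if h : x = 0 then 0 else
    φ ⟨‖x‖⁻¹ • x, by
      rw [mem_sphere_zero_iff_norm, norm_smul, norm_inv, norm_norm,
        inv_mul_cancel₀ (norm_ne_zero_iff.mpr h)]⟩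

/-- Smoothness of a function on the sphere. -/
def SphSmooth (d : ℕ) (φ : Sph d → ℂ) : Prop := ContDiffOn ℝ ∞ (homExt d φ) {0}ᶜ

/-- The Laplace-Beltrami operator on the unit sphere, for smooth functions: the Euclidean Laplacian
of the extension that is homogeneous of degree `0`, restricted to the sphere. -/
def laplaceBeltrami (d : ℕ) (φ : Sph d → ℂ) (v : Sph d) : ℂ :=
  Laplacian.laplacian (homExt d φ) (v : Space d)

/-- The eigenspace of `-Δ` in `L²(𝕊^{d-1})` for the eigenvalue `lam` (it is `{0}` if `lam` is not an
eigenvalue). -/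
def sphEigenspace (d : ℕ) (lam : ℝ≥0) : Submodule ℂ (Lp ℂ 2 (surf d)) :=
  Submodule.span ℂ {Y | ∃ φ : Sph d → ℂ, SphSmooth d φ ∧
    (∀ v, -laplaceBeltrami d φ v = ((lam : ℝ) : ℂ) * φ v) ∧ Y =ᵐ[surf d] φ}

open Classical in
/-- `‖(1 - Δ)^{s/2} φ‖²` in `L²(𝕊^{d-1})`. The operator `(1 - Δ)^{s/2}` is given by the functional
calculus of the self-adjoint operator `-Δ`, which has a discrete nonnegative spectrum: it is
`∑ (1 + lam)^{s/2} P_lam`, where `P_lam` is the orthogonal projection onto the eigenspace of `-Δ` for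
`lam`. As the eigenspaces are mutually orthogonal, the squared norm is
`∑ (1 + lam)^s ‖P_lam φ‖²` (only countably many terms are nonzero). The value is `∞` by
convention if `φ` is not in `L²`. -/
def sphSobolevSq (d : ℕ) (s : ℝ) (φ : Sph d → ℂ) : ℝ≥0∞ :=
  if h : MemLp φ 2 (surf d) then
    ∑' lam : ℝ≥0, ENNReal.ofReal ((1 + (lam : ℝ)) ^ s) *
      ‖(sphEigenspace d lam).topologicalClosure.starProjection (h.toLp φ)‖ₑ ^ 2
  else ∞

/-- `‖(1 - Δ_v)^{s/2} f‖` in `L²(ℝ^d × 𝕊^{d-1})`, the operator acting on the velocity variable. -/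
def velSobolevNorm (d : ℕ) (s : ℝ) (f : Space d × Sph d → ℂ) : ℝ≥0∞ :=
  (∫⁻ x : Space d, sphSobolevSq d s (fun v => f (x, v))) ^ (1 / 2 : ℝ)

end KineticTransport

end

/-! Write d = m + 2. The free flow f(x - tv, v) has its space-time Fourier transform on τ = -ξ·v, so
the transform of ρf at (ξ, τ) integrates the spatial transform of f(·, v) over the parallel ⟨v,
ξ/|ξ|⟩ = t of the sphere, where t = -τ/|ξ|. Expand f(x, ·) in an orthonormal basis of spherical
harmonics Y_j of degree k_j with coefficients A_j(x), and let a_j be the Fourier transform of A_j.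
By Funk-Hecke (`integral_zonProj_mul`), averaging Y_j over a parallel gives Y_j(ξ/|ξ|) P_k(t) with k
= k_j, where P_k is the Gegenbauer polynomial with P_k(1) = 1. Hence the transform of ρf is the sum
over j of κ |ξ|^{-1} (1 - t²)^{(m-1)/2} P_k(t) a_j(ξ) Y_j(ξ/|ξ|), supported in |t| < 1.

As β₊ + β₋ = 1/2, the symbol is |ξ|^{1/2} times a function of t. If f is radial in x, then each a_j
is radial, and the terms multiplied by the symbol are mutually orthogonal in L²(ℝ^{d+1}) because the
Y_j are (`inner_sepFun`). Their squared norms are constant multiples of ‖A_j‖² ∫ η² P_k² dt, with η²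
bounded by a multiple of (1 - t²)^e, e = 2β₋ + m - 1. So the theorem reduces to ∫ (1 - t²)^e P_k² ≤
C (1 + k(k+m))^s over (-1, 1), for e > -2s - 1, which is the hypothesis on β₋
(`exists_integral_rpow_mul_geg_sq_le`). For m ≥ 1 this interpolates between |P_k| ≤ 1 and the decay
(k+1)^{-m} of ∫ (1 - t²)^{(m-1)/2} P_k², with parameter -2s/m, which lies in [0, 1] by the
hypothesis on s. For m = 0 that hypothesis forces s = 0.

Since ρf is not known to be in L², its transform is found by duality: ρ is dual to integration along
rays (`integrable_rho_mul`), and the projection-slice theorem (`rayTransform_fourier`) describes ray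
integrals of a Fourier transform. The sum over j converges in L² only after a change of weight. A
profile `etaH` dominating both the multiplied profile and √dens gives a convergent series H
(`summable_sepLp`), from which the transform of ρf and its product with the symbol are both obtained
by multiplication. -/

noncomputable section

/-! ### Gegenbauer polynomials: differential equation, orthogonality, norms -/

namespace KineticTransport

open Polynomial

/-- The Gegenbauer polynomials of index `m / 2`, normalised to take the value `1` at `1`. -/
def geg (m : ℕ) : ℕ → ℝ[X]
  | 0 => 1
  | 1 => X
  | (k + 2) => C ((2 * (k + 1) + m : ℝ) / (k + 1 + m)) * X * geg m (k + 1) -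
      C ((k + 1 : ℝ) / (k + 1 + m)) * geg m k

lemma geg_zero (m : ℕ) : geg m 0 = 1 := by rw [geg]

lemma geg_one (m : ℕ) : geg m 1 = X := by rw [geg]

lemma geg_rec (m k : ℕ) : ((k : ℝ[X]) + 1 + (m : ℝ[X])) * geg m (k + 2) =
    (2 * ((k : ℝ[X]) + 1) + (m : ℝ[X])) * X * geg m (k + 1) - ((k : ℝ[X]) + 1) * geg m k := by
  have h : (k + 1 + m : ℝ) ≠ 0 := by positivity
  have h1 : ((k : ℝ[X]) + 1 + (m : ℝ[X])) * C ((2 * (k + 1) + m : ℝ) / (k + 1 + m)) = 2 * ((k : ℝ[X]) + 1) + (m : ℝ[X]) := by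
    have : ((k : ℝ[X]) + 1 + (m : ℝ[X])) = C (k + 1 + m : ℝ) := by simp
    rw [this, ← C_mul, mul_div_cancel₀ _ h]; simp [map_ofNat C 2]
  have h2 : ((k : ℝ[X]) + 1 + (m : ℝ[X])) * C ((k + 1 : ℝ) / (k + 1 + m)) = (k : ℝ[X]) + 1 := by
    have : ((k : ℝ[X]) + 1 + (m : ℝ[X])) = C (k + 1 + m : ℝ) := by simp
    rw [this, ← C_mul, mul_div_cancel₀ _ h]; simp
  rw [geg]
  linear_combination (X * geg m (k + 1)) * h1 - geg m k * h2

lemma geg_eval_one (m k : ℕ) : (geg m k).eval 1 = 1 := by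
  induction k using Nat.twoStepInduction with
  | zero => simp [geg_zero]
  | one => simp [geg_one]
  | more k h0 h1 =>
    have h : (k + 1 + m : ℝ) ≠ 0 := by positivity
    simp only [geg, eval_sub, eval_mul, eval_C, eval_X, h0, h1]
    field_simp
    ring

lemma geg_degree (m k : ℕ) : (geg m k).degree = k := by
  induction k using Nat.twoStepInduction with
  | zero => simp [geg_zero]
  | one => simp [geg_one]
  | more k h0 h1 =>
    have h : (2 * (k + 1) + m : ℝ) / (k + 1 + m) ≠ 0 := by positivity
    have e1 : (C ((2 * (k + 1) + m : ℝ) / (k + 1 + m)) * X * geg m (k + 1)).degree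
        = ((k + 2 : ℕ) : WithBot ℕ) := by
      rw [degree_mul, degree_C_mul_X h, h1]; norm_cast; ring_nf
    have h' : (k + 1 : ℝ) / (k + 1 + m) ≠ 0 := by positivity
    have e2 : (C ((k + 1 : ℝ) / (k + 1 + m)) * geg m k).degree = ((k : ℕ) : WithBot ℕ) := by
      rw [degree_C_mul h', h0]
    rw [geg, degree_sub_eq_left_of_degree_lt, e1]
    rw [e1, e2]; norm_cast; omega

/-- The Gegenbauer polynomials as a sequence with one polynomial of each degree. -/
def gegSeq (m : ℕ) : Polynomial.Sequence ℝ := ⟨geg m, geg_degree m⟩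

lemma isUnit_geg_leadingCoeff (m k : ℕ) : IsUnit (gegSeq m k).leadingCoeff := by
  rw [isUnit_iff_ne_zero, Ne, leadingCoeff_eq_zero]
  exact (gegSeq m).ne_zero k

/-- The two relations need a joint induction: the first at k + 1 is the second at k plus the
recurrence, and the second at k + 1 follows from the differentiated recurrence, after cancelling k +
1 + m. -/
lemma geg_derivative_aux (m k : ℕ) :
    (1 - X ^ 2) * derivative (geg m k) = ((k : ℝ[X]) + (m : ℝ[X])) * (X * geg m k - geg m (k + 1)) ∧
    (1 - X ^ 2) * derivative (geg m (k + 1)) =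
      ((k : ℝ[X]) + 1) * (geg m k - X * geg m (k + 1)) := by
  induction k with
  | zero => simp [geg_zero, geg_one]; ring
  | succ k ih =>
    obtain ⟨h1, h2⟩ := ih
    have hr := geg_rec m k
    have hd := congrArg derivative hr
    have hne : ((k : ℝ[X]) + 1 + (m : ℝ[X])) ≠ 0 := by
      have : ((k : ℝ[X]) + 1 + (m : ℝ[X])) = C (k + 1 + m : ℝ) := by simp
      rw [this, Ne, C_eq_zero]; positivity
    simp only [derivative_mul, derivative_sub, derivative_add, derivative_natCast, derivative_one,
      derivative_X, derivative_ofNat, zero_mul, mul_zero, add_zero, zero_add, mul_one] at hd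
    push_cast
    refine ⟨?_, mul_left_cancel₀ hne ?_⟩
    · linear_combination h2 + hr
    · linear_combination (1 - X ^ 2) * hd + (2 * ((k : ℝ[X]) + 1) + (m : ℝ[X])) * X * h2 - ((k : ℝ[X]) + 1) * h1
        + ((k : ℝ[X]) + 2) * X * hr

/-- Differentiating the second first-order relation and substituting both relations gives the
equation times 1 - X², which cancels. -/
lemma geg_ode (m k : ℕ) :
    (1 - X ^ 2) * derivative (derivative (geg m k)) - ((m : ℝ[X]) + 1) * X * derivative (geg m k)
      = - ((k : ℝ[X]) * ((k : ℝ[X]) + (m : ℝ[X]))) * geg m k := by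
  rcases k with _ | k
  · simp [geg_zero]
  · have hne : (1 - X ^ 2 : ℝ[X]) ≠ 0 := by
      intro h
      have := congrArg (eval 0) h
      simp at this
    obtain ⟨h1, h2⟩ := geg_derivative_aux m k
    have hd := congrArg derivative h2
    simp only [derivative_mul, derivative_sub, derivative_add, derivative_natCast, derivative_one,
      derivative_X, derivative_X_pow, zero_mul, mul_zero, add_zero, zero_add, mul_one, one_mul] at hd
    simp only [Nat.cast_ofNat, map_ofNat, Nat.add_one_sub_one, pow_one] at hd
    refine mul_left_cancel₀ hne ?_
    push_cast
    linear_combination (1 - X ^ 2) * hd + ((k : ℝ[X]) + 1) * h1 - ((m : ℝ[X]) + (k : ℝ[X])) * X * h2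

/-- The weighted inner product for which the Gegenbauer polynomials are orthogonal. -/
def gegInner (m : ℕ) (p q : ℝ[X]) : ℝ :=
  ∫ θ in (0 : ℝ)..Real.pi, p.eval (Real.cos θ) * q.eval (Real.cos θ) * Real.sin θ ^ m

lemma continuous_gegIntegrand (m : ℕ) (p q : ℝ[X]) : Continuous fun θ : ℝ =>
    p.eval (Real.cos θ) * q.eval (Real.cos θ) * Real.sin θ ^ m := by
  have h1 : Continuous fun θ : ℝ => p.eval (Real.cos θ) := p.continuous.comp Real.continuous_cos
  have h2 : Continuous fun θ : ℝ => q.eval (Real.cos θ) := q.continuous.comp Real.continuous_cos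
  fun_prop

lemma gegInner_comm (m : ℕ) (p q : ℝ[X]) : gegInner m p q = gegInner m q p := by
  unfold gegInner
  congr 1; ext θ; ring

lemma gegInner_add_left (m : ℕ) (p q r : ℝ[X]) :
    gegInner m (p + q) r = gegInner m p r + gegInner m q r := by
  unfold gegInner
  rw [← intervalIntegral.integral_add ((continuous_gegIntegrand m p r).intervalIntegrable _ _)
    ((continuous_gegIntegrand m q r).intervalIntegrable _ _)]
  congr 1; ext θ; simp only [eval_add]; ring

lemma gegInner_smul_left (m : ℕ) (c : ℝ) (p r : ℝ[X]) :
    gegInner m (c • p) r = c * gegInner m p r := by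
  unfold gegInner
  rw [← intervalIntegral.integral_const_mul]
  congr 1; ext θ; simp only [eval_smul, smul_eq_mul]; ring

/-- `gegInner` with the second argument fixed, as a linear form. -/
def gegForm (m : ℕ) (r : ℝ[X]) : ℝ[X] →ₗ[ℝ] ℝ where
  toFun p := gegInner m p r
  map_add' p q := gegInner_add_left m p q r
  map_smul' c p := gegInner_smul_left m c p r

lemma gegForm_apply (m : ℕ) (p r : ℝ[X]) : gegForm m r p = gegInner m p r := rfl

/-- Sturm-Liouville symmetry: the difference of the integrands is the derivative of sin^{m+1} θ
times the Wronskian of p and q at cos θ, and sin vanishes at 0 and π. -/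
lemma gegInner_operator_symm (m : ℕ) (p q : ℝ[X]) :
    gegInner m ((1 - X ^ 2) * derivative (derivative p) - ((m : ℝ[X]) + 1) * X * derivative p) q =
    gegInner m p ((1 - X ^ 2) * derivative (derivative q) - ((m : ℝ[X]) + 1) * X * derivative q) := by
  rw [← sub_eq_zero]
  unfold gegInner
  rw [← intervalIntegral.integral_sub ((continuous_gegIntegrand m _ _).intervalIntegrable _ _)
    ((continuous_gegIntegrand m _ _).intervalIntegrable _ _)]
  have key : ∀ θ : ℝ, HasDerivAt (fun θ : ℝ => Real.sin θ ^ (m + 1) *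
      (p.eval (Real.cos θ) * (derivative q).eval (Real.cos θ) -
        (derivative p).eval (Real.cos θ) * q.eval (Real.cos θ)))
      (eval (Real.cos θ) ((1 - X ^ 2) * derivative (derivative p) - ((m : ℝ[X]) + 1) * X * derivative p) *
        eval (Real.cos θ) q * Real.sin θ ^ m - eval (Real.cos θ) p *
        eval (Real.cos θ) ((1 - X ^ 2) * derivative (derivative q) - ((m : ℝ[X]) + 1) * X * derivative q) *
        Real.sin θ ^ m) θ := by
    intro θ
    have hc : ∀ r : ℝ[X], HasDerivAt (fun θ : ℝ => r.eval (Real.cos θ))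
        ((derivative r).eval (Real.cos θ) * -Real.sin θ) θ := fun r =>
      (r.hasDerivAt (Real.cos θ)).comp θ (Real.hasDerivAt_cos θ)
    have := ((Real.hasDerivAt_sin θ).pow (m + 1)).mul
      (((hc p).mul (hc (derivative q))).sub ((hc (derivative p)).mul (hc q)))
    refine this.congr_deriv ?_
    simp only [eval_sub, eval_mul, eval_one, eval_pow, eval_X, eval_add, eval_natCast,
      Nat.add_sub_cancel, Pi.mul_apply, Pi.sub_apply, Pi.pow_apply]
    have hs : Real.cos θ ^ 2 = 1 - Real.sin θ ^ 2 := by rw [← Real.sin_sq_add_cos_sq θ]; ring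
    rw [hs, pow_succ]
    push_cast
    ring
  rw [intervalIntegral.integral_eq_sub_of_hasDerivAt (fun θ _ => key θ)
    (((continuous_gegIntegrand m _ _).sub (continuous_gegIntegrand m _ _)).intervalIntegrable _ _)]
  simp

/-- Eigenvectors of a symmetric operator for different eigenvalues: k(k+m) - l(l+m) = (k-l)(k+l+m)
does not vanish for distinct natural numbers. -/
lemma gegInner_geg_of_ne (m : ℕ) {k l : ℕ} (hkl : k ≠ l) :
    gegInner m (geg m k) (geg m l) = 0 := by
  have h := gegInner_operator_symm m (geg m k) (geg m l)
  rw [geg_ode, geg_ode, gegInner_comm m (geg m k)] at h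
  have e : ∀ j : ℕ, -((j : ℝ[X]) * ((j : ℝ[X]) + (m : ℝ[X]))) * geg m j = (-((j : ℝ) * (j + m))) • geg m j := by
    intro j
    rw [smul_eq_C_mul]; simp
  rw [e, e, gegInner_smul_left, gegInner_smul_left, gegInner_comm m (geg m l)] at h
  have h2 : ((k : ℝ) * (k + m) - l * (l + m)) * gegInner m (geg m k) (geg m l) = 0 := by
    linear_combination -h
  rcases mul_eq_zero.1 h2 with h3 | h3
  · exfalso
    have h4 : ((k : ℝ) - l) * (k + l + m) = 0 := by linear_combination h3
    rcases mul_eq_zero.1 h4 with h5 | h5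
    · exact hkl (by exact_mod_cast sub_eq_zero.1 h5)
    · have : k + l + m = 0 := by exact_mod_cast h5
      omega
  · exact h3

/-- The squared norm of the `k`-th Gegenbauer polynomial. -/
def gegNormSq (m k : ℕ) : ℝ := gegInner m (geg m k) (geg m k)

lemma gegForm_rec (m k : ℕ) (r : ℝ[X]) :
    (k + 1 + m) * gegInner m (geg m (k + 2)) r =
      (2 * (k + 1) + m) * gegInner m (X * geg m (k + 1)) r - (k + 1) * gegInner m (geg m k) r := by
  have h : (k + 1 + m : ℝ) • geg m (k + 2) =
      (2 * (k + 1) + m : ℝ) • (X * geg m (k + 1)) - (k + 1 : ℝ) • geg m k := by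
    have := geg_rec m k
    simp only [smul_eq_C_mul]
    simp only [C_add, C_mul, map_natCast, C_1, map_ofNat]
    linear_combination this
  have h' := congrArg (gegForm m r) h
  simpa only [map_smul, map_sub, gegForm_apply, smul_eq_mul] using h'

lemma gegInner_X_mul (m : ℕ) (p q : ℝ[X]) : gegInner m (X * p) q = gegInner m (X * q) p := by
  unfold gegInner
  congr 1; ext θ; simp only [eval_mul, eval_X]; ring

/-- The pairing of X P_k with P_{k+1} is evaluated twice by the recurrence, once lowering and once
raising the degree. -/
lemma gegNormSq_succ (m k : ℕ) :
    (k + m) * (2 * (k + 1) + m) * gegNormSq m (k + 1) = (2 * k + m) * (k + 1) * gegNormSq m k := by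
  have h1 := gegForm_rec m k (geg m k)
  rw [gegInner_geg_of_ne m (by omega), mul_zero] at h1
  rcases k with _ | k
  -- There is no lower recurrence for k = 0, but X · 1 = P_1 replaces it. For k = m = 0 both sides
  -- vanish and the relation says nothing.
  · simp only [geg_zero, geg_one, gegNormSq, zero_add, Nat.cast_zero, mul_one, mul_zero] at h1 ⊢
    have e : gegInner m (X * X) 1 = gegInner m X X := by
      unfold gegInner
      congr 1; ext θ; simp
    rw [e] at h1
    linear_combination -(m : ℝ) * h1
  · have h2 := gegForm_rec m k (geg m (k + 2))
    rw [gegInner_geg_of_ne m (show k ≠ k + 2 by omega), mul_zero, sub_zero, gegInner_X_mul] at h2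
    unfold gegNormSq
    push_cast at h1 ⊢
    linear_combination (2 * ((k : ℝ) + 2) + m) * h2 - (2 * (k + 1) + m) * h1

lemma gegNormSq_zero_pos (m : ℕ) : 0 < gegNormSq m 0 := by
  have : gegNormSq m 0 = ∫ θ in (0 : ℝ)..Real.pi, Real.sin θ ^ m := by
    simp [gegNormSq, gegInner, geg_zero]
  rw [this]; exact integral_sin_pow_pos m

lemma gegNormSq_pos (m k : ℕ) : 0 < gegNormSq m k := by
  unfold gegNormSq gegInner
  have hc := continuous_gegIntegrand m (geg m k) (geg m k)
  have hnn : ∀ θ ∈ Set.Ioc 0 Real.pi,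
      0 ≤ (geg m k).eval (Real.cos θ) * (geg m k).eval (Real.cos θ) * Real.sin θ ^ m := by
    intro θ hθ
    exact mul_nonneg (mul_self_nonneg _) (pow_nonneg (Real.sin_nonneg_of_nonneg_of_le_pi hθ.1.le hθ.2) _)
  have hne : ∃ θ ∈ Set.Ioo 0 Real.pi, (geg m k).eval (Real.cos θ) ≠ 0 := by
    have hcont : Continuous fun θ : ℝ => (geg m k).eval (Real.cos θ) :=
      (geg m k).continuous.comp Real.continuous_cos
    have h0 : (geg m k).eval (Real.cos 0) = 1 := by rw [Real.cos_zero, geg_eval_one]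
    have : ∀ᶠ θ in nhds (0 : ℝ), (geg m k).eval (Real.cos θ) ≠ 0 :=
      hcont.continuousAt.eventually_ne (by rw [h0]; exact one_ne_zero)
    have h2 : ∀ᶠ θ in nhdsWithin (0 : ℝ) (Set.Ioi 0), (geg m k).eval (Real.cos θ) ≠ 0 :=
      this.filter_mono nhdsWithin_le_nhds
    have h3 : ∀ᶠ θ in nhdsWithin (0 : ℝ) (Set.Ioi 0), θ ∈ Set.Ioo 0 Real.pi :=
      Ioo_mem_nhdsGT Real.pi_pos
    obtain ⟨θ, h⟩ := (h2.and h3).exists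
    exact ⟨θ, h.2, h.1⟩
  obtain ⟨θ, hθ, hθ'⟩ := hne
  refine intervalIntegral.integral_pos Real.pi_pos hc.continuousOn hnn ⟨θ, ⟨hθ.1.le, hθ.2.le⟩, ?_⟩
  exact mul_pos (mul_self_pos.2 hθ') (pow_pos (Real.sin_pos_of_pos_of_lt_pi hθ.1 hθ.2) _)

/-- The recursion for the norms telescopes. The index m + 1 is positive, which avoids the void
relation at k = 0 in the Chebyshev case. -/
lemma gegNormSq_mul_ascFactorial (m k : ℕ) :
    gegNormSq (m + 1) k * (2 * k + (m + 1)) * (k + 1).ascFactorial m =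
      gegNormSq (m + 1) 0 * (m + 1).factorial := by
  induction k with
  | zero =>
    simp [Nat.one_ascFactorial, Nat.factorial_succ]
    ring
  | succ k ih =>
    have h1 := gegNormSq_succ (m + 1) k
    have h2 : ((k + 1 : ℕ) : ℝ) * (k + 2).ascFactorial m = (k + 1 + m) * (k + 1).ascFactorial m := by
      have := Nat.succ_ascFactorial (k + 1) m
      exact_mod_cast this
    rw [← ih]
    have hne : ((k : ℝ) + 1) * (k + m + 1) ≠ 0 := by positivity
    refine mul_left_cancel₀ hne ?_
    push_cast at h1 h2 ⊢
    linear_combination ((k + 2).ascFactorial m : ℝ) * (k + 1) * h1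
      + gegNormSq (m + 1) k * (2 * k + (m + 1)) * (k + 1) * h2

/-- This decay in the degree is the source of the gain s < 0 in the theorem. -/
lemma gegNormSq_le (m k : ℕ) :
    gegNormSq (m + 1) k ≤ gegNormSq (m + 1) 0 * (m + 1).factorial / (k + 1) ^ (m + 1) := by
  rw [le_div_iff₀ (by positivity), ← gegNormSq_mul_ascFactorial m k, mul_assoc]
  refine mul_le_mul_of_nonneg_left ?_ (gegNormSq_pos _ _).le
  have h : ((k + 1 : ℕ) : ℝ) ^ m ≤ (k + 1).ascFactorial m := by
    exact_mod_cast Nat.pow_succ_le_ascFactorial (k + 1) m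
  push_cast at h
  rw [pow_succ, mul_comm]
  exact mul_le_mul (by linarith [(Nat.cast_nonneg k : (0:ℝ) ≤ k), (Nat.cast_nonneg m : (0:ℝ) ≤ m)]) h
    (by positivity) (by positivity)

lemma mem_span_geg_of_natDegree_le (m k : ℕ) {p : ℝ[X]} (hp : p.natDegree ≤ k) :
    ∃ c : ℕ → ℝ, p = ∑ j ∈ Finset.range (k + 1), c j • geg m j := by
  have h : p ∈ degreeLT ℝ (k + 1) := by
    rw [mem_degreeLT]
    exact lt_of_le_of_lt degree_le_natDegree (by exact_mod_cast Nat.lt_succ_of_le hp)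
  rw [← (gegSeq m).span_degreeLT (fun i _ => isUnit_geg_leadingCoeff m i)] at h
  have h' : p ∈ Submodule.span ℝ (geg m '' (Finset.range (k + 1) : Set ℕ)) := by
    rw [show ((Finset.range (k + 1) : Finset ℕ) : Set ℕ) = Set.Iio (k + 1) by ext; simp]
    exact h
  obtain ⟨c, hc⟩ := (Submodule.mem_span_image_finset_iff_exists_fun ℝ).1 h'
  refine ⟨fun j => if hj : j ∈ Finset.range (k + 1) then c ⟨j, hj⟩ else 0, ?_⟩
  rw [← hc, ← Finset.sum_attach (Finset.range (k + 1))]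
  exact Finset.sum_congr rfl fun j _ => by beta_reduce; rw [dif_pos j.2]

/-- A polynomial of degree at most `k` that is orthogonal to all Gegenbauer polynomials of smaller
degree is a multiple of the `k`-th one. -/
lemma eq_smul_geg_of_orthogonal (m k : ℕ) {p : ℝ[X]} (hp : p.natDegree ≤ k)
    (h : ∀ j < k, gegInner m p (geg m j) = 0) : p = p.eval 1 • geg m k := by
  obtain ⟨c, hc⟩ := mem_span_geg_of_natDegree_le m k hp
  have hc0 : ∀ j < k, c j = 0 := by
    intro j hj
    have h1 := h j hj
    rw [← gegForm_apply, hc, map_sum, Finset.sum_eq_single j] at h1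
    · rw [map_smul, gegForm_apply, smul_eq_mul] at h1
      exact (mul_eq_zero.1 h1).resolve_right (gegNormSq_pos m j).ne'
    · intro i _ hij
      rw [map_smul, gegForm_apply, gegInner_geg_of_ne m hij, smul_zero]
    · intro hj'; exact absurd (Finset.mem_range.2 (by omega)) hj'
  have hp' : p = c k • geg m k := by
    conv_lhs => rw [hc]
    rw [Finset.sum_range_succ, Finset.sum_eq_zero, zero_add]
    intro j hj
    rw [hc0 j (Finset.mem_range.1 hj), zero_smul]
  have : p.eval 1 = c k := by rw [hp', eval_smul, geg_eval_one, smul_eq_mul, mul_one]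
  rw [this]; exact hp'

end KineticTransport

end

/-! ### Polar coordinates on the sphere around a pole -/

noncomputable section

namespace KineticTransport

section Slices

variable {E : Type*} [NormedAddCommGroup E] [InnerProductSpace ℝ E] [FiniteDimensional ℝ E]
  [MeasurableSpace E] [BorelSpace E]

lemma lintegral_polar [Nontrivial E] {Φ : E → ℝ≥0∞} (hΦ : Measurable Φ) :
    ∫⁻ x : E, Φ x = ∫⁻ v : Metric.sphere (0 : E) 1, ∫⁻ r in Set.Ioi (0 : ℝ),
      ENNReal.ofReal (r ^ (Module.finrank ℝ E - 1)) * Φ (r • (v : E))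
      ∂(volume : Measure ℝ) ∂(volume : Measure E).toSphere := by
  have hmp := (volume : Measure E).measurePreserving_homeomorphUnitSphereProd.symm
    (homeomorphUnitSphereProd E).toMeasurableEquiv
  have h1 : ∫⁻ x : E, Φ x = ∫⁻ x : ({0}ᶜ : Set E), Φ (x : E) ∂(volume.comap Subtype.val) := by
    rw [lintegral_subtype_comap (measurableSet_singleton _).compl Φ,
      restrict_compl_singleton]
  rw [h1, ← hmp.lintegral_comp (f := fun x : ({0}ᶜ : Set E) => Φ (x : E))
    (hΦ.comp measurable_subtype_coe), lintegral_prod]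
  · refine lintegral_congr fun v => ?_
    have hm : Measurable fun r : Set.Ioi (0 : ℝ) =>
        ENNReal.ofReal ((r : ℝ) ^ (Module.finrank ℝ E - 1)) := by fun_prop
    rw [Measure.volumeIoiPow, lintegral_withDensity_eq_lintegral_mul _ hm]
    · rw [← lintegral_subtype_comap measurableSet_Ioi]
      rfl
    · exact (hΦ.comp measurable_subtype_coe).comp (hmp.measurable.comp measurable_prodMk_left)
  · exact ((hΦ.comp measurable_subtype_coe).comp hmp.measurable).aemeasurable

lemma lintegral_eq_lintegral_orthogonal {w : E} (hw : ‖w‖ = 1) {Φ : E → ℝ≥0∞}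
    (hΦ : Measurable Φ) :
    ∫⁻ x : E, Φ x = ∫⁻ t : ℝ, ∫⁻ y : (Submodule.span ℝ {w})ᗮ, Φ (t • w + y) := by
  set K : Submodule ℝ E := Submodule.span ℝ {w}
  have h1 : MeasurePreserving (fun z : K × Kᗮ => (z.1 : E) + z.2) volume volume := by
    have := K.orthogonalDecomposition.symm.measurePreserving.comp (WithLp.volume_preserving_toLp K Kᗮ)
    exact this
  have h2 : MeasurePreserving (LinearIsometryEquiv.toSpanUnitSingleton (𝕜 := ℝ) w hw)
    volume volume := LinearIsometryEquiv.measurePreserving _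
  have h3 : MeasurePreserving (fun z : ℝ × Kᗮ => z.1 • w + (z.2 : E)) volume volume := by
    have := h1.comp (h2.prod (MeasurePreserving.id (volume : Measure Kᗮ)))
    exact this
  rw [← h3.lintegral_comp hΦ, Measure.volume_eq_prod, lintegral_prod]
  exact (hΦ.comp h3.measurable).aemeasurable

/-- The projection `x ↦ x / |x|` onto the unit sphere, with an arbitrary value `w` at the origin. -/
def sphProj (w : Metric.sphere (0 : E) 1) (x : E) : Metric.sphere (0 : E) 1 := by
  classical
  exact ⟨if x = 0 then w else ‖x‖⁻¹ • x, by
    split_ifs with h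
    · exact w.2
    · rw [mem_sphere_zero_iff_norm, norm_smul, norm_inv, norm_norm,
        inv_mul_cancel₀ (norm_ne_zero_iff.mpr h)]⟩

lemma measurable_sphProj (w : Metric.sphere (0 : E) 1) : Measurable (sphProj w) := by
  refine Measurable.subtype_mk ?_
  exact Measurable.ite (measurableSet_singleton 0) measurable_const
    (measurable_norm.inv.smul measurable_id)

lemma coe_sphProj (w : Metric.sphere (0 : E) 1) {x : E} (hx : x ≠ 0) :
    (sphProj w x : E) = ‖x‖⁻¹ • x := by
  simp [sphProj, hx]

lemma sphProj_smul (w v : Metric.sphere (0 : E) 1) {r : ℝ} (hr : 0 < r) :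
    sphProj w (r • (v : E)) = v := by
  have hv : ‖(v : E)‖ = 1 := mem_sphere_zero_iff_norm.1 v.2
  have h : r • (v : E) ≠ 0 := smul_ne_zero hr.ne' (by rw [← norm_ne_zero_iff, hv]; exact one_ne_zero)
  ext1
  rw [coe_sphProj w h, norm_smul, hv, mul_one, Real.norm_of_nonneg hr.le, smul_smul,
    inv_mul_cancel₀ hr.ne', one_smul]

lemma norm_cos_smul_add_sin_smul {w y : E} (hw : ‖w‖ = 1) (hy : ‖y‖ = 1) (h : inner ℝ w y = 0)
    (θ : ℝ) : ‖Real.cos θ • w + Real.sin θ • y‖ = 1 := by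
  have : ‖Real.cos θ • w + Real.sin θ • y‖ ^ 2 = 1 := by
    rw [norm_add_sq_real, norm_smul, norm_smul, inner_smul_left, inner_smul_right, h, hw, hy]
    simp
  nlinarith [norm_nonneg (Real.cos θ • w + Real.sin θ • y)]

/-- The point of the sphere with polar angle `θ` from the pole `w` and with azimuth `η`. -/
def slicePoint (w : Metric.sphere (0 : E) 1)
    (p : Metric.sphere (0 : (Submodule.span ℝ {(w : E)})ᗮ) 1 × ℝ) : Metric.sphere (0 : E) 1 :=
  ⟨Real.cos p.2 • (w : E) + Real.sin p.2 • ((p.1 : (Submodule.span ℝ {(w : E)})ᗮ) : E), by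
    rw [mem_sphere_zero_iff_norm]
    refine norm_cos_smul_add_sin_smul (mem_sphere_zero_iff_norm.1 w.2) ?_ ?_ _
    · exact mem_sphere_zero_iff_norm.1 p.1.2
    · exact Submodule.mem_orthogonal_singleton_iff_inner_right.1 p.1.1.2⟩

lemma continuous_slicePoint (w : Metric.sphere (0 : E) 1) : Continuous (slicePoint w) := by
  refine Continuous.subtype_mk ?_ _
  fun_prop

/-- The radial factor of an integral over the unit ball. It only has to be cancellable, so its value
is not recorded. -/
lemma lintegral_smul_indicator_Iio (n : ℕ) : ∃ c : ℝ≥0∞, c ≠ 0 ∧ c ≠ ⊤ ∧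
    ∀ a : ℝ≥0∞, ∫⁻ r in Set.Ioi (0 : ℝ), ENNReal.ofReal (r ^ n) * (Set.Iio (1 : ℝ)).indicator
      (fun _ => a) r = c * a := by
  refine ⟨∫⁻ r in Set.Ioo (0 : ℝ) 1, ENNReal.ofReal (r ^ n), ?_, ?_, fun a => ?_⟩
  · rw [← pos_iff_ne_zero, setLIntegral_pos_iff (by fun_prop)]
    refine lt_of_lt_of_le ?_ (measure_mono (s := Set.Ioo (0 : ℝ) 1) fun r hr => ⟨?_, hr⟩)
    · simp
    · simpa using pow_pos hr.1 n
  · refine ne_top_of_le_ne_top (b := ∫⁻ r in Set.Ioo (0 : ℝ) 1, 1) (by simp) ?_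
    refine setLIntegral_mono measurable_const fun r hr => ?_
    rw [← ENNReal.ofReal_one]
    exact ENNReal.ofReal_le_ofReal (pow_le_one₀ hr.1.le hr.2.le)
  · have : ∀ r : ℝ, ENNReal.ofReal (r ^ n) * (Set.Iio (1 : ℝ)).indicator (fun _ => a) r =
        (Set.Iio (1 : ℝ)).indicator (fun r => ENNReal.ofReal (r ^ n) * a) r := by
      intro r
      by_cases h : r ∈ Set.Iio (1 : ℝ)
      · rw [Set.indicator_of_mem h, Set.indicator_of_mem h]
      · rw [Set.indicator_of_notMem h, Set.indicator_of_notMem h, mul_zero]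
    simp_rw [this]
    rw [lintegral_indicator measurableSet_Iio, Measure.restrict_restrict measurableSet_Iio,
      lintegral_mul_const _ (by fun_prop), Set.inter_comm, Set.Ioi_inter_Iio]

/-- Planar polar coordinates for the integrand extended by zero to the lower half plane; angles in
(-π, 0] then contribute nothing. -/
lemma lintegral_halfPlane_polar (n : ℕ) {g : ℝ × ℝ → ℝ≥0∞} (hg : Measurable g) :
    ∫⁻ t : ℝ, ∫⁻ ρ in Set.Ioi (0 : ℝ), ENNReal.ofReal (ρ ^ n) * g (t, ρ) =
      ∫⁻ θ in Set.Ioo 0 Real.pi, ENNReal.ofReal (Real.sin θ ^ n) *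
        ∫⁻ r in Set.Ioi (0 : ℝ), ENNReal.ofReal (r ^ (n + 1)) *
          g (r * Real.cos θ, r * Real.sin θ) := by
  set h : ℝ × ℝ → ℝ≥0∞ := (Set.univ ×ˢ Set.Ioi (0 : ℝ)).indicator
    fun z => ENNReal.ofReal (z.2 ^ n) * g z with hh
  have hhm : Measurable h := by
    refine Measurable.indicator (by fun_prop) (MeasurableSet.univ.prod measurableSet_Ioi)
  have h1 : ∫⁻ t : ℝ, ∫⁻ ρ in Set.Ioi (0 : ℝ), ENNReal.ofReal (ρ ^ n) * g (t, ρ) =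
      ∫⁻ z : ℝ × ℝ, h z := by
    rw [Measure.volume_eq_prod, lintegral_prod _ hhm.aemeasurable]
    refine lintegral_congr fun t => ?_
    rw [← lintegral_indicator measurableSet_Ioi]
    refine lintegral_congr fun ρ => ?_
    by_cases hρ : ρ ∈ Set.Ioi (0 : ℝ)
    · rw [Set.indicator_of_mem hρ, hh, Set.indicator_of_mem (by simpa using hρ)]
    · rw [Set.indicator_of_notMem hρ, hh, Set.indicator_of_notMem (by simpa using hρ)]
  rw [h1, ← lintegral_comp_polarCoord_symm, polarCoord_target, Measure.volume_eq_prod,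
    ← Measure.prod_restrict, lintegral_prod_symm]
  swap
  · refine Measurable.aemeasurable ?_
    have : Measurable fun p : ℝ × ℝ => h (polarCoord.symm p) := by
      simp only [polarCoord_symm_apply]
      exact hhm.comp (by fun_prop)
    simp only [smul_eq_mul]
    fun_prop
  have hsub : Set.Ioo (-Real.pi) Real.pi = Set.Ioc (-Real.pi) 0 ∪ Set.Ioo 0 Real.pi := by
    rw [Set.Ioc_union_Ioo_eq_Ioo (by linarith [Real.pi_pos]) Real.pi_pos]
  rw [hsub, lintegral_union measurableSet_Ioo
    (Set.disjoint_left.2 fun x hx hx' => absurd hx'.1 (not_lt.2 hx.2))]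
  have hz : ∫⁻ y in Set.Ioc (-Real.pi) 0, ∫⁻ x in Set.Ioi (0 : ℝ),
      ENNReal.ofReal (x, y).1 • h (polarCoord.symm (x, y)) = 0 := by
    rw [setLIntegral_congr_fun (g := fun _ => 0) measurableSet_Ioc, lintegral_zero]
    intro θ hθ
    simp only
    rw [setLIntegral_congr_fun (g := fun _ => 0) measurableSet_Ioi, lintegral_zero]
    intro r hr
    simp only [polarCoord_symm_apply]
    rw [hh, Set.indicator_of_notMem, smul_zero]
    have hs : Real.sin θ ≤ 0 := Real.sin_nonpos_of_nonpos_of_neg_pi_le hθ.2 hθ.1.le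
    have : r * Real.sin θ ≤ 0 := mul_nonpos_of_nonneg_of_nonpos (le_of_lt hr) hs
    simpa using this
  rw [hz, zero_add]
  refine setLIntegral_congr_fun measurableSet_Ioo fun θ hθ => ?_
  have hs : 0 < Real.sin θ := Real.sin_pos_of_pos_of_lt_pi hθ.1 hθ.2
  simp only
  rw [← lintegral_const_mul _ (by fun_prop)]
  refine setLIntegral_congr_fun measurableSet_Ioi fun r hr => ?_
  have hr' : 0 < r := hr
  simp only [polarCoord_symm_apply]
  rw [hh, Set.indicator_of_mem (by simpa using mul_pos hr' hs), smul_eq_mul, ← mul_assoc,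
    ← mul_assoc, ← ENNReal.ofReal_mul hr'.le, ← ENNReal.ofReal_mul (by positivity)]
  congr 2
  ring

/-- The surface measure of the sphere in polar coordinates with pole `w`. -/
lemma toSphere_eq_map_slicePoint {m : ℕ} (hE : Module.finrank ℝ E = m + 2)
    (w : Metric.sphere (0 : E) 1) :
    (volume : Measure E).toSphere = Measure.map (slicePoint w)
      ((volume : Measure (Submodule.span ℝ {(w : E)})ᗮ).toSphere.prod
        ((volume.restrict (Set.Ioo 0 Real.pi)).withDensity
          fun θ => ENNReal.ofReal (Real.sin θ ^ m))) := by
  have hwn : ‖(w : E)‖ = 1 := mem_sphere_zero_iff_norm.1 w.2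
  have hfact : Fact (Module.finrank ℝ E = (m + 1) + 1) := ⟨hE⟩
  have hK : Module.finrank ℝ (Submodule.span ℝ {(w : E)})ᗮ = m + 1 :=
    Submodule.finrank_orthogonal_span_singleton (by rw [← norm_ne_zero_iff, hwn]; exact one_ne_zero)
  have : Nontrivial E := Module.nontrivial_of_finrank_pos (R := ℝ) (by omega)
  have : Nontrivial (Submodule.span ℝ {(w : E)})ᗮ :=
    Module.nontrivial_of_finrank_pos (R := ℝ) (by omega)
  refine Measure.ext_of_lintegral _ fun G hG => ?_
  have hmd : Measurable fun θ : ℝ => ENNReal.ofReal (Real.sin θ ^ m) := by fun_prop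
  rw [lintegral_map hG (continuous_slicePoint w).measurable,
    lintegral_prod (fun z => G (slicePoint w z)) (hG.comp (continuous_slicePoint w).measurable).aemeasurable]
  -- G is extended to be homogeneous of degree 0 and cut off to the unit ball. The integral of this
  -- Φ over E is computed in two ways, both with the radial factor c, which is then cancelled.
  obtain ⟨c, hc0, hct, hc⟩ := lintegral_smul_indicator_Iio (m + 1)
  set Φ : E → ℝ≥0∞ := fun x => (Set.Iio (1 : ℝ)).indicator (fun _ => G (sphProj w x)) ‖x‖ with hΦd
  have hΦ : Measurable Φ := by
    have : Φ = (norm ⁻¹' Set.Iio (1 : ℝ)).indicator (fun x => G (sphProj w x)) := by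
      ext x; simp [hΦd, Set.indicator]
    rw [this]
    exact (hG.comp (measurable_sphProj w)).indicator (measurable_norm measurableSet_Iio)
  have hval : ∀ (v : Metric.sphere (0 : E) 1) (r : ℝ), 0 < r →
      Φ (r • (v : E)) = (Set.Iio (1 : ℝ)).indicator (fun _ => G v) r := by
    intro v r hr
    have hv : ‖(v : E)‖ = 1 := mem_sphere_zero_iff_norm.1 v.2
    simp only [hΦd]
    rw [sphProj_smul w v hr, norm_smul, hv, mul_one, Real.norm_of_nonneg hr.le]
  have hL : ∫⁻ x, Φ x = c * ∫⁻ v, G v ∂(volume : Measure E).toSphere := by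
    rw [lintegral_polar hΦ, hE, ← lintegral_const_mul _ hG]
    refine lintegral_congr fun v => ?_
    rw [← hc]
    refine setLIntegral_congr_fun measurableSet_Ioi fun r hr => ?_
    rw [hval v r hr]
    rfl
  -- Split off the axis ℝw, take polar coordinates in its complement, and then polar coordinates in
  -- the half plane of (t, ρ): the factor ρ^m becomes sin^m θ · r^m, and the planar Jacobian makes
  -- it r^{m+1}.
  have hR : ∫⁻ x, Φ x = c * ∫⁻ η, ∫⁻ θ, G (slicePoint w (η, θ))
      ∂((volume.restrict (Set.Ioo 0 Real.pi)).withDensity fun θ => ENNReal.ofReal (Real.sin θ ^ m))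
      ∂(volume : Measure (Submodule.span ℝ {(w : E)})ᗮ).toSphere := by
    rw [lintegral_eq_lintegral_orthogonal hwn hΦ]
    have e1 : ∀ t : ℝ, ∫⁻ y : (Submodule.span ℝ {(w : E)})ᗮ, Φ (t • (w : E) + y) =
        ∫⁻ η : Metric.sphere (0 : (Submodule.span ℝ {(w : E)})ᗮ) 1, ∫⁻ ρ in Set.Ioi (0 : ℝ),
          ENNReal.ofReal (ρ ^ m) *
            Φ (t • (w : E) + ρ • ((η : (Submodule.span ℝ {(w : E)})ᗮ) : E))
          ∂(volume : Measure ℝ) ∂(volume : Measure (Submodule.span ℝ {(w : E)})ᗮ).toSphere := by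
      intro t
      have hm : Measurable fun y : (Submodule.span ℝ {(w : E)})ᗮ => Φ (t • (w : E) + y) :=
        hΦ.comp (Continuous.measurable (by fun_prop))
      rw [lintegral_polar hm, hK]
      rfl
    simp_rw [e1]
    rw [lintegral_lintegral_swap]
    swap
    · refine Measurable.aemeasurable ?_
      have : Measurable fun q : (ℝ × Metric.sphere (0 : (Submodule.span ℝ {(w : E)})ᗮ) 1) × ℝ =>
          ENNReal.ofReal (q.2 ^ m) *
            Φ (q.1.1 • (w : E) + q.2 • ((q.1.2 : (Submodule.span ℝ {(w : E)})ᗮ) : E)) := by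
        refine Measurable.mul (by fun_prop) (hΦ.comp ?_)
        exact Continuous.measurable (by fun_prop)
      exact this.lintegral_prod_right'
    rw [← lintegral_const_mul]
    swap
    · exact Measurable.lintegral_prod_right' (hG.comp (continuous_slicePoint w).measurable)
    refine lintegral_congr fun η => ?_
    rw [lintegral_halfPlane_polar m
      (g := fun z => Φ (z.1 • (w : E) + z.2 • ((η : (Submodule.span ℝ {(w : E)})ᗮ) : E)))
      (hΦ.comp (Continuous.measurable (by fun_prop)))]
    have hGm : Measurable fun θ : ℝ => G (slicePoint w (η, θ)) :=
      hG.comp ((continuous_slicePoint w).measurable.comp measurable_prodMk_left)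
    rw [lintegral_withDensity_eq_lintegral_mul _ hmd hGm,
      ← lintegral_const_mul _ (hmd.mul hGm)]
    refine lintegral_congr fun θ => ?_
    simp only [Pi.mul_apply]
    rw [mul_left_comm, ← hc]
    congr 1
    refine setLIntegral_congr_fun measurableSet_Ioi fun r hr => ?_
    rw [← hval _ r hr]
    simp only [slicePoint, smul_add, smul_smul]
  exact (ENNReal.mul_right_inj hc0 hct).1 (hL.symm.trans hR)

end Slices

end KineticTransport

end

/-! ### Integrals over parallels and the Funk-Hecke formula -/

noncomputable section

namespace KineticTransport

open Polynomial
open scoped Pointwise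

section SliceIntegrals

variable {E : Type*} [NormedAddCommGroup E] [InnerProductSpace ℝ E] [FiniteDimensional ℝ E]
  [MeasurableSpace E] [BorelSpace E]

lemma integral_toSphere_slice {m : ℕ} (hE : Module.finrank ℝ E = m + 2)
    (w : Metric.sphere (0 : E) 1) {F : Metric.sphere (0 : E) 1 → ℂ} (hF : Continuous F) :
    ∫ v, F v ∂(volume : Measure E).toSphere =
      ∫ θ in (0 : ℝ)..Real.pi, ((Real.sin θ ^ m : ℝ) : ℂ) * ∫ η, F (slicePoint w (η, θ))
        ∂(volume : Measure (Submodule.span ℝ {(w : E)})ᗮ).toSphere := by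
  have hmd : Measurable fun θ : ℝ => Real.toNNReal (Real.sin θ ^ m) := by fun_prop
  have hfin : IsFiniteMeasure ((volume.restrict (Set.Ioo 0 Real.pi)).withDensity
      fun θ => ENNReal.ofReal (Real.sin θ ^ m)) := by
    refine isFiniteMeasure_withDensity_ofReal ?_
    refine HasFiniteIntegral.of_bounded (C := 1) (Filter.Eventually.of_forall fun θ => ?_)
    rw [norm_pow, Real.norm_eq_abs]
    exact pow_le_one₀ (abs_nonneg _) (Real.abs_sin_le_one θ)
  have hFs : Continuous fun z => F (slicePoint w z) := hF.comp (continuous_slicePoint w)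
  obtain ⟨M, hM⟩ := (isCompact_range hF).isBounded.exists_norm_le
  rw [toSphere_eq_map_slicePoint hE w, integral_map (continuous_slicePoint w).measurable.aemeasurable
    hF.aestronglyMeasurable, integral_prod_symm]
  · rw [intervalIntegral.integral_of_le Real.pi_pos.le, integral_Ioc_eq_integral_Ioo]
    simp only [ENNReal.ofReal]
    rw [integral_withDensity_eq_integral_smul hmd]
    refine setIntegral_congr_fun measurableSet_Ioo fun θ hθ => ?_
    have hs : 0 ≤ Real.sin θ := (Real.sin_pos_of_pos_of_lt_pi hθ.1 hθ.2).le
    simp only [NNReal.smul_def, Real.coe_toNNReal _ (pow_nonneg hs m), Complex.real_smul]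
  · refine Integrable.of_bound hFs.aestronglyMeasurable M (Filter.Eventually.of_forall fun z => ?_)
    exact hM _ ⟨_, rfl⟩

/-- The antipodal map preserves the surface measure and changes the sign of an odd power. -/
lemma integral_inner_pow_odd (F : Type*) [NormedAddCommGroup F] [InnerProductSpace ℝ F]
    [FiniteDimensional ℝ F] [MeasurableSpace F] [BorelSpace F] (g : F →ₗ[ℝ] ℝ) {n : ℕ} (hn : Odd n) :
    ∫ η : Metric.sphere (0 : F) 1, g η ^ n ∂(volume : Measure F).toSphere = 0 := by
  have hmp : MeasurePreserving (fun η : Metric.sphere (0 : F) 1 => -η)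
      (volume : Measure F).toSphere (volume : Measure F).toSphere := by
    refine ⟨continuous_neg.measurable, ?_⟩
    ext s hs
    rw [Measure.map_apply continuous_neg.measurable hs, Measure.toSphere_apply' _ hs,
      Measure.toSphere_apply' _ (continuous_neg.measurable hs)]
    congr 1
    have : Set.Ioo (0 : ℝ) 1 • ((↑) '' ((fun η : Metric.sphere (0 : F) 1 => -η) ⁻¹' s) : Set F) =
        -(Set.Ioo (0 : ℝ) 1 • ((↑) '' s : Set F)) := by
      ext x
      simp only [Set.mem_smul, Set.mem_image, Set.mem_preimage, Set.mem_neg]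
      constructor
      · rintro ⟨r, hr, y, ⟨η, hη, rfl⟩, rfl⟩
        exact ⟨r, hr, _, ⟨-η, hη, rfl⟩, by simp⟩
      · rintro ⟨r, hr, y, ⟨η, hη, rfl⟩, h⟩
        refine ⟨r, hr, _, ⟨-η, by simpa using hη, rfl⟩, ?_⟩
        rw [← neg_neg x, ← h]; simp
    rw [this, Measure.measure_neg]
  have h := hmp.integral_comp' (f := (Homeomorph.neg (Metric.sphere (0 : F) 1)).toMeasurableEquiv)
    (fun η : Metric.sphere (0 : F) 1 => g η ^ n)
  have h2 : ∀ η : Metric.sphere (0 : F) 1,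
      g (((Homeomorph.neg (Metric.sphere (0 : F) 1)).toMeasurableEquiv η : Metric.sphere (0 : F) 1) : F) ^ n
        = -(g η ^ n) := by
    intro η
    have : (((Homeomorph.neg (Metric.sphere (0 : F) 1)).toMeasurableEquiv η :
      Metric.sphere (0 : F) 1) : F) = -η := rfl
    rw [this, map_neg, hn.neg_pow]
  simp_rw [h2, integral_neg] at h
  linarith

/-- On the parallel at angle θ the inner product with w' is cos θ ⟨w, w'⟩ plus sin θ times a linear
form in the azimuth. Odd moments of that form vanish, so only even powers of sin θ survive and the
integral is a polynomial in cos θ. At θ = 0 only the zeroth moment remains. -/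
lemma integral_slice_pow (w w' : Metric.sphere (0 : E) 1) (n : ℕ) :
    ∃ B : ℝ[X], B.natDegree ≤ n ∧
      B.eval 1 = (volume : Measure (Submodule.span ℝ {(w : E)})ᗮ).toSphere.real Set.univ *
        (inner ℝ (w : E) (w' : E) : ℝ) ^ n ∧
      ∀ θ : ℝ, ∫ η, (inner ℝ (slicePoint w (η, θ) : E) (w' : E) : ℝ) ^ n
        ∂(volume : Measure (Submodule.span ℝ {(w : E)})ᗮ).toSphere = B.eval (Real.cos θ) := by
  set F := (Submodule.span ℝ {(w : E)})ᗮ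
  set c : ℝ := inner ℝ (w : E) (w' : E)
  set g : F →ₗ[ℝ] ℝ := (innerₗ E (w' : E)) ∘ₗ F.subtype with hg
  have hgc : Continuous fun η : Metric.sphere (0 : F) 1 => g η :=
    g.continuous_of_finiteDimensional.comp continuous_subtype_val
  set M : ℕ → ℝ := fun i => ∫ η : Metric.sphere (0 : F) 1, g η ^ i ∂(volume : Measure F).toSphere
  have hM : ∀ i, Odd i → M i = 0 := fun i hi => integral_inner_pow_odd F g hi
  have hint : ∀ i, Integrable (fun η : Metric.sphere (0 : F) 1 => g η ^ i)
      (volume : Measure F).toSphere := by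
    intro i
    obtain ⟨R, hR⟩ := (isCompact_range (hgc.pow i)).isBounded.exists_norm_le
    exact Integrable.of_bound (hgc.pow i).aestronglyMeasurable R
      (Filter.Eventually.of_forall fun z => hR _ ⟨_, rfl⟩)
  refine ⟨∑ i ∈ Finset.range (n + 1), C (M i * c ^ (n - i) * n.choose i) *
    ((1 - X ^ 2) ^ (i / 2) * X ^ (n - i)), ?_, ?_, ?_⟩
  · refine natDegree_sum_le_of_forall_le _ _ fun i hi => ?_
    have hi' : i ≤ n := Nat.lt_succ_iff.1 (Finset.mem_range.1 hi)
    refine (natDegree_C_mul_le _ _).trans ?_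
    refine natDegree_mul_le.trans ?_
    have h1 : ((1 - X ^ 2 : ℝ[X]) ^ (i / 2)).natDegree ≤ (i / 2) * 2 := by
      refine natDegree_pow_le.trans (Nat.mul_le_mul le_rfl ?_)
      compute_degree
    have h2 := natDegree_X_pow_le (R := ℝ) (n - i)
    have := Nat.div_mul_le_self i 2
    omega
  · rw [eval_finsetSum, Finset.sum_eq_single 0]
    · have hM0 : M 0 = (volume : Measure F).toSphere.real Set.univ := by
        simp only [M, pow_zero, integral_const, smul_eq_mul, mul_one]
      rw [hM0]; simp; exact Or.inl (Or.inl rfl)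
    · intro i hi hi0
      rcases Nat.even_or_odd i with h | h
      · have : i / 2 ≠ 0 := by
          obtain ⟨j, rfl⟩ := h
          omega
        simp [this]
      · simp [hM i h]
    · simp
  · intro θ
    have e : ∀ η : Metric.sphere (0 : F) 1, (inner ℝ (slicePoint w (η, θ) : E) (w' : E) : ℝ) ^ n =
        ∑ i ∈ Finset.range (n + 1), (Real.sin θ ^ i * (Real.cos θ * c) ^ (n - i) * n.choose i) *
          g η ^ i := by
      intro η
      have : (inner ℝ (slicePoint w (η, θ) : E) (w' : E) : ℝ) =
          Real.sin θ * g η + Real.cos θ * c := by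
        simp only [slicePoint, inner_add_left, real_inner_smul_left, hg, LinearMap.comp_apply,
          innerₗ_apply_apply, Submodule.subtype_apply, c]
        rw [real_inner_comm (w' : E) ((η : F) : E), add_comm]
      rw [this, add_pow]
      refine Finset.sum_congr rfl fun i _ => ?_
      ring
    simp_rw [e]
    rw [integral_finsetSum _ fun i _ => (hint i).const_mul _, eval_finsetSum]
    refine Finset.sum_congr rfl fun i _ => ?_
    rw [integral_const_mul]
    change _ * M i = _
    simp only [eval_mul, eval_C, eval_pow, eval_sub, eval_one, eval_X]
    rcases Nat.even_or_odd i with h | h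
    · obtain ⟨j, rfl⟩ := h
      have h2 : (j + j) / 2 = j := by omega
      have h3 : Real.sin θ ^ (j + j) = (1 - Real.cos θ ^ 2) ^ j := by
        rw [← Real.sin_sq, ← pow_mul]; congr 1; omega
      rw [h2, h3, mul_pow]
      ring
    · rw [hM i h]; ring

end SliceIntegrals

variable {m : ℕ}

/-- The surface measure of the unit sphere of the orthogonal complement of a point of the sphere. -/
def kap (m : ℕ) : ℝ := (surf (m + 2)).real Set.univ / gegNormSq m 0

lemma finrank_space (d : ℕ) : Module.finrank ℝ (Space d) = d := by simp

lemma surf_univ_pos (m : ℕ) : 0 < (surf (m + 2)).real Set.univ := by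
  have h : surf (m + 2) ≠ 0 := Measure.toSphere_ne_zero _
  rw [Measure.real, ENNReal.toReal_pos_iff]
  exact ⟨pos_iff_ne_zero.2 (fun h' => h (Measure.measure_univ_eq_zero.1 h')), measure_lt_top _ _⟩

lemma kap_pos (m : ℕ) : 0 < kap m := div_pos (surf_univ_pos m) (gegNormSq_zero_pos m)

lemma integrable_surf_of_continuous {d : ℕ} {F : Sph d → ℂ} (hF : Continuous F) :
    Integrable F (surf d) := by
  obtain ⟨M, hM⟩ := (isCompact_range hF).isBounded.exists_norm_le
  exact Integrable.of_bound hF.aestronglyMeasurable M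
    (Filter.Eventually.of_forall fun z => hM _ ⟨_, rfl⟩)

/-- The slice formula for the constant function 1; in particular the mass is the same for all poles.
-/
lemma toSphere_orthogonal_univ (w : Sph (m + 2)) :
    (volume : Measure (Submodule.span ℝ {(w : Space (m + 2))})ᗮ).toSphere.real Set.univ = kap m := by
  have h := integral_toSphere_slice (m := m) (finrank_space (m + 2)) w
    (F := fun _ => (1 : ℂ)) continuous_const
  have h0 : gegNormSq m 0 = ∫ θ in (0 : ℝ)..Real.pi, Real.sin θ ^ m := by
    simp [gegNormSq, gegInner, geg_zero]
  simp only [integral_const, Complex.real_smul, mul_one] at h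
  rw [intervalIntegral.integral_mul_const, intervalIntegral.integral_ofReal, ← h0] at h
  rw [kap, eq_div_iff (gegNormSq_zero_pos m).ne', mul_comm]
  exact_mod_cast h.symm

lemma continuous_inner_sphere {d : ℕ} (w : Sph d) :
    Continuous fun v : Sph d => (inner ℝ (v : Space d) (w : Space d) : ℝ) :=
  continuous_subtype_val.inner continuous_const

lemma inner_slicePoint (w : Sph (m + 2))
    (p : Metric.sphere (0 : (Submodule.span ℝ {(w : Space (m + 2))})ᗮ) 1 × ℝ) :
    (inner ℝ (slicePoint w p : Space (m + 2)) (w : Space (m + 2)) : ℝ) = Real.cos p.2 := by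
  have hw : ‖(w : Space (m + 2))‖ = 1 := mem_sphere_zero_iff_norm.1 w.2
  have h : (inner ℝ ((p.1 : (Submodule.span ℝ {(w : Space (m + 2))})ᗮ) : Space (m + 2))
      (w : Space (m + 2)) : ℝ) = 0 := by
    rw [real_inner_comm]
    exact Submodule.mem_orthogonal_singleton_iff_inner_right.1 p.1.1.2
  simp only [slicePoint, inner_add_left, real_inner_smul_left, h, real_inner_self_eq_norm_sq, hw]
  simp

/-- Averaging a ridge polynomial with pole w' over the parallels around w does not raise the degree,
and B(1) is its value at w, to which the parallels shrink. By linearity only monomials matter. -/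
lemma exists_slice_polynomial (w w' : Sph (m + 2)) (N : ℕ) (q : ℝ[X]) (hq : q.natDegree ≤ N) :
    ∃ B : ℝ[X], B.natDegree ≤ N ∧
      B.eval 1 = q.eval (inner ℝ (w : Space (m + 2)) (w' : Space (m + 2))) ∧
      ∀ ψ : ℝ → ℂ, Continuous ψ →
        ∫ v : Sph (m + 2), ((q.eval (inner ℝ (v : Space (m + 2)) (w' : Space (m + 2))) : ℝ) : ℂ) *
          ψ (inner ℝ (v : Space (m + 2)) (w : Space (m + 2))) ∂(surf (m + 2)) =
        kap m * ∫ θ in (0 : ℝ)..Real.pi, ((B.eval (Real.cos θ) : ℝ) : ℂ) * ψ (Real.cos θ) *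
          ((Real.sin θ ^ m : ℝ) : ℂ) := by
  revert hq
  refine induction_with_natDegree_le (motive := fun q => ∃ B : ℝ[X], B.natDegree ≤ N ∧
      B.eval 1 = q.eval (inner ℝ (w : Space (m + 2)) (w' : Space (m + 2))) ∧
      ∀ ψ : ℝ → ℂ, Continuous ψ →
        ∫ v : Sph (m + 2), ((q.eval (inner ℝ (v : Space (m + 2)) (w' : Space (m + 2))) : ℝ) : ℂ) *
          ψ (inner ℝ (v : Space (m + 2)) (w : Space (m + 2))) ∂(surf (m + 2)) =
        kap m * ∫ θ in (0 : ℝ)..Real.pi, ((B.eval (Real.cos θ) : ℝ) : ℂ) * ψ (Real.cos θ) *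
          ((Real.sin θ ^ m : ℝ) : ℂ)) N ?_ ?_ ?_ q
  · exact ⟨0, by simp, by simp, by simp⟩
  · intro n r _ hn
    obtain ⟨B, hB1, hB2, hB3⟩ := integral_slice_pow w w' n
    rw [toSphere_orthogonal_univ] at hB2
    have hk := (kap_pos m).ne'
    -- Division by `kap m`, the total mass of the azimuthal sphere, turns the integral over a
    -- parallel into an average.
    refine ⟨C (r / kap m) * B, (natDegree_C_mul_le _ _).trans (hB1.trans hn), ?_, fun ψ hψ => ?_⟩
    · simp only [eval_mul, eval_C, hB2, eval_pow, eval_X]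
      field_simp
    · have hcont : Continuous fun v : Sph (m + 2) =>
          ((eval (inner ℝ (v : Space (m + 2)) (w' : Space (m + 2))) (C r * X ^ n) : ℝ) : ℂ) *
          ψ (inner ℝ (v : Space (m + 2)) (w : Space (m + 2))) :=
        (Complex.continuous_ofReal.comp ((C r * X ^ n).continuous.comp
          (continuous_inner_sphere w'))).mul (hψ.comp (continuous_inner_sphere w))
      rw [surf, integral_toSphere_slice (m := m) (finrank_space (m + 2)) w hcont,
        ← intervalIntegral.integral_const_mul]
      refine intervalIntegral.integral_congr fun θ _ => ?_
      simp only [inner_slicePoint]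
      rw [integral_mul_const, integral_complex_ofReal]
      simp only [eval_mul, eval_C, eval_pow, eval_X]
      rw [integral_const_mul, hB3]
      push_cast
      have hk' : ((kap m : ℝ) : ℂ) ≠ 0 := by exact_mod_cast hk
      field_simp
  · rintro f g _ _ ⟨B1, h1, h2, h3⟩ ⟨B2, h1', h2', h3'⟩
    refine ⟨B1 + B2, (natDegree_add_le _ _).trans (max_le h1 h1'), by simp [h2, h2'], fun ψ hψ => ?_⟩
    have hc : ∀ f : ℝ[X], Continuous fun v : Sph (m + 2) =>
          ((eval (inner ℝ (v : Space (m + 2)) (w' : Space (m + 2))) f : ℝ) : ℂ) *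
          ψ (inner ℝ (v : Space (m + 2)) (w : Space (m + 2))) := fun f =>
        (Complex.continuous_ofReal.comp (f.continuous.comp
          (continuous_inner_sphere w'))).mul (hψ.comp (continuous_inner_sphere w))
    have hc2 : ∀ B : ℝ[X], Continuous fun θ : ℝ => ((B.eval (Real.cos θ) : ℝ) : ℂ) *
        ψ (Real.cos θ) * ((Real.sin θ ^ m : ℝ) : ℂ) := fun B =>
      ((Complex.continuous_ofReal.comp (B.continuous.comp Real.continuous_cos)).mul
        (hψ.comp Real.continuous_cos)).mul
        (Complex.continuous_ofReal.comp (Real.continuous_sin.pow m))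
    simp only [eval_add, Complex.ofReal_add, add_mul]
    rw [integral_add (integrable_surf_of_continuous (hc f)) (integrable_surf_of_continuous (hc g)),
      h3 ψ hψ, h3' ψ hψ, intervalIntegral.integral_add ((hc2 B1).intervalIntegrable _ _)
        ((hc2 B2).intervalIntegrable _ _), mul_add]

/-- The zonal function of degree `k` with pole `w`. -/
def zon (m k : ℕ) (w v : Sph (m + 2)) : ℝ :=
  (geg m k).eval (inner ℝ (v : Space (m + 2)) (w : Space (m + 2)))

lemma zon_comm (k : ℕ) (w v : Sph (m + 2)) : zon m k w v = zon m k v w := by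
  rw [zon, zon, real_inner_comm]

lemma zon_self (k : ℕ) (w : Sph (m + 2)) : zon m k w w = 1 := by
  rw [zon, real_inner_self_eq_norm_sq, mem_sphere_zero_iff_norm.1 w.2, one_pow, geg_eval_one]

lemma continuous_zon_uncurry (k : ℕ) :
    Continuous fun p : Sph (m + 2) × Sph (m + 2) => zon m k p.1 p.2 :=
  (geg m k).continuous.comp
    ((continuous_subtype_val.comp continuous_snd).inner (continuous_subtype_val.comp continuous_fst))

lemma continuous_zon (k : ℕ) (w : Sph (m + 2)) : Continuous (zon m k w) :=
  (continuous_zon_uncurry k).comp (Continuous.prodMk continuous_const continuous_id)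

lemma gegInner_eq_zero_of_natDegree_lt {p : ℝ[X]} {k : ℕ} (hp : p.natDegree < k) :
    gegInner m p (geg m k) = 0 := by
  obtain ⟨c, hc⟩ := mem_span_geg_of_natDegree_le m p.natDegree (le_refl p.natDegree)
  rw [← gegForm_apply, hc, map_sum]
  refine Finset.sum_eq_zero fun j hj => ?_
  have : j ≠ k := by have := Finset.mem_range.1 hj; omega
  rw [map_smul, gegForm_apply, gegInner_geg_of_ne m this, smul_zero]

lemma integral_gegIntegrand_ofReal (p q : ℝ[X]) :
    ∫ θ in (0 : ℝ)..Real.pi, ((p.eval (Real.cos θ) : ℝ) : ℂ) * ((q.eval (Real.cos θ) : ℝ) : ℂ) *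
      ((Real.sin θ ^ m : ℝ) : ℂ) = gegInner m p q := by
  rw [gegInner, ← intervalIntegral.integral_ofReal]
  simp

/-- The Funk-Hecke formula for zonal functions. -/
lemma integral_zon_mul (k : ℕ) (w w' : Sph (m + 2)) {ψ : ℝ → ℂ} (hψ : Continuous ψ) :
    ∫ v : Sph (m + 2), (zon m k w' v : ℂ) *
        ψ (inner ℝ (v : Space (m + 2)) (w : Space (m + 2))) ∂(surf (m + 2)) =
      zon m k w' w * (kap m * ∫ θ in (0 : ℝ)..Real.pi, (((geg m k).eval (Real.cos θ) : ℝ) : ℂ) *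
        ψ (Real.cos θ) * ((Real.sin θ ^ m : ℝ) : ℂ)) := by
  obtain ⟨B, hB1, hB2, hB3⟩ := exists_slice_polynomial w w' k (geg m k)
    (natDegree_le_of_degree_le (geg_degree m k).le)
  have hk : ((kap m : ℝ) : ℂ) ≠ 0 := by exact_mod_cast (kap_pos m).ne'
  -- The integral over v of P_k(⟨v, w'⟩) P_j(⟨v, w⟩) is sliced around either pole. Slicing around w
  -- gives B against P_j; slicing around w' gives P_k against a polynomial of degree at most j < k,
  -- which is zero. Hence B is a multiple of P_k.
  have horth : ∀ j < k, gegInner m B (geg m j) = 0 := by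
    intro j hj
    obtain ⟨D, hD1, -, hD3⟩ := exists_slice_polynomial w' w j (geg m j)
      (natDegree_le_of_degree_le (geg_degree m j).le)
    have e1 := hB3 (fun t => (((geg m j).eval t : ℝ) : ℂ))
      (Complex.continuous_ofReal.comp (geg m j).continuous)
    have e2 := hD3 (fun t => (((geg m k).eval t : ℝ) : ℂ))
      (Complex.continuous_ofReal.comp (geg m k).continuous)
    rw [integral_gegIntegrand_ofReal] at e1 e2
    rw [gegInner_eq_zero_of_natDegree_lt (lt_of_le_of_lt hD1 hj)] at e2
    simp_rw [mul_comm (((geg m k).eval _ : ℝ) : ℂ)] at e1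
    rw [e1] at e2
    simpa [hk] using e2
  have hB := eq_smul_geg_of_orthogonal m k hB1 horth
  have e : zon m k w' w = B.eval 1 := by rw [hB2]; rfl
  have := hB3 ψ hψ
  rw [e]
  simp only [zon]
  rw [this]
  conv_lhs => rw [hB]
  simp only [eval_smul, smul_eq_mul, Complex.ofReal_mul, mul_assoc]
  rw [intervalIntegral.integral_const_mul]
  ring

lemma integral_zon_mul_zon (k l : ℕ) (w w' : Sph (m + 2)) :
    ∫ v : Sph (m + 2), (zon m k w' v : ℂ) * (zon m l w v : ℂ) ∂(surf (m + 2)) =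
      zon m k w' w * (kap m * gegInner m (geg m k) (geg m l)) := by
  have := integral_zon_mul k w w' (ψ := fun t => (((geg m l).eval t : ℝ) : ℂ))
      (Complex.continuous_ofReal.comp (geg m l).continuous)
  rw [integral_gegIntegrand_ofReal] at this
  exact this

end KineticTransport

end

/-! ### Spherical harmonics: zonal reproducing kernels and completeness -/

noncomputable section

namespace KineticTransport

open Polynomial
open scoped InnerProductSpace

variable {m : ℕ}

/-- The Hilbert space `L²` of the sphere. -/
abbrev SphL2 (d : ℕ) : Type := Lp ℂ 2 (surf d)

/-- The zonal function of degree `k` as a continuous map, jointly in the pole. -/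
def zonC (m k : ℕ) : C(Sph (m + 2), C(Sph (m + 2), ℂ)) :=
  ContinuousMap.curry ⟨fun p => (zon m k p.1 p.2 : ℂ),
    Complex.continuous_ofReal.comp (continuous_zon_uncurry k)⟩

lemma zonC_apply (k : ℕ) (w v : Sph (m + 2)) : zonC m k w v = zon m k w v := rfl

/-- The zonal function of degree `k` and pole `w` as an element of `L²`. -/
def zonL (m k : ℕ) (w : Sph (m + 2)) : SphL2 (m + 2) :=
  ContinuousMap.toLp 2 (surf (m + 2)) ℂ (zonC m k w)

lemma continuous_zonL (k : ℕ) : Continuous (zonL m k) :=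
  (ContinuousMap.toLp 2 (surf (m + 2)) ℂ).continuous.comp (zonC m k).continuous

lemma coeFn_zonL (k : ℕ) (w : Sph (m + 2)) :
    zonL m k w =ᵐ[surf (m + 2)] fun v => (zon m k w v : ℂ) :=
  ContinuousMap.coeFn_toLp (p := 2) (𝕜 := ℂ) (surf (m + 2)) (zonC m k w)

lemma inner_zonL_left (k : ℕ) (w : Sph (m + 2)) (Y : SphL2 (m + 2)) :
    ⟪zonL m k w, Y⟫_ℂ = ∫ v, (zon m k w v : ℂ) * Y v ∂(surf (m + 2)) := by
  rw [L2.inner_def]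
  refine integral_congr_ae ?_
  filter_upwards [coeFn_zonL k w] with v hv
  rw [hv, RCLike.inner_apply, Complex.conj_ofReal, mul_comm]

lemma inner_zonL_zonL (k l : ℕ) (w w' : Sph (m + 2)) :
    ⟪zonL m k w, zonL m l w'⟫_ℂ = zon m k w w' * (kap m * gegInner m (geg m k) (geg m l)) := by
  rw [inner_zonL_left, ← integral_zon_mul_zon]
  refine integral_congr_ae ?_
  filter_upwards [coeFn_zonL l w'] with v hv
  rw [hv]

/-- The squared norm of a zonal function of degree `k`. -/
def zonNormSq (m k : ℕ) : ℝ := kap m * gegNormSq m k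

lemma zonNormSq_pos (m k : ℕ) : 0 < zonNormSq m k := mul_pos (kap_pos m) (gegNormSq_pos m k)

lemma inner_zonL_zonL_same (k : ℕ) (w w' : Sph (m + 2)) :
    ⟪zonL m k w, zonL m k w'⟫_ℂ = zon m k w w' * zonNormSq m k := by
  rw [inner_zonL_zonL, zonNormSq, gegNormSq]; push_cast; rfl

lemma norm_zonL_sq (k : ℕ) (w : Sph (m + 2)) : ‖zonL m k w‖ ^ 2 = zonNormSq m k := by
  have h := inner_self_eq_norm_sq_to_K (𝕜 := ℂ) (zonL m k w)
  rw [inner_zonL_zonL_same, zon_self] at h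
  have h' : ((zonNormSq m k : ℝ) : ℂ) = ((‖zonL m k w‖ ^ 2 : ℝ) : ℂ) := by
    push_cast; simpa using h
  exact_mod_cast h'.symm

lemma norm_zonL (k : ℕ) (w : Sph (m + 2)) : ‖zonL m k w‖ = √(zonNormSq m k) := by
  rw [← norm_zonL_sq k w, Real.sqrt_sq (norm_nonneg _)]

/-- Cauchy-Schwarz for the reproducing kernel: up to the common squared norm, the value at (w, v) is
the inner product of two zonal functions. -/
lemma abs_zon_le_one (k : ℕ) (w v : Sph (m + 2)) : |zon m k w v| ≤ 1 := by
  have h := norm_inner_le_norm (𝕜 := ℂ) (zonL m k w) (zonL m k v)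
  rw [inner_zonL_zonL_same, norm_zonL, norm_zonL, Real.mul_self_sqrt (zonNormSq_pos m k).le,
    norm_mul, Complex.norm_real, Complex.norm_real, Real.norm_of_nonneg (zonNormSq_pos m k).le] at h
  exact le_of_mul_le_mul_right (by simpa using h) (zonNormSq_pos m k)

lemma exists_sphere_inner_eq (m : ℕ) {t : ℝ} (ht : t ∈ Set.Icc (-1 : ℝ) 1) :
    ∃ w v : Sph (m + 2), (inner ℝ (v : Space (m + 2)) (w : Space (m + 2)) : ℝ) = t := by
  set e0 : Space (m + 2) := EuclideanSpace.single 0 1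
  set e1 : Space (m + 2) := EuclideanSpace.single 1 1
  have h0 : ‖e0‖ = 1 := by simp [e0]
  have h1 : ‖e1‖ = 1 := by simp [e1]
  have h01 : (inner ℝ e0 e1 : ℝ) = 0 := by simp [e0, e1, EuclideanSpace.inner_single_left]
  refine ⟨⟨e0, mem_sphere_zero_iff_norm.2 h0⟩,
    ⟨Real.cos (Real.arccos t) • e0 + Real.sin (Real.arccos t) • e1,
      mem_sphere_zero_iff_norm.2 (norm_cos_smul_add_sin_smul h0 h1 h01 _)⟩, ?_⟩
  simp only [inner_add_left, real_inner_smul_left]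
  rw [real_inner_comm e0 e1, h01, real_inner_self_eq_norm_sq, h0, Real.cos_arccos ht.1 ht.2]
  simp

lemma abs_geg_eval_le_one (m k : ℕ) {t : ℝ} (ht : t ∈ Set.Icc (-1 : ℝ) 1) :
    |(geg m k).eval t| ≤ 1 := by
  obtain ⟨w, v, h⟩ := exists_sphere_inner_eq m ht
  rw [← h]
  exact abs_zon_le_one k w v

/-- The closed subspace of `L²` spanned by the zonal functions of degree `k`. -/
def zonSpace (m k : ℕ) : Submodule ℂ (SphL2 (m + 2)) :=
  (Submodule.span ℂ (Set.range (zonL m k))).topologicalClosure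

lemma zonL_mem_zonSpace (k : ℕ) (w : Sph (m + 2)) : zonL m k w ∈ zonSpace m k :=
  Submodule.le_topologicalClosure _ (Submodule.subset_span ⟨w, rfl⟩)

instance (m k : ℕ) : CompleteSpace (zonSpace m k) :=
  (Submodule.isClosed_topologicalClosure _).completeSpace_coe

lemma zonSpace_le_orthogonal {k l : ℕ} (hkl : k ≠ l) : zonSpace m k ≤ (zonSpace m l)ᗮ := by
  refine Submodule.topologicalClosure_minimal _ ?_ (Submodule.isClosed_orthogonal _)
  rw [Submodule.span_le]
  rintro _ ⟨w, rfl⟩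
  rw [zonSpace, Submodule.orthogonal_closure]
  refine (Submodule.mem_orthogonal _ _).2 fun u hu => ?_
  induction hu using Submodule.span_induction with
  | mem x hx =>
    obtain ⟨w', rfl⟩ := hx
    rw [inner_zonL_zonL, gegInner_geg_of_ne m hkl.symm]; simp
  | zero => simp
  | add x y _ _ hx hy => rw [inner_add_left, hx, hy, add_zero]
  | smul a x _ hx => rw [inner_smul_left, hx, mul_zero]

/-- The projection onto the degree `k` part, as a continuous function. -/
def zonProj (m k : ℕ) : SphL2 (m + 2) →L[ℂ] C(Sph (m + 2), ℂ) :=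
  LinearMap.mkContinuous
    { toFun := fun Y => ⟨fun w => (zonNormSq m k : ℂ)⁻¹ * ⟪zonL m k w, Y⟫_ℂ,
        continuous_const.mul ((continuous_zonL k).inner continuous_const)⟩
      map_add' := fun Y Z => by ext w; simp [inner_add_right, mul_add]
      map_smul' := fun a Y => by ext w; simp [inner_smul_right]; ring }
    ((zonNormSq m k)⁻¹ * √(zonNormSq m k)) <| by
      intro Y
      rw [ContinuousMap.norm_le _ (by have := zonNormSq_pos m k; positivity)]
      intro w
      have h := norm_inner_le_norm (𝕜 := ℂ) (zonL m k w) Y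
      rw [norm_zonL] at h
      simp only [LinearMap.coe_mk, AddHom.coe_mk, ContinuousMap.coe_mk, norm_mul, norm_inv,
        Complex.norm_real, Real.norm_of_nonneg (zonNormSq_pos m k).le]
      rw [mul_assoc]
      exact mul_le_mul_of_nonneg_left h (inv_nonneg.2 (zonNormSq_pos m k).le)

lemma zonProj_apply (k : ℕ) (Y : SphL2 (m + 2)) (w : Sph (m + 2)) :
    zonProj m k Y w = (zonNormSq m k : ℂ)⁻¹ * ⟪zonL m k w, Y⟫_ℂ := rfl

lemma zonProj_zonL (k : ℕ) (w : Sph (m + 2)) : zonProj m k (zonL m k w) = zonC m k w := by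
  ext w'
  have h : ((zonNormSq m k : ℝ) : ℂ) ≠ 0 := by exact_mod_cast (zonNormSq_pos m k).ne'
  rw [zonProj_apply, inner_zonL_zonL_same, zonC_apply, zon_comm]
  field_simp

/-- On zonal functions this is the reproducing identity, and continuity extends it to the closed
span. It supplies the continuous representative needed to evaluate elements of `zonSpace` at points.
-/
lemma toLp_zonProj (k : ℕ) {Y : SphL2 (m + 2)} (hY : Y ∈ zonSpace m k) :
    ContinuousMap.toLp 2 (surf (m + 2)) ℂ (zonProj m k Y) = Y := by
  have h := ContinuousLinearMap.eqOn_closure_span (s := Set.range (zonL m k))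
    (f := (ContinuousMap.toLp 2 (surf (m + 2)) ℂ).comp (zonProj m k))
    (g := ContinuousLinearMap.id ℂ (SphL2 (m + 2))) (by
      rintro _ ⟨w, rfl⟩
      simp only [ContinuousLinearMap.comp_apply, zonProj_zonL, ContinuousLinearMap.id_apply]
      rfl)
  exact h hY

lemma coeFn_zonProj (k : ℕ) {Y : SphL2 (m + 2)} (hY : Y ∈ zonSpace m k) :
    Y =ᵐ[surf (m + 2)] zonProj m k Y := by
  have h := ContinuousMap.coeFn_toLp (p := 2) (𝕜 := ℂ) (surf (m + 2)) (zonProj m k Y)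
  rwa [toLp_zonProj k hY] at h

/-- The Funk-Hecke formula for functions of degree `k`. -/
lemma integral_zonProj_mul (k : ℕ) {Y : SphL2 (m + 2)} (hY : Y ∈ zonSpace m k) (w : Sph (m + 2))
    {ψ : ℝ → ℂ} (hψ : Continuous ψ) :
    ∫ v, zonProj m k Y v * ψ (inner ℝ (v : Space (m + 2)) (w : Space (m + 2))) ∂(surf (m + 2)) =
      zonProj m k Y w * (kap m * ∫ θ in (0 : ℝ)..Real.pi,
        (((geg m k).eval (Real.cos θ) : ℝ) : ℂ) * ψ (Real.cos θ) * ((Real.sin θ ^ m : ℝ) : ℂ)) := by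
  set Ψ : C(Sph (m + 2), ℂ) := ⟨fun v => (starRingEnd ℂ)
    (ψ (inner ℝ (v : Space (m + 2)) (w : Space (m + 2)))),
    Complex.continuous_conj.comp (hψ.comp (continuous_inner_sphere w))⟩ with hΨ
  set c : ℂ := kap m * ∫ θ in (0 : ℝ)..Real.pi,
        (((geg m k).eval (Real.cos θ) : ℝ) : ℂ) * ψ (Real.cos θ) * ((Real.sin θ ^ m : ℝ) : ℂ)
  have hL : ∀ Z : SphL2 (m + 2), ⟪ContinuousMap.toLp 2 (surf (m + 2)) ℂ Ψ, Z⟫_ℂ =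
      ∫ v, Z v * ψ (inner ℝ (v : Space (m + 2)) (w : Space (m + 2))) ∂(surf (m + 2)) := by
    intro Z
    rw [L2.inner_def]
    refine integral_congr_ae ?_
    filter_upwards [ContinuousMap.coeFn_toLp (p := 2) (𝕜 := ℂ) (surf (m + 2)) Ψ] with v hv
    rw [hv, RCLike.inner_apply, hΨ, ContinuousMap.coe_mk, Complex.conj_conj]
  -- Both sides are continuous linear functionals of Y, so the zonal case suffices.
  have h := ContinuousLinearMap.eqOn_closure_span (s := Set.range (zonL m k))
    (f := innerSL ℂ (ContinuousMap.toLp 2 (surf (m + 2)) ℂ Ψ))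
    (g := c • (innerSL ℂ ((zonNormSq m k : ℂ)⁻¹ • zonL m k w))) (by
      rintro _ ⟨w', rfl⟩
      have hne : ((zonNormSq m k : ℝ) : ℂ) ≠ 0 := by exact_mod_cast (zonNormSq_pos m k).ne'
      rw [innerSL_apply_apply, hL, _root_.smul_apply, innerSL_apply_apply,
        inner_smul_left, inner_zonL_zonL_same, map_inv₀, Complex.conj_ofReal]
      have e := integral_zon_mul k w w' hψ
      rw [zon_comm k w w', smul_eq_mul]
      rw [show c * ((zonNormSq m k : ℂ)⁻¹ * ((zon m k w' w : ℂ) * (zonNormSq m k : ℂ))) =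
        zon m k w' w * c by field_simp, ← e]
      refine integral_congr_ae ?_
      filter_upwards [coeFn_zonL k w'] with v hv
      rw [hv])
  have h' := h hY
  rw [innerSL_apply_apply, hL, _root_.smul_apply, innerSL_apply_apply,
    inner_smul_left, map_inv₀, Complex.conj_ofReal, ← zonProj_apply, smul_eq_mul, mul_comm c] at h'
  rw [← h']
  refine integral_congr_ae ?_
  filter_upwards [coeFn_zonProj k hY] with v hv
  rw [hv]

section Completeness

/-- Every polynomial is a combination of Gegenbauer polynomials, so every ridge polynomial is a
combination of zonal functions with the same pole. -/
lemma integral_ridge_eq_zero {h : SphL2 (m + 2)} (hz : ∀ k w, ⟪zonL m k w, h⟫_ℂ = 0)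
    (q : ℝ[X]) (w : Sph (m + 2)) :
    ∫ v, ((q.eval (inner ℝ (v : Space (m + 2)) (w : Space (m + 2))) : ℝ) : ℂ) * h v
      ∂(surf (m + 2)) = 0 := by
  obtain ⟨c, hc⟩ := mem_span_geg_of_natDegree_le m q.natDegree (le_refl q.natDegree)
  have e : ∀ v : Sph (m + 2), ((q.eval (inner ℝ (v : Space (m + 2)) (w : Space (m + 2))) : ℝ) : ℂ)
      * h v = ∑ j ∈ Finset.range (q.natDegree + 1), (c j : ℂ) * ((zon m j w v : ℂ) * h v) := by
    intro v
    conv_lhs => rw [hc]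
    rw [eval_finsetSum, Complex.ofReal_sum, Finset.sum_mul]
    refine Finset.sum_congr rfl fun j _ => ?_
    rw [eval_smul, smul_eq_mul, Complex.ofReal_mul, mul_assoc]
    rfl
  have hint : ∀ j, Integrable (fun v => (zon m j w v : ℂ) * h v) (surf (m + 2)) := by
    intro j
    have h1 : Integrable h (surf (m + 2)) := (Lp.memLp h).integrable (by norm_num)
    refine h1.bdd_mul (c := 1) (Complex.continuous_ofReal.comp (continuous_zon j w)).aestronglyMeasurable
      (Filter.Eventually.of_forall fun v => ?_)
    rw [Complex.norm_real]
    exact abs_zon_le_one j w v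
  simp_rw [e]
  rw [integral_finsetSum _ fun j _ => (hint j).const_mul _]
  refine Finset.sum_eq_zero fun j _ => ?_
  rw [integral_const_mul, ← inner_zonL_left, hz, mul_zero]

/-- The terms of the exponential series are ridge polynomials in the direction of x, and the series
may be integrated term by term. -/
lemma integral_exp_inner_eq_zero {h : SphL2 (m + 2)} (hz : ∀ k w, ⟪zonL m k w, h⟫_ℂ = 0)
    (x : Space (m + 2)) :
    ∫ v : Sph (m + 2), (Real.exp (inner ℝ (v : Space (m + 2)) x) : ℂ) * h v ∂(surf (m + 2)) = 0 := by
  obtain ⟨w, r, hx⟩ : ∃ (w : Sph (m + 2)) (r : ℝ), x = r • (w : Space (m + 2)) := by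
    have w0 : Sph (m + 2) := (exists_sphere_inner_eq m (t := 0) (by simp)).choose
    by_cases h0 : x = 0
    · exact ⟨w0, 0, by simp [h0]⟩
    · refine ⟨sphProj w0 x, ‖x‖, ?_⟩
      rw [coe_sphProj w0 h0, smul_smul, mul_inv_cancel₀ (norm_ne_zero_iff.2 h0), one_smul]
  have h1 : Integrable h (surf (m + 2)) := (Lp.memLp h).integrable (by norm_num)
  have hle : ∀ v : Sph (m + 2), |(inner ℝ (v : Space (m + 2)) (w : Space (m + 2)) : ℝ)| ≤ 1 := by
    intro v
    have := abs_real_inner_le_norm (v : Space (m + 2)) (w : Space (m + 2))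
    rwa [mem_sphere_zero_iff_norm.1 v.2, mem_sphere_zero_iff_norm.1 w.2, one_mul] at this
  set F : ℕ → Sph (m + 2) → ℂ := fun n v =>
    (((C (r ^ n / n.factorial) * X ^ n : ℝ[X]).eval
      (inner ℝ (v : Space (m + 2)) (w : Space (m + 2))) : ℝ) : ℂ) * h v with hF
  have hb : ∀ n v, ‖F n v‖ ≤ |r| ^ n / n.factorial * ‖h v‖ := by
    intro n v
    simp only [hF, eval_mul, eval_C, eval_pow, eval_X, norm_mul, Complex.norm_real, norm_div,
      norm_pow, Real.norm_eq_abs, Nat.abs_cast]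
    refine mul_le_mul_of_nonneg_right ?_ (norm_nonneg _)
    exact mul_le_of_le_one_right (by positivity) (pow_le_one₀ (abs_nonneg _) (hle v))
  have hFi : ∀ n, Integrable (F n) (surf (m + 2)) := by
    intro n
    refine (h1.norm.const_mul (|r| ^ n / n.factorial)).mono' ?_ (Filter.Eventually.of_forall (hb n))
    refine AEStronglyMeasurable.mul ?_ h1.aestronglyMeasurable
    exact (Complex.continuous_ofReal.comp ((C (r ^ n / n.factorial) * X ^ n : ℝ[X]).continuous.comp
      (continuous_inner_sphere w))).aestronglyMeasurable
  have hsum : Summable fun n => ∫ v, ‖F n v‖ ∂(surf (m + 2)) := by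
    refine Summable.of_nonneg_of_le (fun n => integral_nonneg fun v => norm_nonneg _) (fun n => ?_)
      ((Real.summable_pow_div_factorial |r|).mul_right (∫ v, ‖h v‖ ∂(surf (m + 2))))
    rw [← integral_const_mul]
    exact integral_mono (hFi n).norm (h1.norm.const_mul _) (hb n)
  have key := hasSum_integral_of_summable_integral_norm hFi hsum
  have h0 : ∀ n, ∫ v, F n v ∂(surf (m + 2)) = 0 := fun n => integral_ridge_eq_zero hz _ w
  simp_rw [h0] at key
  rw [← key.unique hasSum_zero]
  refine integral_congr_ae (Filter.Eventually.of_forall fun v => ?_)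
  simp only [hF]
  rw [tsum_mul_right, hx, real_inner_smul_right]
  congr 1
  rw [← Complex.ofReal_tsum, Real.exp_eq_exp_ℝ, NormedSpace.exp_eq_tsum_div]
  congr 1
  refine tsum_congr fun n => ?_
  simp only [eval_mul, eval_C, eval_pow, eval_X, mul_pow]
  ring

/-- The exponential `v ↦ exp ⟨v, x⟩` on the sphere. -/
def expC (x : Space (m + 2)) : C(Sph (m + 2), ℂ) :=
  ⟨fun v => (Real.exp (inner ℝ (v : Space (m + 2)) x) : ℂ), by fun_prop⟩

lemma expC_mul (x y : Space (m + 2)) : expC x * expC y = expC (x + y) := by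
  ext v; simp [expC, inner_add_right, Complex.exp_add]

lemma expC_zero : expC (0 : Space (m + 2)) = 1 := by
  ext v; simp [expC]

/-- The star subalgebra of continuous functions spanned by the exponentials. -/
def expAlg (m : ℕ) : StarSubalgebra ℂ C(Sph (m + 2), ℂ) where
  toSubalgebra := (Submodule.span ℂ (Set.range (expC (m := m)))).toSubalgebra
    (by rw [← expC_zero]; exact Submodule.subset_span ⟨0, rfl⟩) (by
      intro x y hx hy
      have := Submodule.mul_mem_mul hx hy
      rw [Submodule.span_mul_span] at this
      refine Submodule.span_mono ?_ this
      rintro _ ⟨_, ⟨a, rfl⟩, _, ⟨b, rfl⟩, rfl⟩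
      exact ⟨a + b, (expC_mul a b).symm⟩)
  star_mem' := by
    intro a ha
    change star a ∈ Submodule.span ℂ (Set.range (expC (m := m)))
    change a ∈ Submodule.span ℂ (Set.range (expC (m := m))) at ha
    induction ha using Submodule.span_induction with
    | mem x hx =>
      obtain ⟨y, rfl⟩ := hx
      have : star (expC y) = expC y := by
        ext v
        simp only [expC, ContinuousMap.star_apply, ContinuousMap.coe_mk]
        exact Complex.conj_ofReal _
      rw [this]; exact Submodule.subset_span ⟨y, rfl⟩
    | zero => simp
    | add x y _ _ hx hy => rw [star_add]; exact Submodule.add_mem _ hx hy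
    | smul c x _ hx => rw [star_smul]; exact Submodule.smul_mem _ _ hx

lemma expAlg_topologicalClosure (m : ℕ) : (expAlg m).topologicalClosure = ⊤ := by
  refine ContinuousMap.starSubalgebra_topologicalClosure_eq_top_of_separatesPoints _ ?_
  intro v v' hne
  -- Equal values at v and v' of the exponential with exponent x = v - v' would give |v - v'|² = 0.
  refine ⟨expC ((v : Space (m + 2)) - (v' : Space (m + 2))), ⟨_, ?_, rfl⟩, ?_⟩
  · exact Submodule.subset_span (s := Set.range (expC (m := m))) ⟨_, rfl⟩
  · intro heq
    simp only [expC, ContinuousMap.coe_mk] at heq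
    have h1 := Real.exp_injective (Complex.ofReal_injective heq)
    have h2 : (inner ℝ ((v : Space (m + 2)) - (v' : Space (m + 2))) ((v : Space (m + 2)) - (v' : Space (m + 2))) : ℝ) = 0 := by
      rw [inner_sub_left, h1, sub_self]
    exact hne (Subtype.ext (sub_eq_zero.1 (inner_self_eq_zero.1 h2)))

/-- The zonal functions span a dense subspace of `L²`. -/
lemma eq_zero_of_inner_zonL_eq_zero {h : SphL2 (m + 2)} (hz : ∀ k w, ⟪zonL m k w, h⟫_ℂ = 0) : h = 0 := by
  have h1 : ∀ g : C(Sph (m + 2), ℂ), ⟪h, ContinuousMap.toLp 2 (surf (m + 2)) ℂ g⟫_ℂ = 0 := by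
    have hcl := ContinuousLinearMap.eqOn_closure_span (s := Set.range (expC (m := m)))
      (f := (innerSL ℂ h).comp (ContinuousMap.toLp 2 (surf (m + 2)) ℂ))
      (g := 0) (by
        rintro _ ⟨x, rfl⟩
        simp only [ContinuousLinearMap.comp_apply, innerSL_apply_apply, _root_.zero_apply]
        rw [← inner_conj_symm, map_eq_zero, L2.inner_def, ← integral_exp_inner_eq_zero hz x]
        refine integral_congr_ae ?_
        filter_upwards [ContinuousMap.coeFn_toLp (p := 2) (𝕜 := ℂ) (surf (m + 2)) (expC x)] with v hv
        rw [hv, RCLike.inner_apply, mul_comm]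
        congr 1
        exact Complex.conj_ofReal _)
    intro g
    have hg : g ∈ (expAlg m).topologicalClosure := by rw [expAlg_topologicalClosure]; trivial
    exact hcl hg
  have h2 := DenseRange.induction_on (p := fun y => ⟪h, y⟫_ℂ = 0)
    (ContinuousMap.toLp_denseRange (α := Sph (m + 2)) (E := ℂ) (p := 2) (μ := surf (m + 2)) ℂ
      (by norm_num)) h
    (isClosed_eq (continuous_const.inner continuous_id) continuous_const) h1
  exact inner_self_eq_zero.1 h2

end Completeness

/-- Orthonormal vectors are √2 apart, so the balls of radius 1/2 around them are disjoint. -/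
lemma countable_of_orthonormal {H ι : Type*} [NormedAddCommGroup H] [InnerProductSpace ℂ H]
    [TopologicalSpace.SeparableSpace H] {v : ι → H} (hv : Orthonormal ℂ v) : Countable ι := by
  refine Pairwise.countable_of_isOpen_disjoint (s := fun i => Metric.ball (v i) (1 / 2)) ?_
    (fun i => Metric.isOpen_ball) (fun i => ⟨v i, Metric.mem_ball_self (by norm_num)⟩)
  intro i j hij
  refine Metric.ball_disjoint_ball ?_
  have h1 : ‖v i - v j‖ ^ 2 = 2 := by
    rw [@norm_sub_sq ℂ, hv.1 i, hv.1 j, hv.2 hij]; norm_num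
  rw [dist_eq_norm]
  nlinarith [norm_nonneg (v i - v j)]

lemma inner_eq_zero_of_hilbertBasis {k : ℕ} {ι : Type*} (b : HilbertBasis ι ℂ (zonSpace m k))
    {z : SphL2 (m + 2)} (hz : ∀ i, ⟪z, (b i : SphL2 (m + 2))⟫_ℂ = 0) {y : SphL2 (m + 2)}
    (hy : y ∈ zonSpace m k) : ⟪z, y⟫_ℂ = 0 := by
  have h2 := (b.hasSum_repr ⟨y, hy⟩).mapL ((innerSL ℂ z).comp (zonSpace m k).subtypeL)
  have h3 : ∀ i, ((innerSL ℂ z).comp (zonSpace m k).subtypeL) (b.repr ⟨y, hy⟩ i • b i) = 0 := by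
    intro i
    rw [map_smul]
    simp only [ContinuousLinearMap.comp_apply, innerSL_apply_apply, Submodule.subtypeL_apply]
    rw [hz i, smul_zero]
  simp_rw [h3] at h2
  exact h2.unique hasSum_zero

/-- There is a Hilbert basis of `L²` of the sphere adapted to the decomposition into degrees. -/
lemma exists_hilbertBasis_zonSpace (m : ℕ) : ∃ (ι : Type) (_ : Countable ι)
    (b : HilbertBasis ι ℂ (SphL2 (m + 2))) (deg : ι → ℕ), ∀ j, b j ∈ zonSpace m (deg j) := by
  have hex : ∀ k, ∃ s : Type, Nonempty (HilbertBasis s ℂ (zonSpace m k)) := fun k => by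
    obtain ⟨s, b, -⟩ := exists_hilbertBasis ℂ (zonSpace m k)
    exact ⟨s, ⟨b⟩⟩
  choose s hs using hex
  have b := fun k => (hs k).some
  set e : (Σ k, s k) → SphL2 (m + 2) := fun a => (b a.1 a.2 : SphL2 (m + 2)) with he
  have hon : Orthonormal ℂ e := by
    refine ⟨fun a => (b a.1).orthonormal.1 a.2, ?_⟩
    rintro ⟨k, i⟩ ⟨l, j⟩ hne
    by_cases hkl : k = l
    · subst hkl
      exact (b k).orthonormal.2 fun hij => hne (congrArg (Sigma.mk k) hij)
    · exact Submodule.inner_left_of_mem_orthogonal (b l j).2 (zonSpace_le_orthogonal hkl (b k i).2)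
  have htop : (Submodule.span ℂ (Set.range e))ᗮ = ⊥ := by
    rw [Submodule.eq_bot_iff]
    intro z hz
    refine eq_zero_of_inner_zonL_eq_zero fun k w => ?_
    have h4 : ⟪z, zonL m k w⟫_ℂ = 0 := by
      refine inner_eq_zero_of_hilbertBasis (b k) (fun i => ?_) (zonL_mem_zonSpace k w)
      exact Submodule.inner_left_of_mem_orthogonal (Submodule.subset_span (Set.mem_range_self (⟨k, i⟩ : Σ k, s k))) hz
    rw [← inner_conj_symm, h4, map_zero]
  have : TopologicalSpace.SeparableSpace (SphL2 (m + 2)) :=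
    (ContinuousMap.toLp_denseRange (α := Sph (m + 2)) (E := ℂ) (p := 2) (μ := surf (m + 2)) ℂ
      (by norm_num)).separableSpace (ContinuousLinearMap.continuous _)
  have hc : Countable (Σ k, s k) := countable_of_orthonormal hon
  refine ⟨(Σ k, s k), hc, HilbertBasis.mkOfOrthogonalEqBot hon htop, fun a => a.1, fun a => ?_⟩
  rw [HilbertBasis.coe_mkOfOrthogonalEqBot]
  exact (b a.1 a.2).2

end KineticTransport

end

/-! ### Zonal functions as eigenfunctions of the Laplace-Beltrami operator -/

noncomputable section

namespace KineticTransport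

open Polynomial
open scoped InnerProductSpace

variable {m : ℕ}

section ZonalExtension

variable {E : Type*} [NormedAddCommGroup E] [InnerProductSpace ℝ E]

lemma hasLineDerivAt_inv_norm {x : E} (hx : x ≠ 0) (e : E) :
    HasLineDerivAt ℝ (fun y : E => ‖y‖⁻¹) (-(⟪x, e⟫_ℝ * ‖x‖⁻¹ ^ 3)) x e := by
  have hn : ‖x‖ ≠ 0 := norm_ne_zero_iff.2 hx
  have h1 : HasDerivAt (fun t : ℝ => x + t • e) e 0 := by
    simpa using ((hasDerivAt_id (0 : ℝ)).smul_const e).const_add x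
  have h2 := h1.norm_sq
  simp only [zero_smul, add_zero] at h2
  have h3 := h2.sqrt (by simpa using pow_ne_zero 2 hn)
  have h4 := h3.inv (by simpa using hn)
  simp only [zero_smul, add_zero, Real.sqrt_sq (norm_nonneg _)] at h4
  refine h4.congr_deriv ?_
  field_simp

lemma hasLineDerivAt_inner (x e w : E) :
    HasLineDerivAt ℝ (fun y : E => ⟪y, w⟫_ℝ) ⟪e, w⟫_ℝ x e := by
  have h1 : HasDerivAt (fun t : ℝ => x + t • e) e 0 := by
    simpa using ((hasDerivAt_id (0 : ℝ)).smul_const e).const_add x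
  have := h1.inner ℝ (hasDerivAt_const (0 : ℝ) w)
  unfold HasLineDerivAt
  simpa using this

/-- The extension of a zonal function that is homogeneous of degree `0`. -/
def zonExt (p : ℝ[X]) (w x : E) : ℝ := p.eval (‖x‖⁻¹ * ⟪x, w⟫_ℝ)

/-- The derivative of `zonExt p w` in the direction `e`. -/
def zonExtDeriv (p : ℝ[X]) (w e x : E) : ℝ :=
  (derivative p).eval (‖x‖⁻¹ * ⟪x, w⟫_ℝ) *
    (‖x‖⁻¹ * ⟪e, w⟫_ℝ - ‖x‖⁻¹ ^ 3 * ⟪x, w⟫_ℝ * ⟪x, e⟫_ℝ)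

lemma contDiffAt_zonExt (p : ℝ[X]) (w : E) {x : E} (hx : x ≠ 0) : ContDiffAt ℝ ∞ (zonExt p w) x := by
  have h1 : ContDiffAt ℝ ∞ (fun y : E => ‖y‖⁻¹ * ⟪y, w⟫_ℝ) x :=
    ((contDiffAt_norm ℝ hx).inv (norm_ne_zero_iff.2 hx)).mul
      (contDiffAt_id.inner ℝ contDiffAt_const)
  have h2 : ContDiff ℝ ∞ fun t : ℝ => p.eval t := by
    simpa [coe_aeval_eq_eval] using p.contDiff_aeval (𝕜 := ℝ) ∞
  exact h2.contDiffAt.comp x h1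

lemma hasLineDerivAt_zonExt (p : ℝ[X]) (w e : E) {x : E} (hx : x ≠ 0) :
    HasLineDerivAt ℝ (zonExt p w) (zonExtDeriv p w e x) x e := by
  have h1 : HasLineDerivAt ℝ (fun y : E => ‖y‖⁻¹ * ⟪y, w⟫_ℝ) _ x e :=
    HasDerivAt.mul (hasLineDerivAt_inv_norm hx e) (hasLineDerivAt_inner x e w)
  have hp : HasDerivAt (fun t => p.eval t)
      ((derivative p).eval (‖x + (0 : ℝ) • e‖⁻¹ * ⟪x + (0 : ℝ) • e, w⟫_ℝ))
      (‖x + (0 : ℝ) • e‖⁻¹ * ⟪x + (0 : ℝ) • e, w⟫_ℝ) := p.hasDerivAt _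
  have := HasDerivAt.comp (0 : ℝ) hp h1
  refine this.congr_deriv ?_
  simp only [zero_smul, add_zero, zonExtDeriv]
  ring

/-- The powers of ‖x‖ become 1 after the last differentiation, as the Laplacian is only evaluated on
the sphere. -/
lemma hasLineDerivAt_zonExtDeriv (p : ℝ[X]) (w : E) {e x : E} (hx : ‖x‖ = 1) (he : ‖e‖ = 1) :
    HasLineDerivAt ℝ (zonExtDeriv p w e)
      ((derivative (derivative p)).eval ⟪x, w⟫_ℝ * (⟪e, w⟫_ℝ - ⟪x, w⟫_ℝ * ⟪x, e⟫_ℝ) ^ 2 +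
        (derivative p).eval ⟪x, w⟫_ℝ *
          (3 * ⟪x, w⟫_ℝ * ⟪x, e⟫_ℝ ^ 2 - 2 * ⟪e, w⟫_ℝ * ⟪x, e⟫_ℝ - ⟪x, w⟫_ℝ)) x e := by
  have hx0 : x ≠ 0 := by rw [← norm_ne_zero_iff, hx]; exact one_ne_zero
  have h0 := hasLineDerivAt_zonExt (derivative p) w e hx0
  have hi := hasLineDerivAt_inv_norm hx0 e
  have h1 := HasDerivAt.sub (HasDerivAt.mul hi (hasDerivAt_const (0 : ℝ) ⟪e, w⟫_ℝ))
    (HasDerivAt.mul (HasDerivAt.mul (HasDerivAt.pow hi 3) (hasLineDerivAt_inner x e w))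
      (hasLineDerivAt_inner x e e))
  have h2 := HasDerivAt.mul h0 h1
  refine HasDerivAt.congr_deriv (f := fun t : ℝ => zonExtDeriv p w e (x + t • e)) h2 ?_
  simp only [zero_smul, add_zero, zonExtDeriv, zonExt, hx, real_inner_self_eq_norm_sq, he,
    Pi.mul_apply, Pi.pow_apply, Pi.sub_apply]
  norm_num
  ring

/-- The second directional derivatives are quadratic in the coordinates of x and w, and Parseval
sums them over an orthonormal basis. The result is the Gegenbauer operator when dim E = m + 2. -/
lemma laplacian_zonExt [FiniteDimensional ℝ E] (p : ℝ[X]) {w x : E} (hx : ‖x‖ = 1) (hw : ‖w‖ = 1) :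
    Laplacian.laplacian (zonExt p w) x = (1 - ⟪x, w⟫_ℝ ^ 2) *
      (derivative (derivative p)).eval ⟪x, w⟫_ℝ -
      ((Module.finrank ℝ E : ℝ) - 1) * ⟪x, w⟫_ℝ * (derivative p).eval ⟪x, w⟫_ℝ := by
  have hx0 : x ≠ 0 := by rw [← norm_ne_zero_iff, hx]; exact one_ne_zero
  set b := stdOrthonormalBasis ℝ E
  rw [InnerProductSpace.laplacian_eq_iteratedFDeriv_orthonormalBasis (zonExt p w) b]
  have hterm : ∀ i, iteratedFDeriv ℝ 2 (zonExt p w) x ![b i, b i] =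
      (derivative (derivative p)).eval ⟪x, w⟫_ℝ * (⟪b i, w⟫_ℝ - ⟪x, w⟫_ℝ * ⟪x, b i⟫_ℝ) ^ 2 +
        (derivative p).eval ⟪x, w⟫_ℝ *
          (3 * ⟪x, w⟫_ℝ * ⟪x, b i⟫_ℝ ^ 2 - 2 * ⟪b i, w⟫_ℝ * ⟪x, b i⟫_ℝ - ⟪x, w⟫_ℝ) := by
    intro i
    rw [iteratedFDeriv_two_apply]
    simp only [Matrix.cons_val_zero, Matrix.cons_val_one]
    have hd : DifferentiableAt ℝ (fderiv ℝ (zonExt p w)) x :=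
      ((contDiffAt_zonExt p w hx0).fderiv_right (m := 1) (by norm_cast)).differentiableAt (by norm_num)
    have hev : (fun y => fderiv ℝ (zonExt p w) y (b i)) =ᶠ[nhds x] zonExtDeriv p w (b i) := by
      filter_upwards [isOpen_ne.mem_nhds hx0] with y hy
      have hdy : DifferentiableAt ℝ (zonExt p w) y :=
        (contDiffAt_zonExt p w hy).differentiableAt (by simp)
      rw [← hdy.lineDeriv_eq_fderiv]
      exact (hasLineDerivAt_zonExt p w (b i) hy).lineDeriv
    have hde : DifferentiableAt ℝ (fun y => fderiv ℝ (zonExt p w) y (b i)) x :=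
      hd.clm_apply (differentiableAt_const _)
    have e1 : fderiv ℝ (fderiv ℝ (zonExt p w)) x (b i) (b i) =
        fderiv ℝ (fun y => fderiv ℝ (zonExt p w) y (b i)) x (b i) := by
      rw [fderiv_clm_apply hd (differentiableAt_const _)]
      simp
    have hlin := hasLineDerivAt_zonExtDeriv p w hx (b.orthonormal.1 i)
    rw [e1, hev.fderiv_eq, ← (hev.differentiableAt_iff.1 hde).lineDeriv_eq_fderiv]
    exact hlin.lineDeriv
  simp_rw [hterm]
  have s1 : ∑ i, ⟪b i, w⟫_ℝ ^ 2 = 1 := by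
    have := b.sum_sq_norm_inner_right w
    simpa [hw] using this
  have s2 : ∑ i, ⟪x, b i⟫_ℝ ^ 2 = 1 := by
    have := b.sum_sq_norm_inner_left x
    simpa [hx] using this
  have s3 : ∑ i, ⟪b i, w⟫_ℝ * ⟪x, b i⟫_ℝ = ⟪x, w⟫_ℝ := by
    have := b.sum_inner_mul_inner x w
    rw [← this]
    exact Finset.sum_congr rfl fun i _ => mul_comm _ _
  set c := ⟪x, w⟫_ℝ
  set A := (derivative (derivative p)).eval c
  set B := (derivative p).eval c
  have e : ∀ i, A * (⟪b i, w⟫_ℝ - c * ⟪x, b i⟫_ℝ) ^ 2 +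
      B * (3 * c * ⟪x, b i⟫_ℝ ^ 2 - 2 * ⟪b i, w⟫_ℝ * ⟪x, b i⟫_ℝ - c) =
      A * ⟪b i, w⟫_ℝ ^ 2 + (A * c ^ 2 + 3 * B * c) * ⟪x, b i⟫_ℝ ^ 2 -
        (2 * A * c + 2 * B) * (⟪b i, w⟫_ℝ * ⟪x, b i⟫_ℝ) - B * c := by
    intro i; ring
  simp_rw [e]
  rw [Finset.sum_sub_distrib, Finset.sum_sub_distrib, Finset.sum_add_distrib, ← Finset.mul_sum,
    ← Finset.mul_sum, ← Finset.mul_sum, s1, s2, s3]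
  simp only [Finset.sum_const, Finset.card_univ, Fintype.card_fin, nsmul_eq_mul]
  ring

end ZonalExtension

lemma homExt_zon (k : ℕ) (w : Sph (m + 2)) {x : Space (m + 2)} (hx : x ≠ 0) :
    homExt (m + 2) (fun v => (zon m k w v : ℂ)) x =
      Complex.ofRealCLM (zonExt (geg m k) (w : Space (m + 2)) x) := by
  rw [homExt, dif_neg hx]
  simp only [zon, zonExt, real_inner_smul_left, Complex.ofRealCLM_apply]

lemma sphSmooth_zon (k : ℕ) (w : Sph (m + 2)) :
    SphSmooth (m + 2) fun v => (zon m k w v : ℂ) := by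
  have h : ContDiffOn ℝ ∞ (fun x => Complex.ofRealCLM (zonExt (geg m k) (w : Space (m + 2)) x))
      {0}ᶜ := fun x hx =>
    (Complex.ofRealCLM.contDiff.contDiffAt.comp x
      (contDiffAt_zonExt (geg m k) (w : Space (m + 2)) hx)).contDiffWithinAt
  exact h.congr fun x hx => homExt_zon k w hx

lemma laplaceBeltrami_zon (k : ℕ) (w v : Sph (m + 2)) :
    -laplaceBeltrami (m + 2) (fun v => (zon m k w v : ℂ)) v =
      ((k * (k + m) : ℝ) : ℂ) * (zon m k w v : ℂ) := by
  have hv : ‖(v : Space (m + 2))‖ = 1 := mem_sphere_zero_iff_norm.1 v.2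
  have hw : ‖(w : Space (m + 2))‖ = 1 := mem_sphere_zero_iff_norm.1 w.2
  have hv0 : (v : Space (m + 2)) ≠ 0 := by rw [← norm_ne_zero_iff, hv]; exact one_ne_zero
  have hev : homExt (m + 2) (fun v => (zon m k w v : ℂ)) =ᶠ[nhds (v : Space (m + 2))]
      Complex.ofRealCLM ∘ zonExt (geg m k) (w : Space (m + 2)) := by
    filter_upwards [isOpen_ne.mem_nhds hv0] with y hy
    exact homExt_zon k w hy
  rw [laplaceBeltrami, (InnerProductSpace.laplacian_congr_nhds hev).eq_of_nhds,
    ContDiffAt.laplacian_CLM_comp_left ((contDiffAt_zonExt (geg m k) _ hv0).of_le (by norm_cast)),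
    Function.comp_apply, laplacian_zonExt _ hv hw, finrank_space]
  have hode := congrArg (eval ⟪(v : Space (m + 2)), (w : Space (m + 2))⟫_ℝ) (geg_ode m k)
  simp only [eval_sub, eval_mul, eval_one, eval_pow, eval_X, eval_add, eval_natCast, eval_neg] at hode
  rw [Complex.ofRealCLM_apply, ← Complex.ofReal_neg, ← Complex.ofReal_mul]
  congr 1
  rw [zon]
  push_cast
  linear_combination -hode

/-- The eigenvalue `k (k + d - 2)` of the Laplace-Beltrami operator. -/
def sphEig (m k : ℕ) : ℝ≥0 := k * (k + m)

lemma coe_sphEig (m k : ℕ) : ((sphEig m k : ℝ≥0) : ℝ) = k * (k + m) := by simp [sphEig]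

lemma sphEig_injective (m : ℕ) : Function.Injective (sphEig m) := by
  intro k l h
  have h' : k * (k + m) = l * (l + m) := by
    have : ((k * (k + m) : ℕ) : ℝ≥0) = ((l * (l + m) : ℕ) : ℝ≥0) := by
      push_cast; exact h
    exact_mod_cast this
  rcases lt_trichotomy k l with hkl | hkl | hkl
  · exfalso; nlinarith
  · exact hkl
  · exfalso; nlinarith

lemma zonSpace_le_sphEigenspace (k : ℕ) :
    zonSpace m k ≤ (sphEigenspace (m + 2) (sphEig m k)).topologicalClosure := by
  refine Submodule.topologicalClosure_mono ?_
  rw [Submodule.span_le]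
  rintro _ ⟨w, rfl⟩
  refine Submodule.subset_span ⟨fun v => (zon m k w v : ℂ), sphSmooth_zon k w, fun v => ?_,
    coeFn_zonL k w⟩
  rw [laplaceBeltrami_zon, coe_sphEig]

/-- Group the basis by degree and apply Bessel's inequality to each eigenprojection. As only this
direction is needed, it does not matter whether the eigenspaces are exhausted by zonal functions or
whether other eigenvalues exist. -/
lemma sphSobolevSq_ge {ι : Type*} {b : ι → SphL2 (m + 2)} (hb : Orthonormal ℂ b) {deg : ι → ℕ}
    (hdeg : ∀ j, b j ∈ zonSpace m (deg j)) (s : ℝ) {φ : Sph (m + 2) → ℂ}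
    (hφ : MemLp φ 2 (surf (m + 2))) :
    ∑' j, ENNReal.ofReal ((1 + (sphEig m (deg j) : ℝ)) ^ s) * ‖⟪b j, hφ.toLp φ⟫_ℂ‖ₑ ^ 2 ≤
      sphSobolevSq (m + 2) s φ := by
  rw [sphSobolevSq, dif_pos hφ, ENNReal.tsum_eq_iSup_sum]
  refine iSup_le fun F => ?_
  set Φ := hφ.toLp φ
  set T : ℝ≥0 → ℝ≥0∞ := fun lam => ENNReal.ofReal ((1 + (lam : ℝ)) ^ s) *
    ‖(sphEigenspace (m + 2) lam).topologicalClosure.starProjection Φ‖ₑ ^ 2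
  rw [← Finset.sum_fiberwise_of_maps_to (t := F.image deg) (g := deg)
    (fun j hj => Finset.mem_image_of_mem _ hj)]
  calc _ ≤ ∑ k ∈ F.image deg, T (sphEig m k) := by
        refine Finset.sum_le_sum fun k _ => ?_
        set P := (sphEigenspace (m + 2) (sphEig m k)).topologicalClosure.starProjection Φ with hP
        have e1 : ∀ j ∈ F.filter (fun j => deg j = k),
            ENNReal.ofReal ((1 + (sphEig m (deg j) : ℝ)) ^ s) * ‖⟪b j, Φ⟫_ℂ‖ₑ ^ 2 =
            ENNReal.ofReal ((1 + (sphEig m k : ℝ)) ^ s) * ENNReal.ofReal (‖⟪b j, P⟫_ℂ‖ ^ 2) := by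
          intro j hj
          have hjk : deg j = k := (Finset.mem_filter.1 hj).2
          have hmem : b j ∈ (sphEigenspace (m + 2) (sphEig m k)).topologicalClosure :=
            zonSpace_le_sphEigenspace k (hjk ▸ hdeg j)
          rw [hjk, hP, ← Submodule.inner_starProjection_left_eq_right,
            Submodule.starProjection_eq_self_iff.2 hmem, ENNReal.ofReal_pow (norm_nonneg _),
            ofReal_norm]
        rw [Finset.sum_congr rfl e1, ← Finset.mul_sum,
          ← ENNReal.ofReal_sum_of_nonneg fun _ _ => sq_nonneg _]
        refine mul_le_mul_right ?_ _
        rw [← ofReal_norm, ← ENNReal.ofReal_pow (norm_nonneg _)]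
        exact ENNReal.ofReal_le_ofReal (hb.sum_inner_products_le _)
    _ = ∑ lam ∈ (F.image deg).map ⟨sphEig m, sphEig_injective m⟩, T lam := by
        rw [Finset.sum_map]; rfl
    _ ≤ ∑' lam, T lam := ENNReal.sum_le_tsum _

end KineticTransport

end

/-! ### Weighted L² bounds for Gegenbauer polynomials -/

noncomputable section

namespace KineticTransport

open Polynomial

lemma one_sub_sq_pos {t : ℝ} (ht : t ∈ Set.Ioo (-1 : ℝ) 1) : 0 < 1 - t ^ 2 := by
  nlinarith [ht.1, ht.2]

lemma rpow_le_two_rpow_abs {x : ℝ} (h1 : 1 ≤ x) (h2 : x ≤ 2) (e : ℝ) : x ^ e ≤ 2 ^ |e| :=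
  (Real.rpow_le_rpow_of_exponent_le h1 (le_abs_self e)).trans
    (Real.rpow_le_rpow (by linarith) h2 (abs_nonneg e))

/-- At each t one of the factors 1 - t, 1 + t lies in [1, 2], so the weight is dominated by a
multiple of the sum of their e-th powers. -/
lemma integrableOn_one_sub_sq_rpow {e : ℝ} (he : -1 < e) :
    IntegrableOn (fun t : ℝ => (1 - t ^ 2) ^ e) (Set.Ioo (-1) 1) := by
  have hI : IntervalIntegrable (fun t : ℝ => t ^ e) volume 0 2 :=
    intervalIntegral.intervalIntegrable_rpow' he
  have h1 : IntegrableOn (fun t : ℝ => (1 - t) ^ e) (Set.Ioo (-1) 1) := by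
    have := hI.comp_sub_left 1
    norm_num at this
    exact (intervalIntegrable_iff_integrableOn_Ioo_of_le (by norm_num)).1 this.symm
  have h2 : IntegrableOn (fun t : ℝ => (1 + t) ^ e) (Set.Ioo (-1) 1) := by
    have := hI.comp_add_left 1
    norm_num at this
    exact (intervalIntegrable_iff_integrableOn_Ioo_of_le (by norm_num)).1 this
  refine Integrable.mono' ((h1.add h2).const_mul (2 ^ |e|))
    (Measurable.aestronglyMeasurable (by fun_prop)) ?_
  filter_upwards [ae_restrict_mem measurableSet_Ioo] with t ht
  have hp1 : 0 < 1 - t := by linarith [ht.2]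
  have hp2 : 0 < 1 + t := by linarith [ht.1]
  have hf : 1 - t ^ 2 = (1 - t) * (1 + t) := by ring
  rw [Real.norm_of_nonneg (Real.rpow_nonneg (one_sub_sq_pos ht).le _), hf,
    Real.mul_rpow hp1.le hp2.le]
  have n1 := Real.rpow_nonneg hp1.le e
  have n2 := Real.rpow_nonneg hp2.le e
  have n3 : (0 : ℝ) ≤ 2 ^ |e| := by positivity
  simp only [Pi.add_apply]
  rcases le_total 0 t with h | h
  · have := rpow_le_two_rpow_abs (x := 1 + t) (by linarith) (by linarith [ht.2]) e
    nlinarith [mul_le_mul_of_nonneg_left this n1, mul_nonneg n3 n2]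
  · have := rpow_le_two_rpow_abs (x := 1 - t) (by linarith) (by linarith [ht.1]) e
    nlinarith [mul_le_mul_of_nonneg_right this n2, mul_nonneg n3 n1]

lemma image_cos_Ioo : Real.cos '' Set.Ioo 0 Real.pi = Set.Ioo (-1) 1 := by
  ext t
  constructor
  · rintro ⟨θ, hθ, rfl⟩
    have hs := Real.sin_pos_of_pos_of_lt_pi hθ.1 hθ.2
    have := Real.sin_sq_add_cos_sq θ
    constructor <;> nlinarith [mul_pos hs hs]
  · intro ht
    exact ⟨Real.arccos t, ⟨Real.arccos_pos.2 ht.2, Real.arccos_lt_pi.2 ht.1⟩,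
      Real.cos_arccos ht.1.le ht.2.le⟩

lemma sin_mul_rpow {m : ℕ} {θ : ℝ} (hθ : θ ∈ Set.Ioo 0 Real.pi) :
    |(-Real.sin θ)| * (1 - Real.cos θ ^ 2) ^ (((m : ℝ) - 1) / 2) = Real.sin θ ^ m := by
  have hs := Real.sin_pos_of_pos_of_lt_pi hθ.1 hθ.2
  rw [← Real.sin_sq, abs_neg, abs_of_pos hs, ← Real.rpow_natCast (Real.sin θ) 2,
    ← Real.rpow_mul hs.le]
  nth_rewrite 1 [← Real.rpow_one (Real.sin θ)]
  rw [← Real.rpow_add hs, ← Real.rpow_natCast]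
  congr 1
  push_cast
  ring

lemma integral_cos_mul_sin_pow (m : ℕ) (F : ℝ → ℂ) :
    ∫ θ in (0 : ℝ)..Real.pi, F (Real.cos θ) * ((Real.sin θ ^ m : ℝ) : ℂ) =
      ∫ t in Set.Ioo (-1 : ℝ) 1, F t * (((1 - t ^ 2) ^ (((m : ℝ) - 1) / 2) : ℝ) : ℂ) := by
  rw [← image_cos_Ioo, integral_image_eq_integral_abs_deriv_smul measurableSet_Ioo
    (fun θ _ => (Real.hasDerivAt_cos θ).hasDerivWithinAt)
    (Real.injOn_cos.mono Set.Ioo_subset_Icc_self), intervalIntegral.integral_of_le Real.pi_pos.le,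
    integral_Ioc_eq_integral_Ioo]
  refine setIntegral_congr_fun measurableSet_Ioo fun θ hθ => ?_
  rw [← sin_mul_rpow hθ, Complex.real_smul]
  push_cast
  ring

lemma gegNormSq_eq_integral (m k : ℕ) : gegNormSq m k =
    ∫ t in Set.Ioo (-1 : ℝ) 1, (1 - t ^ 2) ^ (((m : ℝ) - 1) / 2) * (geg m k).eval t ^ 2 := by
  have h := integral_cos_mul_sin_pow m
    (fun t => (((geg m k).eval t : ℝ) : ℂ) * (((geg m k).eval t : ℝ) : ℂ))
  rw [integral_gegIntegrand_ofReal] at h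
  have h2 : ∫ t in Set.Ioo (-1 : ℝ) 1, (((geg m k).eval t : ℝ) : ℂ) * (((geg m k).eval t : ℝ) : ℂ) *
      (((1 - t ^ 2) ^ (((m : ℝ) - 1) / 2) : ℝ) : ℂ) =
      ((∫ t in Set.Ioo (-1 : ℝ) 1, (1 - t ^ 2) ^ (((m : ℝ) - 1) / 2) * (geg m k).eval t ^ 2 : ℝ) :
        ℂ) := by
    rw [← integral_complex_ofReal]
    refine integral_congr_ae (Filter.Eventually.of_forall fun t => ?_)
    push_cast
    ring
  rw [h2] at h
  exact_mod_cast h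

lemma integrableOn_rpow_mul_geg_sq {e : ℝ} (he : -1 < e) (m k : ℕ) :
    IntegrableOn (fun t : ℝ => (1 - t ^ 2) ^ e * (geg m k).eval t ^ 2) (Set.Ioo (-1) 1) := by
  refine (integrableOn_one_sub_sq_rpow he).mul_bdd (c := 1)
    ((geg m k).continuous.pow 2).aestronglyMeasurable ?_
  filter_upwards [ae_restrict_mem measurableSet_Ioo] with t ht
  rw [norm_pow, Real.norm_eq_abs]
  exact pow_le_one₀ (abs_nonneg _) (abs_geg_eval_le_one m k ⟨ht.1.le, ht.2.le⟩)

/-- Interpolation between |P_k| ≤ 1 and the natural weighted norm N of P_k, carried out pointwise: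
weighted AM-GM is applied after dividing the natural density by N, which yields the power N^a. -/
lemma integral_rpow_mul_geg_sq_le {m : ℕ} (hm : 1 ≤ m) {a e : ℝ} (ha0 : 0 ≤ a) (ha1 : a ≤ 1)
    (he : a * m - 1 < e) : ∃ C : ℝ, 0 ≤ C ∧ ∀ k,
      ∫ t in Set.Ioo (-1 : ℝ) 1, (1 - t ^ 2) ^ e * (geg m k).eval t ^ 2 ≤ C * gegNormSq m k ^ a := by
  have hm' : (1 : ℝ) ≤ m := by exact_mod_cast hm
  have hem : -1 < e := by nlinarith
  have hm1 : -1 < ((m : ℝ) - 1) / 2 := by linarith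
  rcases ha1.eq_or_lt with rfl | ha1
  · refine ⟨1, zero_le_one, fun k => ?_⟩
    rw [one_mul, Real.rpow_one, gegNormSq_eq_integral]
    refine setIntegral_mono_on (integrableOn_rpow_mul_geg_sq hem m k)
      (integrableOn_rpow_mul_geg_sq hm1 m k) measurableSet_Ioo fun t ht => ?_
    refine mul_le_mul_of_nonneg_right ?_ (sq_nonneg _)
    exact Real.rpow_le_rpow_of_exponent_ge (one_sub_sq_pos ht) (by nlinarith [sq_nonneg t])
      (by linarith)
  -- Chosen so that e = a (m-1)/2 + (1-a) e'. Integrability requires e' > -1, that is e > a(m+1)/2 -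
  -- 1, which follows from e > am - 1 because m ≥ 1.
  · set e' : ℝ := (e - a * ((m - 1) / 2)) / (1 - a) with he'
    have h1a : 0 < 1 - a := by linarith
    have he'1 : -1 < e' := by
      rw [he', lt_div_iff₀ h1a]
      nlinarith
    have hJ : 0 ≤ ∫ t in Set.Ioo (-1 : ℝ) 1, (1 - t ^ 2) ^ e' :=
      setIntegral_nonneg measurableSet_Ioo fun t ht => Real.rpow_nonneg (one_sub_sq_pos ht).le _
    refine ⟨a + (1 - a) * ∫ t in Set.Ioo (-1 : ℝ) 1, (1 - t ^ 2) ^ e', by positivity, fun k => ?_⟩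
    set N := gegNormSq m k with hN
    have hNpos : 0 < N := gegNormSq_pos m k
    have hpt : ∀ t ∈ Set.Ioo (-1 : ℝ) 1, (1 - t ^ 2) ^ e * (geg m k).eval t ^ 2 ≤
        N ^ a * (a / N * ((1 - t ^ 2) ^ (((m : ℝ) - 1) / 2) * (geg m k).eval t ^ 2) +
          (1 - a) * (1 - t ^ 2) ^ e') := by
      intro t ht
      set y := 1 - t ^ 2 with hy
      have hy0 : 0 < y := one_sub_sq_pos ht
      set x := (geg m k).eval t ^ 2 with hx
      have hx0 : 0 ≤ x := sq_nonneg _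
      have hx1 : x ≤ 1 := by
        rw [hx, ← sq_abs]
        exact pow_le_one₀ (abs_nonneg _) (abs_geg_eval_le_one m k ⟨ht.1.le, ht.2.le⟩)
      have hxa : x ≤ x ^ a := by
        rcases hx0.eq_or_lt with h | h
        · rw [← h]; exact Real.rpow_nonneg le_rfl a
        · calc x = x ^ (1 : ℝ) := (Real.rpow_one x).symm
            _ ≤ x ^ a := Real.rpow_le_rpow_of_exponent_ge h hx1 ha1.le
      have hyoung := Real.geom_mean_le_arith_mean2_weighted ha0 h1a.le
        (p₁ := y ^ (((m : ℝ) - 1) / 2) * x / N) (p₂ := y ^ e') (by positivity) (by positivity)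
        (by ring)
      have hprod : (y ^ (((m : ℝ) - 1) / 2) * x / N) ^ a * (y ^ e') ^ (1 - a) =
          y ^ e * x ^ a / N ^ a := by
        rw [Real.div_rpow (by positivity) hNpos.le, Real.mul_rpow (by positivity) hx0,
          ← Real.rpow_mul hy0.le, ← Real.rpow_mul hy0.le]
        have : e = ((m : ℝ) - 1) / 2 * a + e' * (1 - a) := by
          rw [he']; field_simp; ring
        rw [this, Real.rpow_add hy0]
        ring
      rw [hprod, div_le_iff₀ (by positivity)] at hyoung
      calc y ^ e * x ≤ y ^ e * x ^ a := mul_le_mul_of_nonneg_left hxa (by positivity)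
        _ ≤ _ := hyoung
        _ = _ := by ring
    have hi1 := integrableOn_rpow_mul_geg_sq hm1 m k
    have hi2 := integrableOn_one_sub_sq_rpow he'1
    have hi3 : IntegrableOn (fun t : ℝ => N ^ a * (a / N * ((1 - t ^ 2) ^ (((m : ℝ) - 1) / 2) *
        (geg m k).eval t ^ 2) + (1 - a) * (1 - t ^ 2) ^ e')) (Set.Ioo (-1) 1) :=
      ((hi1.const_mul (a / N)).add (hi2.const_mul (1 - a))).const_mul (N ^ a)
    calc _ ≤ ∫ t in Set.Ioo (-1 : ℝ) 1,
          N ^ a * (a / N * ((1 - t ^ 2) ^ (((m : ℝ) - 1) / 2) * (geg m k).eval t ^ 2) +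
          (1 - a) * (1 - t ^ 2) ^ e') :=
        setIntegral_mono_on (integrableOn_rpow_mul_geg_sq hem m k)
          hi3 measurableSet_Ioo hpt
      _ = N ^ a * (a / N * N + (1 - a) * ∫ t in Set.Ioo (-1 : ℝ) 1, (1 - t ^ 2) ^ e') := by
        rw [integral_const_mul, integral_add (hi1.const_mul _) (hi2.const_mul _),
          integral_const_mul, integral_const_mul, ← gegNormSq_eq_integral]
      _ = _ := by rw [div_mul_cancel₀ _ hNpos.ne']; ring

/-- The power -2s/m turns the decay (k+1)^{-m} into (k+1)^{2s}. As s ≤ 0, comparison with the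
eigenvalue only needs the upper bound 1 + k(k+m) ≤ (m+1)(k+1)². -/
lemma gegNormSq_rpow_le {m : ℕ} (hm : 1 ≤ m) {s : ℝ} (hs : s ≤ 0) : ∃ C : ℝ, 0 ≤ C ∧ ∀ k,
    gegNormSq m k ^ (-(2 * s) / m) ≤ C * (1 + (sphEig m k : ℝ)) ^ s := by
  obtain ⟨n, rfl⟩ : ∃ n, m = n + 1 := ⟨m - 1, by omega⟩
  set a : ℝ := -(2 * s) / ((n + 1 : ℕ) : ℝ) with ha
  have ha0 : 0 ≤ a := div_nonneg (by linarith) (by positivity)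
  have ham : ((n + 1 : ℕ) : ℝ) * a = -(2 * s) := by
    rw [ha]; exact mul_div_cancel₀ _ (by positivity)
  set A := gegNormSq (n + 1) 0 * (n + 1).factorial with hA
  have hA0 : 0 < A := mul_pos (gegNormSq_pos _ _) (by positivity)
  refine ⟨A ^ a * ((n : ℝ) + 2) ^ (-s), by positivity, fun k => ?_⟩
  have h1 : gegNormSq (n + 1) k ^ a ≤ (A / (k + 1) ^ (n + 1)) ^ a :=
    Real.rpow_le_rpow (gegNormSq_pos _ _).le (gegNormSq_le n k) ha0
  refine h1.trans ?_
  have hk : (0 : ℝ) < k + 1 := by positivity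
  rw [Real.div_rpow hA0.le (by positivity), ← Real.rpow_natCast ((k : ℝ) + 1) (n + 1),
    ← Real.rpow_mul hk.le, ham, div_eq_mul_inv, ← Real.rpow_neg hk.le, neg_neg, mul_assoc]
  refine mul_le_mul_of_nonneg_left ?_ (by positivity)
  have hL : 1 + (sphEig (n + 1) k : ℝ) ≤ ((n : ℝ) + 2) * (k + 1) ^ 2 := by
    rw [coe_sphEig]; push_cast
    nlinarith [(Nat.cast_nonneg k : (0 : ℝ) ≤ k), (Nat.cast_nonneg n : (0 : ℝ) ≤ n),
      mul_nonneg (Nat.cast_nonneg k : (0 : ℝ) ≤ k) (Nat.cast_nonneg n : (0 : ℝ) ≤ n),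
      mul_nonneg (Nat.cast_nonneg n : (0 : ℝ) ≤ n) (sq_nonneg (k : ℝ))]
  have hpos : 0 < 1 + (sphEig (n + 1) k : ℝ) := by positivity
  have h2 := Real.rpow_le_rpow_of_nonpos hpos hL hs
  rw [Real.mul_rpow (by positivity) (by positivity), ← Real.rpow_natCast ((k : ℝ) + 1) 2,
    ← Real.rpow_mul hk.le] at h2
  push_cast at h2
  calc ((k : ℝ) + 1) ^ (2 * s) = ((n : ℝ) + 2) ^ (-s) * (((n : ℝ) + 2) ^ s * ((k : ℝ) + 1) ^ (2 * s)) := by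
        rw [← mul_assoc, ← Real.rpow_add (by positivity)]; simp
    _ ≤ _ := mul_le_mul_of_nonneg_left h2 (by positivity)

/-- The weighted norm of the Gegenbauer polynomials is controlled by a power of the eigenvalue. -/
lemma exists_integral_rpow_mul_geg_sq_le {m : ℕ} {s e : ℝ} (hs : s ∈ Set.Icc (-((m : ℝ) / 2)) 0)
    (he : -(2 * s) - 1 < e) : ∃ C : ℝ, 0 ≤ C ∧ ∀ k,
      ∫ t in Set.Ioo (-1 : ℝ) 1, (1 - t ^ 2) ^ e * (geg m k).eval t ^ 2 ≤
        C * (1 + (sphEig m k : ℝ)) ^ s := by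
  rcases Nat.eq_zero_or_pos m with rfl | hm
  -- In dimension two the range of s is {0}, and |P_k| ≤ 1 suffices.
  · have hs0 : s = 0 := le_antisymm hs.2 (by simpa using hs.1)
    subst hs0
    refine ⟨∫ t in Set.Ioo (-1 : ℝ) 1, (1 - t ^ 2) ^ e,
      setIntegral_nonneg measurableSet_Ioo fun t ht => Real.rpow_nonneg (one_sub_sq_pos ht).le _,
      fun k => ?_⟩
    rw [Real.rpow_zero, mul_one]
    have he' : -1 < e := by linarith
    refine setIntegral_mono_on (integrableOn_rpow_mul_geg_sq he' 0 k)
      (integrableOn_one_sub_sq_rpow he') measurableSet_Ioo fun t ht => ?_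
    refine mul_le_of_le_one_right (Real.rpow_nonneg (one_sub_sq_pos ht).le _) ?_
    rw [← sq_abs]
    exact pow_le_one₀ (abs_nonneg _) (abs_geg_eval_le_one 0 k ⟨ht.1.le, ht.2.le⟩)
  · have hm' : (0 : ℝ) < m := by exact_mod_cast hm
    obtain ⟨C1, h1, hC1⟩ := integral_rpow_mul_geg_sq_le (m := m) hm (a := -(2 * s) / m) (e := e)
      (div_nonneg (by linarith [hs.2]) hm'.le) ((div_le_one hm').2 (by linarith [hs.1]))
      (by rw [div_mul_cancel₀ _ hm'.ne']; exact he)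
    obtain ⟨C2, h2, hC2⟩ := gegNormSq_rpow_le (m := m) hm hs.2
    refine ⟨C1 * C2, mul_nonneg h1 h2, fun k => (hC1 k).trans ?_⟩
    rw [mul_assoc]
    exact mul_le_mul_of_nonneg_left (hC2 k) h1

/-- The density of the distribution of `⟨v, w⟩` on the sphere, up to a constant. -/
def dens (m : ℕ) (t : ℝ) : ℝ :=
  (Set.Ioo (-1 : ℝ) 1).indicator (fun t => (1 - t ^ 2) ^ (((m : ℝ) - 1) / 2)) t

/-- The symbol of the hyperbolic derivative in terms of the ratio `τ / |ξ|`. -/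
def symb (βp βm t : ℝ) : ℝ := √(2 * Real.pi) * ((1 + |t|) ^ βp * abs (1 - |t|) ^ βm)

lemma measurable_dens (m : ℕ) : Measurable (dens m) :=
  Measurable.indicator (by fun_prop) measurableSet_Ioo

lemma measurable_symb (βp βm : ℝ) : Measurable (symb βp βm) := by
  unfold symb; fun_prop

lemma dens_nonneg (m : ℕ) (t : ℝ) : 0 ≤ dens m t :=
  Set.indicator_nonneg (fun _ ht => Real.rpow_nonneg (one_sub_sq_pos ht).le _) t

lemma dens_of_mem (m : ℕ) {t : ℝ} (ht : t ∈ Set.Ioo (-1 : ℝ) 1) :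
    dens m t = (1 - t ^ 2) ^ (((m : ℝ) - 1) / 2) := Set.indicator_of_mem ht _

lemma dens_of_notMem (m : ℕ) {t : ℝ} (ht : t ∉ Set.Ioo (-1 : ℝ) 1) : dens m t = 0 :=
  Set.indicator_of_notMem ht _

lemma symb_nonneg (βp βm t : ℝ) : 0 ≤ symb βp βm t := by unfold symb; positivity

/-- In 1 - t² = (1 - |t|)(1 + |t|) the second factor lies in [1, 2], so β₊ affects only the
constant. -/
lemma symb_mul_dens_sq_le (m : ℕ) (βp βm : ℝ) : ∃ C : ℝ, 0 ≤ C ∧ ∀ t ∈ Set.Ioo (-1 : ℝ) 1,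
    (symb βp βm t * dens m t) ^ 2 ≤ C * (1 - t ^ 2) ^ (2 * βm + ((m : ℝ) - 1)) := by
  refine ⟨2 * Real.pi * 2 ^ |2 * βp - 2 * βm|, by positivity, fun t ht => ?_⟩
  have hat : |t| < 1 := abs_lt.2 ht
  have hy := one_sub_sq_pos ht
  have h1 : 0 < 1 - |t| := by linarith
  have h2 : 0 < 1 + |t| := by positivity
  have hf : 1 - t ^ 2 = (1 - |t|) * (1 + |t|) := by rw [← sq_abs]; ring
  have sqr : ∀ {x : ℝ} (c : ℝ), 0 < x → (x ^ c) ^ 2 = x ^ (2 * c) := by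
    intro x c hx
    rw [← Real.rpow_natCast, ← Real.rpow_mul hx.le]; push_cast; ring_nf
  have e1 : (1 + |t|) ^ (2 * βp) * (1 - |t|) ^ (2 * βm) =
      (1 + |t|) ^ (2 * βp - 2 * βm) * (1 - t ^ 2) ^ (2 * βm) := by
    rw [hf, Real.mul_rpow h1.le h2.le, Real.rpow_sub h2]
    have : (1 + |t|) ^ (2 * βm) ≠ 0 := (Real.rpow_pos_of_pos h2 _).ne'
    field_simp
  rw [dens_of_mem m ht, symb, abs_of_pos h1, mul_pow, mul_pow, mul_pow, Real.sq_sqrt (by positivity),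
    sqr _ h2, sqr _ h1, sqr _ hy, e1, Real.rpow_add hy]
  have e2 : 2 * (((m : ℝ) - 1) / 2) = m - 1 := by ring
  rw [e2]
  have h3 := rpow_le_two_rpow_abs (x := 1 + |t|) (by linarith [abs_nonneg t]) (by linarith)
    (2 * βp - 2 * βm)
  have h4 : 0 ≤ (1 - t ^ 2) ^ (2 * βm) * (1 - t ^ 2) ^ ((m : ℝ) - 1) := by positivity
  calc _ = 2 * Real.pi * ((1 + |t|) ^ (2 * βp - 2 * βm) *
        ((1 - t ^ 2) ^ (2 * βm) * (1 - t ^ 2) ^ ((m : ℝ) - 1))) := by ring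
    _ ≤ 2 * Real.pi * (2 ^ |2 * βp - 2 * βm| *
        ((1 - t ^ 2) ^ (2 * βm) * (1 - t ^ 2) ^ ((m : ℝ) - 1))) := by gcongr
    _ = _ := by ring

/-- The radial profile of the multiplied Fourier transform. -/
def etaM (m : ℕ) (βp βm t : ℝ) : ℝ := kap m * (symb βp βm t * dens m t)

/-- A profile that dominates both `etaM` and the square root of the density. -/
def etaH (m : ℕ) (βp βm t : ℝ) : ℝ := kap m * (symb βp βm t * dens m t + √(dens m t))

lemma measurable_etaM (m : ℕ) (βp βm : ℝ) : Measurable (etaM m βp βm) :=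
  ((measurable_symb βp βm).mul (measurable_dens m)).const_mul _

lemma measurable_etaH (m : ℕ) (βp βm : ℝ) : Measurable (etaH m βp βm) :=
  (((measurable_symb βp βm).mul (measurable_dens m)).add (measurable_dens m).sqrt).const_mul _

lemma etaM_of_notMem (m : ℕ) (βp βm : ℝ) {t : ℝ} (ht : t ∉ Set.Ioo (-1 : ℝ) 1) :
    etaM m βp βm t = 0 := by simp [etaM, dens_of_notMem m ht]

lemma etaH_of_notMem (m : ℕ) (βp βm : ℝ) {t : ℝ} (ht : t ∉ Set.Ioo (-1 : ℝ) 1) :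
    etaH m βp βm t = 0 := by simp [etaH, dens_of_notMem m ht]

section EtaBounds

variable {m : ℕ} {s βp βm : ℝ}

lemma integrable_sq_of_le {η : ℝ → ℝ} (hη : Measurable η)
    (h0 : ∀ t, t ∉ Set.Ioo (-1 : ℝ) 1 → η t = 0) {g : ℝ → ℝ} (hg : IntegrableOn g (Set.Ioo (-1) 1))
    (hle : ∀ t ∈ Set.Ioo (-1 : ℝ) 1, η t ^ 2 ≤ g t) : Integrable fun t => η t ^ 2 := by
  have h1 : IntegrableOn (fun t => η t ^ 2) (Set.Ioo (-1) 1) := by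
    refine Integrable.mono' hg (hη.pow_const 2).aestronglyMeasurable ?_
    filter_upwards [ae_restrict_mem measurableSet_Ioo] with t ht
    rw [Real.norm_of_nonneg (sq_nonneg _)]
    exact hle t ht
  refine (integrableOn_iff_integrable_of_support_subset fun t ht => ?_).1 h1
  by_contra hnot
  exact ht (by simp [h0 t hnot])

lemma integral_sq_mul_geg_sq_le {η : ℝ → ℝ} (hη : Measurable η)
    (h0 : ∀ t, t ∉ Set.Ioo (-1 : ℝ) 1 → η t = 0) {g : ℝ → ℝ} (hg : IntegrableOn g (Set.Ioo (-1) 1))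
    (hle : ∀ t ∈ Set.Ioo (-1 : ℝ) 1, η t ^ 2 ≤ g t) (k : ℕ) :
    ∫ t, η t ^ 2 * (geg m k).eval t ^ 2 ≤ ∫ t in Set.Ioo (-1 : ℝ) 1, g t * (geg m k).eval t ^ 2 := by
  have hb : ∀ᵐ t ∂(volume.restrict (Set.Ioo (-1 : ℝ) 1)), ‖(geg m k).eval t ^ 2‖ ≤ 1 := by
    filter_upwards [ae_restrict_mem measurableSet_Ioo] with t ht
    rw [norm_pow, Real.norm_eq_abs]
    exact pow_le_one₀ (abs_nonneg _) (abs_geg_eval_le_one m k ⟨ht.1.le, ht.2.le⟩)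
  rw [← setIntegral_eq_integral_of_forall_compl_eq_zero (s := Set.Ioo (-1 : ℝ) 1)
    (fun t ht => by rw [h0 t ht]; ring)]
  refine setIntegral_mono_on ?_ ?_ measurableSet_Ioo fun t ht => ?_
  · exact (integrable_sq_of_le hη h0 hg hle).integrableOn.mul_bdd
      ((geg m k).continuous.pow 2).aestronglyMeasurable hb
  · exact hg.mul_bdd ((geg m k).continuous.pow 2).aestronglyMeasurable hb
  · exact mul_le_mul_of_nonneg_right (hle t ht) (sq_nonneg _)

lemma exists_etaM_bound (hs : s ∈ Set.Icc (-((m : ℝ) / 2)) 0) (hβm : -s - (m : ℝ) / 2 < βm) :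
    Integrable (fun t => etaM m βp βm t ^ 2) ∧ ∃ C : ℝ, 0 ≤ C ∧ ∀ k,
      ∫ t, etaM m βp βm t ^ 2 * (geg m k).eval t ^ 2 ≤ C * (1 + (sphEig m k : ℝ)) ^ s := by
  obtain ⟨C0, hC0, h0⟩ := symb_mul_dens_sq_le m βp βm
  -- Equivalent to the hypothesis on β₋.
  have he : -(2 * s) - 1 < 2 * βm + ((m : ℝ) - 1) := by linarith
  have he1 : -1 < 2 * βm + ((m : ℝ) - 1) := by linarith [hs.2]
  obtain ⟨C1, hC1, h1⟩ := exists_integral_rpow_mul_geg_sq_le hs he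
  have hle : ∀ t ∈ Set.Ioo (-1 : ℝ) 1, etaM m βp βm t ^ 2 ≤
      kap m ^ 2 * C0 * (1 - t ^ 2) ^ (2 * βm + ((m : ℝ) - 1)) := by
    intro t ht
    rw [etaM, mul_pow, mul_assoc]
    exact mul_le_mul_of_nonneg_left (h0 t ht) (sq_nonneg _)
  have hg := (integrableOn_one_sub_sq_rpow he1).const_mul (kap m ^ 2 * C0)
  refine ⟨integrable_sq_of_le (measurable_etaM m βp βm) (fun t => etaM_of_notMem m βp βm) hg hle,
    kap m ^ 2 * C0 * C1, by positivity, fun k => ?_⟩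
  refine (integral_sq_mul_geg_sq_le (measurable_etaM m βp βm) (fun t => etaM_of_notMem m βp βm)
    hg hle k).trans ?_
  simp_rw [mul_assoc (kap m ^ 2 * C0)]
  rw [integral_const_mul]
  exact mul_le_mul_of_nonneg_left (h1 k) (by positivity)

/-- No decay in k is needed here: the dominating profile serves only to make a series converge in
L². -/
lemma exists_etaH_bound (hs : s ∈ Set.Icc (-((m : ℝ) / 2)) 0) (hβm : -s - (m : ℝ) / 2 < βm) :
    Integrable (fun t => etaH m βp βm t ^ 2) ∧ ∃ C : ℝ, 0 ≤ C ∧ ∀ k,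
      ∫ t, etaH m βp βm t ^ 2 * (geg m k).eval t ^ 2 ≤ C := by
  obtain ⟨C0, hC0, h0⟩ := symb_mul_dens_sq_le m βp βm
  have he1 : -1 < 2 * βm + ((m : ℝ) - 1) := by linarith [hs.2]
  have hm1 : -1 < ((m : ℝ) - 1) / 2 := by linarith [(Nat.cast_nonneg m : (0 : ℝ) ≤ m)]
  set g : ℝ → ℝ := fun t => 2 * kap m ^ 2 * (C0 * (1 - t ^ 2) ^ (2 * βm + ((m : ℝ) - 1)) +
    (1 - t ^ 2) ^ (((m : ℝ) - 1) / 2)) with hgd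
  have hle : ∀ t ∈ Set.Ioo (-1 : ℝ) 1, etaH m βp βm t ^ 2 ≤ g t := by
    intro t ht
    have h1 := h0 t ht
    have h2 : √(dens m t) ^ 2 = (1 - t ^ 2) ^ (((m : ℝ) - 1) / 2) := by
      rw [Real.sq_sqrt (dens_nonneg m t), dens_of_mem m ht]
    rw [etaH, mul_pow]
    simp only [hgd]
    rw [← h2]
    nlinarith [mul_nonneg (sq_nonneg (kap m)) (sq_nonneg (symb βp βm t * dens m t - √(dens m t))),
      mul_le_mul_of_nonneg_left h1 (sq_nonneg (kap m))]
  have hg : IntegrableOn g (Set.Ioo (-1) 1) :=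
    (((integrableOn_one_sub_sq_rpow he1).const_mul C0).add
      (integrableOn_one_sub_sq_rpow hm1)).const_mul _
  have hg0 : ∀ t ∈ Set.Ioo (-1 : ℝ) 1, 0 ≤ g t := fun t ht => (sq_nonneg _).trans (hle t ht)
  refine ⟨integrable_sq_of_le (measurable_etaH m βp βm) (fun t => etaH_of_notMem m βp βm) hg hle,
    ∫ t in Set.Ioo (-1 : ℝ) 1, g t, setIntegral_nonneg measurableSet_Ioo hg0, fun k => ?_⟩
  refine (integral_sq_mul_geg_sq_le (measurable_etaH m βp βm) (fun t => etaH_of_notMem m βp βm)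
    hg hle k).trans ?_
  have hb : ∀ t ∈ Set.Ioo (-1 : ℝ) 1, (geg m k).eval t ^ 2 ≤ 1 := by
    intro t ht
    rw [← sq_abs]
    exact pow_le_one₀ (abs_nonneg _) (abs_geg_eval_le_one m k ⟨ht.1.le, ht.2.le⟩)
  refine setIntegral_mono_on ?_ hg measurableSet_Ioo fun t ht =>
    mul_le_of_le_one_right (hg0 t ht) (hb t ht)
  refine hg.mul_bdd (c := 1) ((geg m k).continuous.pow 2).aestronglyMeasurable ?_
  filter_upwards [ae_restrict_mem measurableSet_Ioo] with t ht
  rw [Real.norm_of_nonneg (sq_nonneg _)]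
  exact hb t ht

end EtaBounds

end KineticTransport

end

/-! ### The L² Fourier transform and radial functions -/

noncomputable section

namespace KineticTransport

open scoped InnerProductSpace
open Filter

section LTwo

variable {α : Type*} [MeasurableSpace α] {μ : Measure α}

lemma eLpNorm_two_eq (g : α → ℂ) : eLpNorm g 2 μ = (∫⁻ x, ‖g x‖ₑ ^ 2 ∂μ) ^ (1 / 2 : ℝ) := by
  simp [eLpNorm_eq_lintegral_rpow_enorm_toReal (p := 2) (by norm_num) (by norm_num)]

lemma memLp_two_iff_lintegral {g : α → ℂ} (hg : AEStronglyMeasurable g μ) :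
    MemLp g 2 μ ↔ ∫⁻ x, ‖g x‖ₑ ^ 2 ∂μ < ⊤ := by
  rw [MemLp, and_iff_right hg, eLpNorm_two_eq, ENNReal.rpow_lt_top_iff_of_pos (by norm_num)]

lemma lintegral_enorm_sq_ne_top {g : α → ℂ} (hg : MemLp g 2 μ) : ∫⁻ x, ‖g x‖ₑ ^ 2 ∂μ ≠ ⊤ :=
  ((memLp_two_iff_lintegral hg.1).1 hg).ne

lemma enorm_toLp_sq {g : α → ℂ} (hg : MemLp g 2 μ) :
    ‖hg.toLp g‖ₑ ^ 2 = ∫⁻ x, ‖g x‖ₑ ^ 2 ∂μ := by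
  rw [Lp.enorm_toLp, eLpNorm_two_eq, ← ENNReal.rpow_natCast, ← ENNReal.rpow_mul]
  norm_num

lemma inner_toLp_toLp {g h : α → ℂ} (hg : MemLp g 2 μ) (hh : MemLp h 2 μ) :
    ⟪hg.toLp g, hh.toLp h⟫_ℂ = ∫ x, starRingEnd ℂ (g x) * h x ∂μ := by
  rw [L2.inner_def]
  refine integral_congr_ae ?_
  filter_upwards [hg.coeFn_toLp, hh.coeFn_toLp] with x h1 h2
  rw [h1, h2, RCLike.inner_apply']

end LTwo

section Fourier

variable {E : Type*} [NormedAddCommGroup E] [InnerProductSpace ℝ E] [FiniteDimensional ℝ E]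
  [MeasurableSpace E] [BorelSpace E]

lemma integral_Lp_mul_fourier (f : Lp ℂ 2 (volume : Measure E)) (φ : 𝓢(E, ℂ)) :
    ∫ x, f x * 𝓕 φ x = ∫ x, (𝓕 f : Lp ℂ 2 (volume : Measure E)) x * φ x := by
  have h := congrArg (fun T : 𝓢'(E, ℂ) => T φ) (Lp.fourier_toTemperedDistribution_eq f)
  simp only [TemperedDistribution.fourier_apply, Lp.toTemperedDistribution_apply,
    smul_eq_mul] at h
  simpa only [mul_comm] using h

lemma integral_mul_fourier_of_integrable {g : E → ℂ} (hg : Integrable g) (φ : 𝓢(E, ℂ)) :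
    ∫ x, g x * 𝓕 φ x = ∫ x, 𝓕 g x * φ x := by
  have h := VectorFourier.integral_fourierIntegral_smul_eq_flip (L := innerₗ E) (μ := volume)
    (ν := volume) (f := g) (g := fun x => φ x) Real.continuous_fourierChar continuous_inner hg φ.integrable
  rw [flip_innerₗ] at h
  simp only [smul_eq_mul] at h
  rw [SchwartzMap.fourier_coe]
  exact h.symm

lemma fourier_ae_eq_of_integrable {g : E → ℂ} (hg : Integrable g) (hg2 : MemLp g 2) :
    (𝓕 (hg2.toLp g) : Lp ℂ 2 (volume : Measure E)) =ᵐ[volume] 𝓕 g := by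
  have hc : Continuous (𝓕 g) := VectorFourier.fourierIntegral_continuous
    Real.continuous_fourierChar continuous_inner hg
  refine ae_eq_of_integral_contDiff_smul_eq
    ((Lp.memLp _).locallyIntegrable (by norm_num)) hc.locallyIntegrable fun u hu hs => ?_
  have hs' : HasCompactSupport fun x => (u x : ℂ) := hs.comp_left (g := fun t : ℝ => (t : ℂ)) rfl
  have hu' : ContDiff ℝ ∞ fun x => (u x : ℂ) := Complex.ofRealCLM.contDiff.comp hu
  have h1 := integral_Lp_mul_fourier (hg2.toLp g) (hs'.toSchwartzMap hu')
  have h2 := integral_mul_fourier_of_integrable hg (hs'.toSchwartzMap hu')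
  have h3 : ∫ x, hg2.toLp g x * 𝓕 (hs'.toSchwartzMap hu') x =
      ∫ x, g x * 𝓕 (hs'.toSchwartzMap hu') x :=
    integral_congr_ae (hg2.coeFn_toLp.mono fun x hx => by simp only [hx])
  rw [h3, h2] at h1
  simp only [Complex.real_smul]
  calc _ = ∫ x, (𝓕 (hg2.toLp g) : Lp ℂ 2 (volume : Measure E)) x * (hs'.toSchwartzMap hu') x :=
        integral_congr_ae (Eventually.of_forall fun x => mul_comm _ _)
    _ = _ := h1.symm
    _ = _ := integral_congr_ae (Eventually.of_forall fun x => mul_comm _ _)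

/-- The reflection exchanging x and y leaves a radial function invariant and commutes with the
Fourier transform. -/
lemma fourier_eq_of_norm_eq {g : E → ℂ} {B : ℝ → ℂ} (hg : g =ᵐ[volume] fun x => B ‖x‖) {x y : E}
    (hxy : ‖x‖ = ‖y‖) : 𝓕 g x = 𝓕 g y := by
  rw [Real.fourier_congr_ae hg, Real.fourier_congr_ae hg]
  have h := Real.fourier_comp_linearIsometry (Submodule.reflection (ℝ ∙ (x - y))ᗮ)
    (fun x : E => B ‖x‖) x
  rw [Submodule.reflection_sub hxy] at h
  rw [← h]
  have h' : (fun x : E => B ‖x‖) ∘ (Submodule.reflection (ℝ ∙ (x - y))ᗮ) = fun x : E => B ‖x‖ := by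
    funext z
    simp
  rw [h']

/-- Truncations to balls are integrable, so their transforms are defined pointwise and constant on
spheres. A subsequence of these converges almost everywhere to the L² transform. -/
lemma fourier_radial {f : Lp ℂ 2 (volume : Measure E)} {B : ℝ → ℂ}
    (hf : f =ᵐ[volume] fun x => B ‖x‖) :
    ∃ F : ℝ → ℂ, (𝓕 f : Lp ℂ 2 (volume : Measure E)) =ᵐ[volume] fun x => F ‖x‖ := by
  let g : ℕ → E → ℂ := fun n => (Metric.ball (0 : E) n).indicator f
  have hg2 : ∀ n, MemLp (g n) 2 := fun n => (Lp.memLp f).indicator measurableSet_ball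
  have hg1 : ∀ n, Integrable (g n) := fun n => by
    rw [integrable_indicator_iff measurableSet_ball]
    have : IsFiniteMeasure ((volume : Measure E).restrict (Metric.ball (0 : E) n)) :=
      ⟨by simpa using measure_ball_lt_top⟩
    exact ((Lp.memLp f).restrict _).integrable (by norm_num)
  have hlim : Tendsto (fun n => (hg2 n).toLp (g n)) atTop (nhds f) := by
    have hf2 := Lp.memLp f
    rw [← Lp.toLp_coeFn f hf2, Lp.tendsto_Lp_iff_tendsto_eLpNorm'' g hg2 f hf2]
    simp only [eLpNorm_two_eq]
    rw [show (0 : ℝ≥0∞) = 0 ^ (1 / 2 : ℝ) by norm_num]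
    refine Tendsto.ennrpow_const _ ?_
    rw [show (0 : ℝ≥0∞) = ∫⁻ _ : E, 0 by simp]
    refine tendsto_lintegral_of_dominated_convergence' (fun x => ‖f x‖ₑ ^ 2)
      (fun n => ((hg2 n).sub hf2).1.enorm.pow_const 2) (fun n => Eventually.of_forall fun x => ?_)
      (lintegral_enorm_sq_ne_top hf2) (Eventually.of_forall fun x => ?_)
    · by_cases hx : x ∈ Metric.ball (0 : E) n <;> simp [g, hx]
    · refine tendsto_const_nhds.congr' ?_
      obtain ⟨N, hN⟩ := exists_nat_gt ‖x‖
      filter_upwards [eventually_ge_atTop N] with n hn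
      have : x ∈ Metric.ball (0 : E) n := by
        rw [mem_ball_zero_iff]; exact hN.trans_le (by exact_mod_cast hn)
      simp [g, this]
  have hlim' : Tendsto (fun n => (𝓕 ((hg2 n).toLp (g n)) : Lp ℂ 2 (volume : Measure E))) atTop
      (nhds (𝓕 f)) := ((Lp.fourierTransformₗᵢ E ℂ).continuous.tendsto f).comp hlim
  obtain ⟨ns, -, hns⟩ := (tendstoInMeasure_of_tendsto_Lp hlim').exists_seq_tendsto_ae
  have hrad : ∀ n, ∀ x y : E, ‖x‖ = ‖y‖ → 𝓕 (g n) x = 𝓕 (g n) y := fun n x y hxy =>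
    fourier_eq_of_norm_eq (B := fun r => if r < n then B r else 0)
      (hf.mono fun z hz => by
        show (Metric.ball (0 : E) n).indicator f z = if ‖z‖ < n then B ‖z‖ else 0
        by_cases h : ‖z‖ < n
        · rw [if_pos h, Set.indicator_of_mem (mem_ball_zero_iff.2 h), hz]
        · rw [if_neg h, Set.indicator_of_notMem (fun h' => h (mem_ball_zero_iff.1 h'))]) hxy
  classical
  -- The profile at r is the limit at some point of norm r; which point is chosen does not matter,
  -- by `hrad`.
  refine ⟨fun r => if h : ∃ y : E, ‖y‖ = r then
    limUnder atTop (fun k => 𝓕 (g (ns k)) h.choose) else 0, ?_⟩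
  have hall : ∀ᵐ x, ∀ n, (𝓕 ((hg2 n).toLp (g n)) : Lp ℂ 2 (volume : Measure E)) x = 𝓕 (g n) x :=
    ae_all_iff.2 fun n => fourier_ae_eq_of_integrable (hg1 n) (hg2 n)
  filter_upwards [hns, hall] with x hx hx'
  have he : ∃ y : E, ‖y‖ = ‖x‖ := ⟨x, rfl⟩
  rw [dif_pos he]
  refine (Tendsto.limUnder_eq ?_).symm
  refine hx.congr fun k => ?_
  rw [hx', hrad _ _ _ he.choose_spec]

end Fourier

section Polar

variable {E : Type*} [NormedAddCommGroup E] [InnerProductSpace ℝ E] [FiniteDimensional ℝ E]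
  [MeasurableSpace E] [BorelSpace E] [Nontrivial E]

/-- Polar coordinates factor both integrals over E. The total mass on the left removes the radial
integral from the statement. -/
lemma integral_norm_mul_sphProj (w : Metric.sphere (0 : E) 1) (p : ℝ → ℂ)
    (q : Metric.sphere (0 : E) 1 → ℂ) :
    ((volume : Measure E).toSphere.real Set.univ : ℂ) * ∫ x : E, p ‖x‖ * q (sphProj w x) =
      (∫ x : E, p ‖x‖) * ∫ v, q v ∂(volume : Measure E).toSphere := by
  have key : ∀ q : Metric.sphere (0 : E) 1 → ℂ, ∫ x : E, p ‖x‖ * q (sphProj w x) =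
      (∫ v, q v ∂(volume : Measure E).toSphere) *
        ∫ r, p r ∂(Measure.volumeIoiPow (Module.finrank ℝ E - 1)) := by
    intro q
    have h1 : ∫ x : E, p ‖x‖ * q (sphProj w x) =
        ∫ x : ({0}ᶜ : Set E), p ‖(x : E)‖ * q (sphProj w (x : E)) ∂((volume : Measure E).comap (↑)) := by
      rw [integral_subtype_comap (measurableSet_singleton _).compl
        (fun x => p ‖x‖ * q (sphProj w x)), restrict_compl_singleton]
    rw [h1, ← integral_prod_mul, ← ((volume : Measure E).measurePreserving_homeomorphUnitSphereProd).integral_comp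
      (Homeomorph.measurableEmbedding _)]
    refine integral_congr_ae (Eventually.of_forall fun x => ?_)
    have hx : (x : E) ≠ 0 := x.2
    have : sphProj w (x : E) = ((homeomorphUnitSphereProd E) x).1 := by
      ext1
      rw [coe_sphProj w hx]
      simp
    simp only [this, homeomorphUnitSphereProd_apply_snd_coe]
    ring
  have k1 := key 1
  simp only [Pi.one_apply, mul_one, integral_const, Complex.real_smul] at k1
  rw [key, k1]
  ring

end Polar

end KineticTransport

end

/-! ### Spherical harmonic coefficients on phase space -/

noncomputable section

namespace KineticTransport

open scoped InnerProductSpace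
open Filter

section SphereCoefficients

variable {d : ℕ}

/-- The coefficient of `f (x, ·)` along the function `Y` on the sphere. -/
def sphCoef (Y : Sph d → ℂ) (f : Space d × Sph d → ℂ) (x : Space d) : ℂ :=
  ∫ v, starRingEnd ℂ (Y v) * f (x, v) ∂(surf d)

lemma memLp_slice {f : Space d × Sph d → ℂ} (hf : MemLp f 2 (phase d)) :
    ∀ᵐ x, MemLp (fun v => f (x, v)) 2 (surf d) := by
  have h1 : AEMeasurable (fun p => ‖f p‖ₑ ^ 2) (phase d) := hf.1.enorm.pow_const 2
  have h2 := lintegral_enorm_sq_ne_top hf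
  rw [phase, lintegral_prod _ h1] at h2
  filter_upwards [ae_lt_top' h1.lintegral_prod_right' h2, hf.1.prodMk_left] with x hx hx'
  exact (memLp_two_iff_lintegral hx').2 hx

lemma sphCoef_eq_inner {Y : Sph d → ℂ} {b : SphL2 d} (hb : b =ᵐ[surf d] Y)
    {f : Space d × Sph d → ℂ} {x : Space d} (hf : MemLp (fun v => f (x, v)) 2 (surf d)) :
    sphCoef Y f x = ⟪b, hf.toLp _⟫_ℂ := by
  have hY : MemLp Y 2 (surf d) := (Lp.memLp b).ae_eq hb
  have : b = hY.toLp Y := by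
    ext1
    exact hb.trans hY.coeFn_toLp.symm
  rw [this, inner_toLp_toLp, sphCoef]

lemma aestronglyMeasurable_sphCoef {Y : Sph d → ℂ} (hY : Continuous Y) {f : Space d × Sph d → ℂ}
    (hf : AEStronglyMeasurable f (phase d)) : AEStronglyMeasurable (sphCoef Y f) := by
  refine AEStronglyMeasurable.integral_prod_right' (f := fun p : Space d × Sph d =>
    starRingEnd ℂ (Y p.2) * f p) (μ := volume) (ν := surf d) ?_
  exact ((Complex.continuous_conj.comp (hY.comp continuous_snd)).aestronglyMeasurable).mul hf

variable {ι : Type*} [Countable ι] (b : HilbertBasis ι ℂ (SphL2 d)) {Y : ι → Sph d → ℂ}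

lemma tsum_sphCoef_sq (hb : ∀ j, b j =ᵐ[surf d] Y j) {f : Space d × Sph d → ℂ} {x : Space d}
    (hf : MemLp (fun v => f (x, v)) 2 (surf d)) :
    ∑' j, ‖sphCoef (Y j) f x‖ₑ ^ 2 = ∫⁻ v, ‖f (x, v)‖ₑ ^ 2 ∂(surf d) := by
  rw [← enorm_toLp_sq hf]
  simp_rw [fun j => sphCoef_eq_inner (hb j) hf]
  set φ := hf.toLp _
  have h := (b.hasSum_inner_mul_inner φ φ).mapL Complex.reCLM
  have h' : HasSum (fun j => ‖⟪b j, φ⟫_ℂ‖ ^ 2) (‖φ‖ ^ 2) := by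
    convert h using 1
    · ext j
      rw [Complex.reCLM_apply, ← inner_conj_symm (b j) φ, RCLike.mul_conj, RCLike.norm_conj]
      norm_cast
    · rw [inner_self_eq_norm_sq_to_K, Complex.reCLM_apply]
      norm_cast
  rw [← ofReal_norm, ← ENNReal.ofReal_pow (norm_nonneg _), ← h'.tsum_eq,
    ENNReal.ofReal_tsum_of_nonneg (fun _ => sq_nonneg _) h'.summable]
  refine tsum_congr fun j => ?_
  rw [ENNReal.ofReal_pow (norm_nonneg _), ofReal_norm]

lemma hasSum_sphCoef_mul (hb : ∀ j, b j =ᵐ[surf d] Y j) {f g : Space d × Sph d → ℂ} {x : Space d}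
    (hf : MemLp (fun v => f (x, v)) 2 (surf d)) (hg : MemLp (fun v => g (x, v)) 2 (surf d)) :
    HasSum (fun j => starRingEnd ℂ (sphCoef (Y j) g x) * sphCoef (Y j) f x)
      (∫ v, starRingEnd ℂ (g (x, v)) * f (x, v) ∂(surf d)) := by
  have h := b.hasSum_inner_mul_inner (hg.toLp _) (hf.toLp _)
  rw [inner_toLp_toLp] at h
  have e : (fun j => starRingEnd ℂ (sphCoef (Y j) g x) * sphCoef (Y j) f x) =
      fun j => ⟪hg.toLp _, b j⟫_ℂ * ⟪b j, hf.toLp _⟫_ℂ := by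
    funext j
    rw [sphCoef_eq_inner (hb j) hf, sphCoef_eq_inner (hb j) hg, inner_conj_symm]
  rw [e]
  exact h

lemma tsum_lintegral_sphCoef_sq (hb : ∀ j, b j =ᵐ[surf d] Y j) (hY : ∀ j, Continuous (Y j))
    {f : Space d × Sph d → ℂ} (hf : MemLp f 2 (phase d)) :
    ∑' j, ∫⁻ x, ‖sphCoef (Y j) f x‖ₑ ^ 2 = ∫⁻ p, ‖f p‖ₑ ^ 2 ∂(phase d) := by
  rw [← lintegral_tsum fun j => (aestronglyMeasurable_sphCoef (hY j) hf.1).enorm.pow_const 2,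
    phase, lintegral_prod _ (hf.1.enorm.pow_const 2)]
  refine lintegral_congr_ae ?_
  filter_upwards [memLp_slice hf] with x hx
  exact tsum_sphCoef_sq b hb hx

lemma memLp_sphCoef {b : SphL2 d} {Y : Sph d → ℂ} (hb : b =ᵐ[surf d] Y) (hY : Continuous Y)
    {f : Space d × Sph d → ℂ} (hf : MemLp f 2 (phase d)) : MemLp (sphCoef Y f) 2 := by
  rw [memLp_two_iff_lintegral (aestronglyMeasurable_sphCoef hY hf.1)]
  have h1 : ∀ᵐ x, ‖sphCoef Y f x‖ₑ ^ 2 ≤ ‖b‖ₑ ^ 2 * ∫⁻ v, ‖f (x, v)‖ₑ ^ 2 ∂(surf d) := by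
    filter_upwards [memLp_slice hf] with x hx
    rw [sphCoef_eq_inner hb hx, ← enorm_toLp_sq hx, ← mul_pow]
    gcongr
    simp only [← ofReal_norm, ← ENNReal.ofReal_mul (norm_nonneg _)]
    exact ENNReal.ofReal_le_ofReal (norm_inner_le_norm _ _)
  refine (lintegral_mono_ae h1).trans_lt ?_
  rw [lintegral_const_mul' _ _ (by finiteness), ← lintegral_prod _ (hf.1.enorm.pow_const 2)]
  exact ENNReal.mul_lt_top (by finiteness) (lintegral_enorm_sq_ne_top hf).lt_top

lemma sphCoef_radial (Y : Sph d → ℂ) {f : Space d × Sph d → ℂ} (hf : IsRadialInSpace d f) :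
    ∃ B : ℝ → ℂ, sphCoef Y f =ᵐ[volume] fun x => B ‖x‖ := by
  obtain ⟨F, hF⟩ := hf
  refine ⟨fun r => ∫ v, starRingEnd ℂ (Y v) * F r v ∂(surf d), ?_⟩
  filter_upwards [Measure.ae_ae_of_ae_prod hF] with x hx
  exact integral_congr_ae (hx.mono fun v hv => by simp only [hv])

end SphereCoefficients

end KineticTransport

end

/-! ### Separated functions of slope and spatial frequency -/

noncomputable section

namespace KineticTransport

open scoped InnerProductSpace
open Filter

section SpaceTimeIntegrals

variable {d : ℕ}

lemma lintegral_spaceTime {F : SpaceTime d → ℝ≥0∞} (hF : AEMeasurable F) :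
    ∫⁻ z, F z = ∫⁻ x, ∫⁻ t, F (WithLp.toLp 2 (x, t)) := by
  have h := WithLp.volume_preserving_toLp (Space d) ℝ
  have he := (MeasurableEquiv.toLp 2 (Space d × ℝ)).measurableEmbedding
  rw [← h.lintegral_comp_emb he, Measure.volume_eq_prod, lintegral_prod]
  exact hF.comp_quasiMeasurePreserving h.quasiMeasurePreserving

lemma integral_spaceTime {F : SpaceTime d → ℂ} (hF : Integrable F) :
    ∫ z, F z = ∫ x, ∫ t, F (WithLp.toLp 2 (x, t)) := by
  have h := WithLp.volume_preserving_toLp (Space d) ℝ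
  have he := (MeasurableEquiv.toLp 2 (Space d × ℝ)).measurableEmbedding
  have h1 := h.integral_comp he F
  have h2 := (h.integrable_comp_emb he).2 hF
  rw [← h1, Measure.volume_eq_prod]
  exact integral_prod _ h2

lemma aestronglyMeasurable_comp_fst {g : Space d → ℂ} (hg : AEStronglyMeasurable g) :
    AEStronglyMeasurable fun ζ : SpaceTime d => g ζ.fst := by
  have h := WithLp.volume_preserving_ofLp (Space d) ℝ
  have h1 : AEStronglyMeasurable (fun p : Space d × ℝ => g p.1) volume := hg.comp_fst
  exact h1.comp_measurePreserving h

lemma lintegral_comp_neg_div {r : ℝ} (hr : 0 < r) (F : ℝ → ℝ≥0∞) :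
    ENNReal.ofReal r⁻¹ * ∫⁻ t, F (-(t / r)) = ∫⁻ t, F t := by
  have h0 : -r⁻¹ ≠ 0 := neg_ne_zero.2 (inv_ne_zero hr.ne')
  have h := Real.map_volume_mul_left h0
  have h1 : ∫⁻ t, F (-(t / r)) = ∫⁻ t, F t ∂(Measure.map (fun t => -r⁻¹ * t) volume) := by
    refine Eq.trans (lintegral_congr fun t => ?_)
      ((Homeomorph.mulLeft₀ _ h0).measurableEmbedding.lintegral_map F).symm
    simp [div_eq_inv_mul]
  rw [h1, h, lintegral_smul_measure, smul_eq_mul, ← mul_assoc, ← ENNReal.ofReal_mul (by positivity)]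
  simp [abs_of_pos hr, hr.ne']

lemma integral_comp_neg_div {r : ℝ} (hr : 0 < r) (F : ℝ → ℂ) :
    ((r⁻¹ : ℝ) : ℂ) * ∫ t, F (-(t / r)) = ∫ t, F t := by
  have h := Measure.integral_comp_mul_left F (-r⁻¹)
  have h1 : ∫ t, F (-(t / r)) = ∫ t, F (-r⁻¹ * t) :=
    integral_congr_ae (Eventually.of_forall fun t => by simp [div_eq_inv_mul])
  rw [h1, h, Complex.real_smul, ← mul_assoc, ← Complex.ofReal_mul]
  simp [abs_of_pos hr, hr.ne']

/-- The slope `-τ / |ξ|` of a frequency `(ξ, τ)`. -/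
def slope (ζ : SpaceTime d) : ℝ := -(ζ.snd / ‖ζ.fst‖)

lemma measurable_slope : Measurable (slope (d := d)) := by
  unfold slope
  fun_prop

/-- The function `|ξ|^{-1/2} q(-τ/|ξ|) g(ξ)` on the frequency space. -/
def sepFun (q : ℝ → ℝ) (g : Space d → ℂ) (ζ : SpaceTime d) : ℂ :=
  (((√‖ζ.fst‖)⁻¹ * q (slope ζ) : ℝ) : ℂ) * g ζ.fst

lemma sepFun_toLp (q : ℝ → ℝ) (g : Space d → ℂ) (x : Space d) (t : ℝ) :
    sepFun q g (WithLp.toLp 2 (x, t)) = (((√‖x‖)⁻¹ * q (-(t / ‖x‖)) : ℝ) : ℂ) * g x := rfl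

lemma aestronglyMeasurable_sepFun {q : ℝ → ℝ} (hq : Measurable q) {g : Space d → ℂ}
    (hg : AEStronglyMeasurable g) : AEStronglyMeasurable (sepFun q g) := by
  refine AEStronglyMeasurable.mul ?_ (aestronglyMeasurable_comp_fst hg)
  refine (Complex.measurable_ofReal.comp (Measurable.mul ?_ (hq.comp measurable_slope))).aestronglyMeasurable
  fun_prop

end SpaceTimeIntegrals

section SepFun

variable {m : ℕ}

lemma ae_norm_pos : ∀ᵐ x : Space (m + 2), 0 < ‖x‖ := by
  have : ∀ᵐ x : Space (m + 2), x ≠ 0 := by simp [ae_iff]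
  exact this.mono fun x hx => norm_pos_iff.2 hx

/-- For fixed ξ the substitution t = -τ/|ξ| has Jacobian |ξ|, which the square of |ξ|^{-1/2}
cancels. -/
lemma lintegral_sepFun {q : ℝ → ℝ} (hq : Measurable q) {g : Space (m + 2) → ℂ}
    (hg : AEStronglyMeasurable g) :
    ∫⁻ ζ, ‖sepFun q g ζ‖ₑ ^ 2 = (∫⁻ t, ‖q t‖ₑ ^ 2) * ∫⁻ x, ‖g x‖ₑ ^ 2 := by
  rw [lintegral_spaceTime ((aestronglyMeasurable_sepFun hq hg).enorm.pow_const 2),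
    ← lintegral_const_mul'' _ (hg.enorm.pow_const 2)]
  refine lintegral_congr_ae ?_
  filter_upwards [ae_norm_pos] with x hx
  rw [← lintegral_comp_neg_div hx (fun t => ‖q t‖ₑ ^ 2), mul_assoc, ← lintegral_mul_const _ (by fun_prop),
    ← lintegral_const_mul _ (by fun_prop)]
  refine lintegral_congr fun t => ?_
  have e : ‖(((√‖x‖)⁻¹ * q (-(t / ‖x‖)) : ℝ) : ℂ)‖ₑ ^ 2 =
      ENNReal.ofReal ‖x‖⁻¹ * ‖q (-(t / ‖x‖))‖ₑ ^ 2 := by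
    rw [← ofReal_norm, ← ofReal_norm, ← ENNReal.ofReal_pow (norm_nonneg _),
      ← ENNReal.ofReal_pow (norm_nonneg _), ← ENNReal.ofReal_mul (by positivity),
      Complex.norm_real, norm_mul, mul_pow, Real.norm_eq_abs, sq_abs, inv_pow, Real.sq_sqrt hx.le]
  simp only [sepFun_toLp, enorm_mul, mul_pow, e]
  ring

lemma memLp_sepFun {q : ℝ → ℝ} (hq : Measurable q) (hq2 : Integrable fun t => q t ^ 2)
    {g : Space (m + 2) → ℂ} (hg : MemLp g 2) : MemLp (sepFun q g) 2 := by
  rw [memLp_two_iff_lintegral (aestronglyMeasurable_sepFun hq hg.1), lintegral_sepFun hq hg.1]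
  refine ENNReal.mul_lt_top ?_ (lintegral_enorm_sq_ne_top hg).lt_top
  have := hq2.2
  simpa [HasFiniteIntegral, enorm_pow] using this

lemma integral_sepFun_mul_sepFun {q q' : ℝ → ℝ} (hq : Measurable q)
    (hq2 : Integrable fun t => q t ^ 2) (hq' : Measurable q') (hq2' : Integrable fun t => q' t ^ 2)
    {g g' : Space (m + 2) → ℂ} (hg : MemLp g 2) (hg' : MemLp g' 2) :
    ∫ ζ, starRingEnd ℂ (sepFun q g ζ) * sepFun q' g' ζ =
      ((∫ t, q t * q' t : ℝ) : ℂ) * ∫ x, starRingEnd ℂ (g x) * g' x := by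
  have hint : Integrable fun ζ => starRingEnd ℂ (sepFun q g ζ) * sepFun q' g' ζ :=
    MemLp.integrable_mul (memLp_sepFun hq hq2 hg).star (memLp_sepFun hq' hq2' hg')
  rw [integral_spaceTime hint, ← integral_const_mul]
  refine integral_congr_ae ?_
  filter_upwards [ae_norm_pos] with x hx
  rw [← integral_complex_ofReal, ← integral_comp_neg_div hx (fun t => ((q t * q' t : ℝ) : ℂ)),
    mul_assoc, ← integral_mul_const,
    ← integral_const_mul]
  refine integral_congr_ae (Eventually.of_forall fun t => ?_)
  have e : ((‖x‖⁻¹ : ℝ) : ℂ) = (((√‖x‖)⁻¹ : ℝ) : ℂ) * (((√‖x‖)⁻¹ : ℝ) : ℂ) := by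
    rw [← Complex.ofReal_mul, ← mul_inv, Real.mul_self_sqrt hx.le]
  simp only [sepFun_toLp, map_mul, Complex.conj_ofReal, e]
  push_cast
  ring

end SepFun

end KineticTransport

end

/-! ### The velocity average as dual of the ray transform -/

noncomputable section

namespace KineticTransport

open scoped InnerProductSpace
open Filter

section Transport

variable {d : ℕ}

instance : SFinite (phase d) :=
  inferInstanceAs (SFinite ((volume : Measure (Space d)).prod (surf d)))

lemma norm_fst_le (z : SpaceTime d) : ‖z.fst‖ ≤ ‖z‖ := by
  have h := WithLp.prod_norm_sq_eq_of_L2 z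
  nlinarith [norm_nonneg z, norm_nonneg z.fst, sq_nonneg ‖z.snd‖]

lemma abs_snd_le (z : SpaceTime d) : |z.snd| ≤ ‖z‖ := by
  have h := WithLp.prod_norm_sq_eq_of_L2 z
  rw [← Real.norm_eq_abs]
  nlinarith [norm_nonneg z, norm_nonneg z.snd, sq_nonneg ‖z.fst‖]

/-- The standard integrable majorant `(1 + |x|)^{-(d+1)}`. -/
def bracket (d : ℕ) (x : Space d) : ℝ := ((1 + ‖x‖) ^ (d + 1))⁻¹

lemma bracket_nonneg (x : Space d) : 0 ≤ bracket d x := by unfold bracket; positivity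

lemma bracket_le_one (x : Space d) : bracket d x ≤ 1 :=
  inv_le_one_of_one_le₀ (one_le_pow₀ (by linarith [norm_nonneg x]))

lemma integrable_bracket (d : ℕ) : Integrable (bracket d) := by
  have h := integrable_one_add_norm (E := Space d) (μ := volume) (r := (d + 1 : ℕ)) (by simp)
  refine h.congr (Eventually.of_forall fun x => ?_)
  simp only [bracket]
  rw [Real.rpow_neg (by positivity), Real.rpow_natCast]

lemma continuous_bracket (d : ℕ) : Continuous (bracket d) := by
  unfold bracket
  exact Continuous.inv₀ (by fun_prop) fun x => by positivity

lemma memLp_bracket (d : ℕ) : MemLp (fun x => (bracket d x : ℂ)) 2 := by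
  have hm : AEStronglyMeasurable (fun x => (bracket d x : ℂ)) volume :=
    (Complex.continuous_ofReal.comp (continuous_bracket d)).aestronglyMeasurable
  rw [memLp_two_iff_integrable_sq_norm hm]
  refine (integrable_bracket d).mono' (hm.norm.pow 2) (Eventually.of_forall fun x => ?_)
  rw [Complex.norm_real, Real.norm_of_nonneg (bracket_nonneg x), Real.norm_of_nonneg (sq_nonneg _)]
  nlinarith [bracket_nonneg x, bracket_le_one x]

lemma integrable_one_add_abs_sq : Integrable fun t : ℝ => ((1 + |t|) ^ 2)⁻¹ := by
  have h := integrable_one_add_norm (E := ℝ) (μ := volume) (r := (2 : ℕ)) (by simp)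
  refine h.congr (Eventually.of_forall fun x => ?_)
  simp only
  rw [Real.rpow_neg (by positivity), Real.rpow_natCast, Real.norm_eq_abs]

lemma schwartz_decay (ψ : 𝓢(SpaceTime d, ℂ)) : ∃ C : ℝ, 0 ≤ C ∧
    ∀ (z : SpaceTime d) (x : Space d) (t : ℝ), ‖x‖ ≤ 2 * ‖z‖ → |t| ≤ 2 * ‖z‖ →
      ‖ψ z‖ ≤ C * (bracket d x * ((1 + |t|) ^ 2)⁻¹) := by
  -- One power of 2 comes from 1 + ‖x‖ and 1 + |t| being at most 2(1 + ‖z‖), the other from the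
  -- seminorm estimate. The exponent d + 3 is d + 1 for the bracket plus 2 for time.
  refine ⟨2 ^ (d + 3) * (2 ^ (d + 3) *
    ((Finset.Iic (d + 3, 0)).sup fun m => SchwartzMap.seminorm ℝ m.1 m.2) ψ), by positivity, ?_⟩
  intro z x t hx ht
  have h := SchwartzMap.one_add_le_sup_seminorm_apply (𝕜 := ℝ) (m := (d + 3, 0)) le_rfl le_rfl ψ z
  rw [norm_iteratedFDeriv_zero] at h
  simp only at h
  have h1 : (1 + ‖x‖) ^ (d + 1) ≤ (2 * (1 + ‖z‖)) ^ (d + 1) := by gcongr; linarith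
  have h2 : (1 + |t|) ^ 2 ≤ (2 * (1 + ‖z‖)) ^ 2 := by gcongr; linarith
  rw [bracket, ← mul_inv, ← div_eq_mul_inv, le_div_iff₀ (by positivity)]
  calc ‖ψ z‖ * ((1 + ‖x‖) ^ (d + 1) * (1 + |t|) ^ 2)
      ≤ ‖ψ z‖ * ((2 * (1 + ‖z‖)) ^ (d + 1) * (2 * (1 + ‖z‖)) ^ 2) := by gcongr
    _ = 2 ^ (d + 3) * ((1 + ‖z‖) ^ (d + 3) * ‖ψ z‖) := by rw [mul_pow, mul_pow]; ring
    _ ≤ _ := by gcongr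

/-- The point reached at time `t` on the ray through `(x, 0)` with velocity `v`. -/
def rayPoint (x : Space d) (v : Sph d) (t : ℝ) : SpaceTime d :=
  WithLp.toLp 2 (x + t • (v : Space d), t)

lemma continuous_rayPoint :
    Continuous fun p : (Space d × Sph d) × ℝ => rayPoint p.1.1 p.1.2 p.2 := by
  unfold rayPoint
  exact (WithLp.prod_continuous_toLp 2 _ _).comp (by fun_prop)

lemma norm_sphere (v : Sph d) : ‖(v : Space d)‖ = 1 := mem_sphere_zero_iff_norm.1 v.2

lemma le_norm_rayPoint (x : Space d) (v : Sph d) (t : ℝ) :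
    ‖x‖ ≤ 2 * ‖rayPoint x v t‖ ∧ |t| ≤ 2 * ‖rayPoint x v t‖ := by
  have h1 : ‖x + t • (v : Space d)‖ ≤ _ := norm_fst_le (rayPoint x v t)
  have h2 : |t| ≤ _ := abs_snd_le (rayPoint x v t)
  have h3 : ‖x‖ ≤ ‖x + t • (v : Space d)‖ + |t| := by
    have := norm_sub_le (x + t • (v : Space d)) (t • (v : Space d))
    rwa [add_sub_cancel_right, norm_smul, norm_sphere, mul_one, Real.norm_eq_abs] at this
  constructor <;> linarith [norm_nonneg (rayPoint x v t)]

/-- The integral of a function on space-time along the ray through `(x, 0)` with velocity `v`. -/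
def rayTransform (ψ : SpaceTime d → ℂ) (p : Space d × Sph d) : ℂ :=
  ∫ t, ψ (rayPoint p.1 p.2 t)

/-- Up to reordering the variables this is a shear, which for fixed (t, v) is a translation in x. -/
lemma measurePreserving_ray :
    MeasurePreserving (fun p : SpaceTime d × Sph d =>
        ((p.1.fst - p.1.snd • (p.2 : Space d), p.2), p.1.snd))
      (volume.prod (surf d)) ((phase d).prod volume) := by
  have h1 := (WithLp.volume_preserving_ofLp (Space d) ℝ).prod (MeasurePreserving.id (surf d))
  have h2 := measurePreserving_prodAssoc (volume : Measure (Space d)) (volume : Measure ℝ) (surf d)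
  have h3 := Measure.measurePreserving_swap (μ := (volume : Measure (Space d)))
    (ν := (volume : Measure ℝ).prod (surf d))
  have h4 : MeasurePreserving (fun p : (ℝ × Sph d) × Space d => (p.1, p.2 - p.1.1 • (p.1.2 : Space d)))
      (((volume : Measure ℝ).prod (surf d)).prod volume)
      (((volume : Measure ℝ).prod (surf d)).prod volume) := by
    refine (MeasurePreserving.id _).skew_product
      (g := fun (a : ℝ × Sph d) (x : Space d) => x - a.1 • (a.2 : Space d)) ?_ ?_
    · exact Continuous.measurable (by unfold Function.uncurry; fun_prop)
    · exact Eventually.of_forall fun a => (measurePreserving_sub_right volume _).map_eq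
  have h5 := Measure.measurePreserving_swap (μ := (volume : Measure ℝ).prod (surf d))
    (ν := (volume : Measure (Space d)))
  have h6 := (MeasurePreserving.id (volume : Measure (Space d))).prod
    (Measure.measurePreserving_swap (μ := (volume : Measure ℝ)) (ν := surf d))
  have h7 := (measurePreserving_prodAssoc (volume : Measure (Space d)) (surf d)
    (volume : Measure ℝ)).symm
  exact h7.comp (h6.comp (h5.comp (h4.comp (h3.comp (h2.comp h1)))))

variable {f : Space d × Sph d → ℂ}

lemma integrable_mul_bracket (hf : MemLp f 2 (phase d)) :
    Integrable (fun p => ‖f p‖ * bracket d p.1) (phase d) := by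
  have h : MemLp (fun p : Space d × Sph d => (bracket d p.1 : ℂ)) 2 (phase d) :=
    (memLp_bracket d).comp_fst (surf d)
  have := (MemLp.integrable_mul hf h).norm
  refine this.congr (Eventually.of_forall fun p => ?_)
  simp [abs_of_nonneg (bracket_nonneg p.1)]

lemma integrable_mul_rayPoint (hf : MemLp f 2 (phase d)) (ψ : 𝓢(SpaceTime d, ℂ)) :
    Integrable (fun p : (Space d × Sph d) × ℝ => f p.1 * ψ (rayPoint p.1.1 p.1.2 p.2))
      ((phase d).prod volume) := by
  obtain ⟨C, hC, hψ⟩ := schwartz_decay ψ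
  refine (((integrable_mul_bracket hf).mul_prod integrable_one_add_abs_sq).const_mul C).mono' ?_ ?_
  · exact hf.1.comp_fst.mul (ψ.continuous.comp continuous_rayPoint).aestronglyMeasurable
  · refine Eventually.of_forall fun p => ?_
    have := hψ _ _ _ (le_norm_rayPoint p.1.1 p.1.2 p.2).1 (le_norm_rayPoint p.1.1 p.1.2 p.2).2
    rw [norm_mul]
    calc _ ≤ ‖f p.1‖ * (C * (bracket d p.1.1 * ((1 + |p.2|) ^ 2)⁻¹)) := by gcongr
      _ = _ := by ring

/-- Fubini in the coordinates that follow the rays. It shows that ρf pairs absolutely with Schwartz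
functions, although it need not lie in L². -/
lemma integrable_rho_mul (hf : MemLp f 2 (phase d)) (ψ : 𝓢(SpaceTime d, ℂ)) :
    Integrable (fun z => rho d f z * ψ z) ∧
      ∫ z, rho d f z * ψ z = ∫ p, f p * rayTransform ψ p ∂(phase d) := by
  have h1 := integrable_mul_rayPoint hf ψ
  have h2 := measurePreserving_ray.integrable_comp_of_integrable h1
  have e : ∀ z : SpaceTime d, rho d f z * ψ z = ∫ v, ((fun p : (Space d × Sph d) × ℝ =>
      f p.1 * ψ (rayPoint p.1.1 p.1.2 p.2)) ∘ fun p : SpaceTime d × Sph d =>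
        ((p.1.fst - p.1.snd • (p.2 : Space d), p.2), p.1.snd)) (z, v) ∂(surf d) := by
    intro z
    rw [rho, ← integral_mul_const]
    refine integral_congr_ae (Eventually.of_forall fun v => ?_)
    simp only [Function.comp_apply, rayPoint, sub_add_cancel]
    rfl
  simp_rw [e]
  refine ⟨h2.integral_prod_left, ?_⟩
  rw [← integral_prod _ h2]
  have h3 := integral_map measurePreserving_ray.aemeasurable
    (f := fun p : (Space d × Sph d) × ℝ => f p.1 * ψ (rayPoint p.1.1 p.1.2 p.2))
    (by rw [measurePreserving_ray.map_eq]; exact h1.1)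
  rw [measurePreserving_ray.map_eq, integral_prod _ h1] at h3
  refine h3.symm.trans ?_
  refine integral_congr_ae (Eventually.of_forall fun p => ?_)
  simp only [rayTransform, integral_const_mul]

lemma memLp_rayTransform (ψ : 𝓢(SpaceTime d, ℂ)) : MemLp (rayTransform ψ) 2 (phase d) := by
  obtain ⟨C, hC, hψ⟩ := schwartz_decay ψ
  have hm : AEStronglyMeasurable (rayTransform ψ) (phase d) :=
    AEStronglyMeasurable.integral_prod_right' (μ := phase d) (ν := volume)
      (f := fun p : (Space d × Sph d) × ℝ => ψ (rayPoint p.1.1 p.1.2 p.2))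
      (ψ.continuous.comp continuous_rayPoint).aestronglyMeasurable
  have h : MemLp (fun p : Space d × Sph d => (bracket d p.1 : ℂ)) 2 (phase d) :=
    (memLp_bracket d).comp_fst (surf d)
  refine (h.const_mul ((C * ∫ t : ℝ, ((1 + |t|) ^ 2)⁻¹ : ℝ) : ℂ)).mono hm
    (Eventually.of_forall fun p => ?_)
  have hb : ∀ t, ‖ψ (rayPoint p.1 p.2 t)‖ ≤ C * bracket d p.1 * ((1 + |t|) ^ 2)⁻¹ := fun t => by
    have := hψ _ _ _ (le_norm_rayPoint p.1 p.2 t).1 (le_norm_rayPoint p.1 p.2 t).2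
    linarith
  have h1 := norm_integral_le_of_norm_le (integrable_one_add_abs_sq.const_mul (C * bracket d p.1))
    (Eventually.of_forall hb)
  rw [integral_const_mul] at h1
  refine h1.trans (le_of_eq ?_)
  have h0 : 0 ≤ ∫ t : ℝ, ((1 + |t|) ^ 2)⁻¹ := integral_nonneg fun t => by positivity
  rw [norm_mul, Complex.norm_real, Complex.norm_real, Real.norm_of_nonneg (by positivity),
    Real.norm_of_nonneg (bracket_nonneg _)]
  ring

end Transport

end KineticTransport

end

/-! ### The projection-slice theorem -/

noncomputable section

namespace KineticTransport

open scoped InnerProductSpace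
open Filter

section ProjectionSlice

variable {d : ℕ}

/-- The frequency with spatial part `ξ` at height `τ` over the hyperplane orthogonal to the
rays of velocity `v`. -/
def freqPoint (v : Sph d) (ξ : Space d) (τ : ℝ) : SpaceTime d :=
  WithLp.toLp 2 (ξ, τ - ⟪ξ, (v : Space d)⟫_ℝ)

lemma continuous_freqPoint :
    Continuous fun p : (Sph d × Space d) × ℝ => freqPoint p.1.1 p.1.2 p.2 := by
  unfold freqPoint
  exact (WithLp.prod_continuous_toLp 2 _ _).comp (by fun_prop)

lemma le_norm_freqPoint (v : Sph d) (ξ : Space d) (τ : ℝ) :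
    ‖ξ‖ ≤ 2 * ‖freqPoint v ξ τ‖ ∧ |τ| ≤ 2 * ‖freqPoint v ξ τ‖ := by
  have h1 : ‖ξ‖ ≤ _ := norm_fst_le (freqPoint v ξ τ)
  have h2 : |τ - ⟪ξ, (v : Space d)⟫_ℝ| ≤ _ := abs_snd_le (freqPoint v ξ τ)
  have h3 := abs_real_inner_le_norm ξ (v : Space d)
  rw [norm_sphere, mul_one] at h3
  have h4 := abs_sub_abs_le_abs_sub τ ⟪ξ, (v : Space d)⟫_ℝ
  constructor <;> linarith [norm_nonneg (freqPoint v ξ τ)]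

lemma norm_freqPoint_le (φ : 𝓢(SpaceTime d, ℂ)) : ∃ C : ℝ, 0 ≤ C ∧
    ∀ v ξ τ, ‖φ (freqPoint v ξ τ)‖ ≤ C * bracket d ξ * ((1 + |τ|) ^ 2)⁻¹ := by
  obtain ⟨C, hC, h⟩ := schwartz_decay φ
  refine ⟨C, hC, fun v ξ τ => ?_⟩
  have := h _ _ _ (le_norm_freqPoint v ξ τ).1 (le_norm_freqPoint v ξ τ).2
  linarith

/-- Shifting the time frequency by ⟨ξ, v⟩ makes the pairing with a ray point equal to ⟨ξ, y⟩ + τt,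
so the two variables separate. -/
lemma fourier_rayPoint (φ : 𝓢(SpaceTime d, ℂ)) (y : Space d) (v : Sph d) (t : ℝ) :
    𝓕 φ (rayPoint y v t) = 𝓕 (fun τ : ℝ => 𝓕 (fun ξ => φ (freqPoint v ξ τ)) y) t := by
  obtain ⟨C, hC, hφ⟩ := norm_freqPoint_le φ
  have hK : Integrable (fun p : Space d × ℝ =>
      Real.fourierChar (-(p.2 * t)) • Real.fourierChar (-⟪p.1, y⟫_ℝ) • φ (freqPoint v p.1 p.2))
      (volume.prod volume) := by
    refine (((integrable_bracket d).mul_prod integrable_one_add_abs_sq).const_mul C).mono' ?_ ?_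
    · refine Continuous.aestronglyMeasurable ?_
      have h1 : Continuous fun p : Space d × ℝ => φ (freqPoint v p.1 p.2) :=
        φ.continuous.comp (continuous_freqPoint.comp
          (f := fun p : Space d × ℝ => ((v, p.1), p.2)) (by fun_prop))
      have h2 : Continuous fun p : Space d × ℝ => Real.fourierChar (-(p.2 * t)) :=
        Real.continuous_fourierChar.comp (by fun_prop)
      have h3 : Continuous fun p : Space d × ℝ => Real.fourierChar (-⟪p.1, y⟫_ℝ) :=
        Real.continuous_fourierChar.comp (by fun_prop)
      exact h2.smul (h3.smul h1)
    · refine Eventually.of_forall fun p => ?_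
      rw [Circle.norm_smul, Circle.norm_smul]
      have := hφ v p.1 p.2
      linarith
  have hint : Integrable fun ζ : SpaceTime d =>
      Real.fourierChar (-⟪ζ, rayPoint y v t⟫_ℝ) • φ ζ :=
    (Real.fourierIntegral_convergent_iff (rayPoint y v t)).2 φ.integrable
  rw [SchwartzMap.fourier_coe, Real.fourier_eq, integral_spaceTime hint, Real.fourier_real_eq]
  have e1 : ∀ x : Space d, ∫ τ, Real.fourierChar (-⟪(WithLp.toLp 2 (x, τ) : SpaceTime d),
      rayPoint y v t⟫_ℝ) • φ (WithLp.toLp 2 (x, τ)) =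
      ∫ τ, Real.fourierChar (-(τ * t)) • Real.fourierChar (-⟪x, y⟫_ℝ) • φ (freqPoint v x τ) := by
    intro x
    rw [← integral_sub_right_eq_self _ ⟪x, (v : Space d)⟫_ℝ]
    refine integral_congr_ae (Eventually.of_forall fun τ => ?_)
    simp only
    rw [smul_smul, ← AddChar.map_add_eq_mul, rayPoint, WithLp.prod_inner_apply]
    simp only [inner_add_right, inner_smul_right, freqPoint, RCLike.inner_apply, conj_trivial]
    congr 2
    ring
  simp_rw [e1]
  rw [integral_integral_swap hK]
  refine integral_congr_ae (Eventually.of_forall fun τ => ?_)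
  simp only
  rw [Real.fourier_eq]
  simp only [Circle.smul_def, smul_eq_mul, integral_const_mul]

/-- Along a ray, the transform of φ is a one-dimensional Fourier transform in t. Its integral over t
is the original function at τ = 0, by Fourier inversion. -/
lemma rayTransform_fourier (φ : 𝓢(SpaceTime d, ℂ)) (y : Space d) (v : Sph d) :
    rayTransform (𝓕 φ : 𝓢(SpaceTime d, ℂ)) (y, v) = 𝓕 (fun ξ => φ (freqPoint v ξ 0)) y := by
  obtain ⟨C, hC, hφ⟩ := norm_freqPoint_le φ
  set g : ℝ → ℂ := fun τ => 𝓕 (fun ξ => φ (freqPoint v ξ τ)) y with hg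
  have hcont : Continuous fun p : Space d × ℝ =>
      Real.fourierChar (-⟪p.1, y⟫_ℝ) • φ (freqPoint v p.1 p.2) := by
    have h1 : Continuous fun p : Space d × ℝ => φ (freqPoint v p.1 p.2) :=
      φ.continuous.comp (continuous_freqPoint.comp
        (f := fun p : Space d × ℝ => ((v, p.1), p.2)) (by fun_prop))
    have h3 : Continuous fun p : Space d × ℝ => Real.fourierChar (-⟪p.1, y⟫_ℝ) :=
      Real.continuous_fourierChar.comp (by fun_prop)
    exact h3.smul h1
  have hbound : ∀ p : Space d × ℝ, ‖Real.fourierChar (-⟪p.1, y⟫_ℝ) • φ (freqPoint v p.1 p.2)‖ ≤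
      C * (bracket d p.1 * ((1 + |p.2|) ^ 2)⁻¹) := fun p => by
    rw [Circle.norm_smul]
    have := hφ v p.1 p.2
    linarith
  have hgc : Continuous g := by
    simp only [hg, Real.fourier_eq]
    refine continuous_of_dominated (bound := fun ξ => C * bracket d ξ) (fun τ => ?_)
      (fun τ => Eventually.of_forall fun ξ => ?_) ((integrable_bracket d).const_mul C)
      (Eventually.of_forall fun ξ => ?_)
    · exact (hcont.comp (f := fun ξ : Space d => (ξ, τ)) (by fun_prop)).aestronglyMeasurable
    · refine (hbound (ξ, τ)).trans ?_
      have : ((1 + |τ|) ^ 2)⁻¹ ≤ 1 :=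
        inv_le_one_of_one_le₀ (one_le_pow₀ (by linarith [abs_nonneg τ]))
      have h0 := bracket_nonneg ξ
      gcongr
      nlinarith
    · exact hcont.comp (f := fun τ : ℝ => (ξ, τ)) (by fun_prop)
  have hgi : Integrable g := by
    have hK : Integrable (fun p : Space d × ℝ =>
        Real.fourierChar (-⟪p.1, y⟫_ℝ) • φ (freqPoint v p.1 p.2)) (volume.prod volume) :=
      (((integrable_bracket d).mul_prod integrable_one_add_abs_sq).const_mul C).mono'
        hcont.aestronglyMeasurable (Eventually.of_forall hbound)
    simp only [hg, Real.fourier_eq]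
    exact hK.integral_prod_right
  have hF : 𝓕 g = fun t => 𝓕 φ (rayPoint y v t) := by
    funext t
    exact (fourier_rayPoint φ y v t).symm
  have hFi : Integrable (𝓕 g) := by
    obtain ⟨C', hC', hψ⟩ := schwartz_decay (𝓕 φ)
    rw [hF]
    refine (integrable_one_add_abs_sq.const_mul (C' * bracket d y)).mono' ?_
      (Eventually.of_forall fun t => ?_)
    · exact ((𝓕 φ).continuous.comp (continuous_rayPoint.comp
        (f := fun t : ℝ => ((y, v), t)) (by fun_prop))).aestronglyMeasurable
    · have := hψ _ _ _ (le_norm_rayPoint y v t).1 (le_norm_rayPoint y v t).2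
      linarith
  have h := congrFun (hgc.fourierInv_fourier_eq hgi hFi) 0
  rw [Real.fourierInv_eq] at h
  simp only [inner_zero_right, AddChar.map_zero_eq_one, one_smul] at h
  rw [rayTransform, ← hF]
  exact h

/-- The restriction of a Schwartz function to the hyperplane orthogonal to the rays of
velocity `v`, as a function of the spatial frequency. -/
def sliceSchwartz (φ : 𝓢(SpaceTime d, ℂ)) (v : Sph d) : 𝓢(Space d, ℂ) :=
  SchwartzMap.compCLMOfAntilipschitz ℂ (K := 2) (g := fun ξ => freqPoint v ξ 0)
    (by
      let L : Space d →L[ℝ] SpaceTime d :=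
        ((WithLp.prodContinuousLinearEquiv 2 ℝ (Space d) ℝ).symm : (Space d × ℝ) →L[ℝ] SpaceTime d).comp
          ((ContinuousLinearMap.id ℝ (Space d)).prod (-(innerSL ℝ (v : Space d))))
      have : (fun ξ => freqPoint v ξ 0) = L := by
        funext ξ
        simp [L, freqPoint, real_inner_comm]
      rw [this]
      exact L.hasTemperateGrowth)
    (AntilipschitzWith.of_le_mul_dist fun x y => by
      rw [dist_eq_norm, dist_eq_norm]
      have : freqPoint v x 0 - freqPoint v y 0 = freqPoint v (x - y) 0 := by
        simp only [freqPoint, ← WithLp.toLp_sub, Prod.mk_sub_mk, inner_sub_left]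
        congr 2
        ring
      rw [this]
      exact (le_norm_freqPoint v (x - y) 0).1) φ

lemma rayTransform_fourier_eq (φ : 𝓢(SpaceTime d, ℂ)) (y : Space d) (v : Sph d) :
    rayTransform (𝓕 φ : 𝓢(SpaceTime d, ℂ)) (y, v) = 𝓕 (sliceSchwartz φ v) y := by
  rw [rayTransform_fourier, SchwartzMap.fourier_coe]
  rfl

end ProjectionSlice

end KineticTransport

end

/-! ### The Fourier transform of one term of the expansion -/

noncomputable section

namespace KineticTransport

open scoped InnerProductSpace
open Filter Polynomial

section Weights

/-- The quotient of `kap m * dens m` by `etaH m βp βm`. -/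
def invWeight (m : ℕ) (βp βm t : ℝ) : ℝ := √(dens m t) / (symb βp βm t * √(dens m t) + 1)

variable (m : ℕ) (βp βm t : ℝ)

lemma measurable_invWeight : Measurable (invWeight m βp βm) :=
  (measurable_dens m).sqrt.div
    (((measurable_symb βp βm).mul (measurable_dens m).sqrt).add_const 1)

lemma symb_mul_sqrt_dens_add_one_pos : 0 < symb βp βm t * √(dens m t) + 1 := by
  have := mul_nonneg (symb_nonneg βp βm t) (Real.sqrt_nonneg (dens m t))
  linarith

lemma invWeight_nonneg : 0 ≤ invWeight m βp βm t :=
  div_nonneg (Real.sqrt_nonneg _) (symb_mul_sqrt_dens_add_one_pos m βp βm t).le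

/-- Puts the test weight in L², since `dens` is integrable. -/
lemma invWeight_le : invWeight m βp βm t ≤ √(dens m t) := by
  have := mul_nonneg (symb_nonneg βp βm t) (Real.sqrt_nonneg (dens m t))
  exact div_le_self (Real.sqrt_nonneg _) (by linarith)

/-- Makes the passage from the profile `etaH` to `etaM` a bounded multiplication on L². -/
lemma symb_mul_invWeight_le_one : symb βp βm t * invWeight m βp βm t ≤ 1 := by
  rw [invWeight, ← mul_div_assoc, div_le_one (symb_mul_sqrt_dens_add_one_pos m βp βm t)]
  linarith

lemma invWeight_mul_etaH : invWeight m βp βm t * etaH m βp βm t = kap m * dens m t := by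
  have h := symb_mul_sqrt_dens_add_one_pos m βp βm t
  have hd := Real.mul_self_sqrt (dens_nonneg m t)
  rw [invWeight, etaH, div_mul_eq_mul_div, div_eq_iff h.ne']
  linear_combination kap m * hd

lemma symb_mul_invWeight_mul_etaH :
    symb βp βm t * invWeight m βp βm t * etaH m βp βm t = etaM m βp βm t := by
  rw [mul_assoc, invWeight_mul_etaH, etaM]
  ring

lemma integrable_dens : Integrable (dens m) := by
  have h := integrableOn_one_sub_sq_rpow (e := ((m : ℝ) - 1) / 2)
    (by have : (0 : ℝ) ≤ m := m.cast_nonneg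
        linarith)
  rw [← integrable_indicator_iff measurableSet_Ioo] at h
  exact h

end Weights

variable {m : ℕ}

/-- Funk-Hecke with pole ξ/|ξ|: on the hyperplane τ = -⟨ξ, v⟩ the test function depends on v only
through the inner product with this pole. The factor |ξ|^{-1} is the Jacobian of t = -τ/|ξ|. -/
lemma integral_zonProj_freqPoint (k : ℕ) {b : SphL2 (m + 2)} (hb : b ∈ zonSpace m k)
    (w : Sph (m + 2)) (φ : 𝓢(SpaceTime (m + 2), ℂ)) {ξ : Space (m + 2)} (hξ : 0 < ‖ξ‖) :
    ∫ v, zonProj m k b v * φ (freqPoint v ξ 0) ∂(surf (m + 2)) =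
      zonProj m k b (sphProj w ξ) * (((‖ξ‖⁻¹ : ℝ) : ℂ) *
        ∫ τ, ((kap m * dens m (-(τ / ‖ξ‖)) * (geg m k).eval (-(τ / ‖ξ‖)) : ℝ) : ℂ) *
          φ (WithLp.toLp 2 (ξ, τ))) := by
  have hξ0 : ξ ≠ 0 := norm_pos_iff.1 hξ
  set ψ : ℝ → ℂ := fun t => φ (WithLp.toLp 2 (ξ, -(‖ξ‖ * t))) with hψ
  have hψc : Continuous ψ := φ.continuous.comp
    ((WithLp.prod_continuous_toLp 2 _ _).comp (by fun_prop))
  have e1 : ∀ v : Sph (m + 2), φ (freqPoint v ξ 0) =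
      ψ ⟪(v : Space (m + 2)), (sphProj w ξ : Space (m + 2))⟫_ℝ := by
    intro v
    simp only [hψ, freqPoint]
    congr 3
    rw [coe_sphProj w hξ0, inner_smul_right, ← mul_assoc, mul_inv_cancel₀ hξ.ne', one_mul,
      real_inner_comm, zero_sub]
  simp_rw [e1]
  rw [integral_zonProj_mul k hb (sphProj w ξ) hψc,
    integral_cos_mul_sin_pow m fun t => (((geg m k).eval t : ℝ) : ℂ) * ψ t]
  congr 1
  have h := integral_comp_neg_div hξ fun t =>
    ((kap m * dens m t * (geg m k).eval t : ℝ) : ℂ) * ψ t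
  have e2 : ∀ τ : ℝ, ψ (-(τ / ‖ξ‖)) = φ (WithLp.toLp 2 (ξ, τ)) := by
    intro τ
    simp only [hψ]
    congr 3
    field_simp
  simp_rw [e2] at h
  rw [h, ← integral_const_mul, ← integral_indicator measurableSet_Ioo]
  refine integral_congr_ae (Eventually.of_forall fun t => ?_)
  by_cases ht : t ∈ Set.Ioo (-1 : ℝ) 1
  · simp only [Set.indicator_of_mem ht, dens_of_mem m ht]
    push_cast
    ring
  · simp only [Set.indicator_of_notMem ht, dens_of_notMem m ht]
    simp

/-- By Fubini v may be fixed; the ray transform is then the Fourier transform of a Schwartz function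
of ξ, and the transform moves over to A. -/
lemma integral_mul_rayCoef (A : Lp ℂ 2 (volume : Measure (Space (m + 2)))) {Y : Sph (m + 2) → ℂ}
    (hY : Continuous Y) (φ : 𝓢(SpaceTime (m + 2), ℂ)) :
    ∫ y, A y * ∫ v, Y v * rayTransform (𝓕 φ : 𝓢(SpaceTime (m + 2), ℂ)) (y, v) ∂(surf (m + 2)) =
      ∫ ξ, (𝓕 A : Lp ℂ 2 (volume : Measure (Space (m + 2)))) ξ *
        ∫ v, Y v * φ (freqPoint v ξ 0) ∂(surf (m + 2)) := by
  obtain ⟨M, hM⟩ : ∃ M, ∀ v, ‖Y v‖ ≤ M := by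
    obtain ⟨M, hM⟩ := (isCompact_range hY).isBounded.exists_norm_le
    exact ⟨M, fun v => hM _ ⟨v, rfl⟩⟩
  have hYm : AEStronglyMeasurable (fun p : Space (m + 2) × Sph (m + 2) => Y p.2) (phase (m + 2)) :=
    (hY.comp continuous_snd).aestronglyMeasurable
  set X := rayTransform (𝓕 φ : 𝓢(SpaceTime (m + 2), ℂ)) with hX
  have h1 : Integrable (fun p => A p.1 * (Y p.2 * X p)) (phase (m + 2)) := by
    have h2 : MemLp (fun p : Space (m + 2) × Sph (m + 2) => A p.1) 2 (phase (m + 2)) :=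
      (Lp.memLp A).comp_fst (surf (m + 2))
    refine ((MemLp.integrable_mul h2 (memLp_rayTransform (𝓕 φ))).bdd_mul
      hYm (Eventually.of_forall fun p => hM p.2)).congr (Eventually.of_forall fun p => ?_)
    simp only [Pi.mul_apply, hX]
    ring
  set a : Lp ℂ 2 (volume : Measure (Space (m + 2))) := 𝓕 A with ha
  have h3 : Integrable (fun p => a p.1 * (Y p.2 * φ (freqPoint p.2 p.1 0))) (phase (m + 2)) := by
    have h2 : MemLp (fun p : Space (m + 2) × Sph (m + 2) => a p.1) 2 (phase (m + 2)) :=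
      (Lp.memLp a).comp_fst (surf (m + 2))
    obtain ⟨C, hC, hφ⟩ := norm_freqPoint_le φ
    refine ((integrable_mul_bracket h2).const_mul (M * C)).mono' ?_
      (Eventually.of_forall fun p => ?_)
    · exact h2.1.mul (hYm.mul (φ.continuous.comp (continuous_freqPoint.comp
        (f := fun p : Space (m + 2) × Sph (m + 2) => ((p.2, p.1), (0 : ℝ)))
        (by fun_prop))).aestronglyMeasurable)
    · have h4 := hφ p.2 p.1 0
      simp only [abs_zero, add_zero, one_pow, inv_one, mul_one] at h4
      rw [norm_mul, norm_mul]
      calc _ ≤ ‖a p.1‖ * (M * (C * bracket (m + 2) p.1)) := by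
            gcongr
            · exact (norm_nonneg _).trans (hM p.2)
            · exact hM p.2
        _ = _ := by ring
  simp_rw [← integral_const_mul]
  refine (integral_integral_swap h1).trans (Eq.trans ?_ (integral_integral_swap h3).symm)
  refine integral_congr_ae (Eventually.of_forall fun v => ?_)
  have h5 : ∀ B : Space (m + 2) → ℂ, ∀ Z : Space (m + 2) → ℂ,
      ∫ y, B y * (Y v * Z y) = Y v * ∫ y, B y * Z y := fun B Z => by
    rw [← integral_const_mul]
    exact integral_congr_ae (Eventually.of_forall fun y => by ring)
  simp only [h5, hX, rayTransform_fourier_eq]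
  rw [integral_Lp_mul_fourier A (sliceSchwartz φ v)]
  rfl

variable {βp βm : ℝ}

/-- The test function against which the terms of the expansion are integrated. -/
def testWeight (m : ℕ) (βp βm : ℝ) (φ : SpaceTime (m + 2) → ℂ) (ζ : SpaceTime (m + 2)) : ℂ :=
  (((√‖ζ.fst‖)⁻¹ * invWeight m βp βm (slope ζ) : ℝ) : ℂ) * φ ζ

lemma memLp_testWeight (φ : 𝓢(SpaceTime (m + 2), ℂ)) : MemLp (testWeight m βp βm φ) 2 := by
  obtain ⟨C, hC, hφ⟩ := schwartz_decay φ
  have h1 : MemLp (fun x => ((C : ℂ) * (bracket (m + 2) x : ℂ))) 2 := (memLp_bracket _).const_mul _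
  have h2 := memLp_sepFun (measurable_dens m).sqrt
    ((integrable_dens m).congr (Eventually.of_forall fun t => (Real.sq_sqrt (dens_nonneg m t)).symm)) h1
  refine h2.mono ?_ (Eventually.of_forall fun ζ => ?_)
  · refine AEStronglyMeasurable.mul (Measurable.aestronglyMeasurable
      (Complex.measurable_ofReal.comp (Measurable.mul ?_
        ((measurable_invWeight m βp βm).comp measurable_slope)))) φ.continuous.aestronglyMeasurable
    fun_prop
  · have h3 := hφ ζ ζ.fst 0 (by linarith [norm_fst_le ζ, norm_nonneg ζ]) (by simp)
    simp only [abs_zero, add_zero, one_pow, inv_one, mul_one] at h3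
    rw [testWeight, sepFun, norm_mul, norm_mul, Complex.norm_real, Complex.norm_real, norm_mul,
      norm_mul, Real.norm_of_nonneg (invWeight_nonneg _ _ _ _), Real.norm_of_nonneg (Real.sqrt_nonneg (dens _ _)),
      norm_mul, Complex.norm_real, Complex.norm_real, Real.norm_of_nonneg hC, Real.norm_of_nonneg (bracket_nonneg _)]
    gcongr
    exact invWeight_le _ _ _ _

lemma memLp_mul_sphProj {a : Space (m + 2) → ℂ} (ha : MemLp a 2) (w : Sph (m + 2))
    {Y : Sph (m + 2) → ℂ} (hY : Continuous Y) : MemLp (fun ξ => a ξ * Y (sphProj w ξ)) 2 := by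
  obtain ⟨M, hM⟩ := (isCompact_range hY).isBounded.exists_norm_le
  have hYm : AEStronglyMeasurable (fun ξ => Y (sphProj w ξ)) volume :=
    (hY.measurable.comp (measurable_sphProj w)).aestronglyMeasurable
  refine (ha.const_mul (M : ℂ)).mono (ha.1.mul hYm) (Eventually.of_forall fun ξ => ?_)
  rw [norm_mul, norm_mul, mul_comm, Complex.norm_real]
  gcongr
  exact (hM _ ⟨_, rfl⟩).trans (le_abs_self M)

/-- The two factors |ξ|^{-1/2} make up the Jacobian |ξ|^{-1}, and `invWeight` times `etaH` is the
density of Funk-Hecke. Thus a term of the L² series represents the corresponding term of the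
transform of ρf. -/
lemma integral_sepFun_mul_testWeight (k : ℕ) {b : SphL2 (m + 2)} (hb : b ∈ zonSpace m k)
    (w : Sph (m + 2)) (A : Lp ℂ 2 (volume : Measure (Space (m + 2))))
    {q : ℝ → ℝ} (hq : ∀ t, q t = etaH m βp βm t * (geg m k).eval t) (hqm : Measurable q)
    (hq2 : Integrable fun t => q t ^ 2) (φ : 𝓢(SpaceTime (m + 2), ℂ)) :
    ∫ ζ, sepFun q (fun ξ => (𝓕 A : Lp ℂ 2 (volume : Measure (Space (m + 2)))) ξ *
        zonProj m k b (sphProj w ξ)) ζ * testWeight m βp βm φ ζ =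
      ∫ y, A y * ∫ v, zonProj m k b v *
        rayTransform (𝓕 φ : 𝓢(SpaceTime (m + 2), ℂ)) (y, v) ∂(surf (m + 2)) := by
  rw [integral_mul_rayCoef A (zonProj m k b).continuous φ]
  set a : Lp ℂ 2 (volume : Measure (Space (m + 2))) := 𝓕 A with ha
  have hg := memLp_mul_sphProj (Lp.memLp a) w (zonProj m k b).continuous
  have hint := MemLp.integrable_mul (memLp_sepFun hqm hq2 hg)
    (memLp_testWeight (βp := βp) (βm := βm) φ)
  refine (integral_spaceTime hint).trans (integral_congr_ae ?_)
  filter_upwards [ae_norm_pos] with ξ hξ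
  rw [integral_zonProj_freqPoint k hb w φ hξ, ← integral_const_mul, ← integral_const_mul,
    ← integral_const_mul]
  refine integral_congr_ae (Eventually.of_forall fun τ => ?_)
  simp only [Pi.mul_apply, sepFun_toLp]
  have e : testWeight m βp βm φ (WithLp.toLp 2 (ξ, τ)) =
    (((√‖ξ‖)⁻¹ * invWeight m βp βm (-(τ / ‖ξ‖)) : ℝ) : ℂ) * φ (WithLp.toLp 2 (ξ, τ)) := rfl
  have e1 : ‖ξ‖⁻¹ = (√‖ξ‖)⁻¹ * (√‖ξ‖)⁻¹ := by rw [← mul_inv, Real.mul_self_sqrt hξ.le]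
  rw [e, hq, ← invWeight_mul_etaH m βp βm, e1]
  push_cast
  ring

end KineticTransport

end

/-! ### Orthogonality and summation of the series -/

noncomputable section

namespace KineticTransport

open scoped InnerProductSpace
open Filter Polynomial

section Abstract

lemma exists_clm_mul {α : Type*} [MeasurableSpace α] {μ : Measure α} {M : α → ℂ}
    (hM : Measurable M) (hM1 : ∀ x, ‖M x‖ ≤ 1) :
    ∃ T : Lp ℂ 2 μ →L[ℂ] Lp ℂ 2 μ, ∀ h : Lp ℂ 2 μ, T h =ᵐ[μ] fun x => M x * h x := by
  have hmem : ∀ h : Lp ℂ 2 μ, MemLp (fun x => M x * h x) 2 μ := fun h =>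
    (Lp.memLp h).mono (hM.aestronglyMeasurable.mul (Lp.memLp h).1) (Eventually.of_forall fun x => by
      rw [norm_mul]
      exact mul_le_of_le_one_left (norm_nonneg _) (hM1 x))
  refine ⟨LinearMap.mkContinuous
    { toFun := fun h => (hmem h).toLp _
      map_add' := fun h g => ?_
      map_smul' := fun c h => ?_ } 1 fun h => ?_, fun h => (hmem h).coeFn_toLp⟩
  · rw [← MemLp.toLp_add, MemLp.toLp_eq_toLp_iff]
    filter_upwards [Lp.coeFn_add h g] with x hx
    simp only [hx, Pi.add_apply, mul_add]
  · rw [RingHom.id_apply, ← MemLp.toLp_const_smul, MemLp.toLp_eq_toLp_iff]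
    filter_upwards [Lp.coeFn_smul c h] with x hx
    simp only [hx, Pi.smul_apply, smul_eq_mul]
    ring
  · rw [one_mul]
    refine Lp.norm_le_norm_of_ae_le ?_
    filter_upwards [(hmem h).coeFn_toLp] with x hx
    simp only [LinearMap.coe_mk, AddHom.coe_mk]
    rw [hx, norm_mul]
    exact mul_le_of_le_one_left (norm_nonneg _) (hM1 x)

lemma summable_of_pairwise_orthogonal {H ι : Type*} [NormedAddCommGroup H] [InnerProductSpace ℂ H]
    [CompleteSpace H] {V : ι → H} (hV : Pairwise fun j l => ⟪V j, V l⟫_ℂ = 0)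
    (hs : Summable fun j => ‖V j‖ ^ 2) : Summable V ∧ ‖∑' j, V j‖ ^ 2 ≤ ∑' j, ‖V j‖ ^ 2 := by
  have hO : OrthogonalFamily ℂ (fun j => (ℂ ∙ V j : Submodule ℂ H)) fun j => (ℂ ∙ V j).subtypeₗᵢ := by
    refine OrthogonalFamily.of_pairwise fun j l hjl => ?_
    show (ℂ ∙ V j) ⟂ (ℂ ∙ V l)
    rw [Submodule.isOrtho_span]
    rintro _ rfl _ rfl
    exact hV hjl
  have h := hO.summable_iff_norm_sq_summable fun j => ⟨V j, Submodule.mem_span_singleton_self _⟩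
  have hsum : Summable V := h.2 hs
  refine ⟨hsum, le_of_tendsto (hsum.hasSum.norm.pow 2) (Eventually.of_forall fun s => ?_)⟩
  have h2 := hO.norm_sum (fun j => ⟨V j, Submodule.mem_span_singleton_self _⟩) s
  refine (le_of_eq h2).trans (hs.sum_le_tsum s fun _ _ => sq_nonneg _)

lemma norm_toLp_sq {α : Type*} [MeasurableSpace α] {μ : Measure α} {g : α → ℂ} (hg : MemLp g 2 μ) :
    ‖hg.toLp g‖ ^ 2 = ∫ x, ‖g x‖ ^ 2 ∂μ := by
  have h := inner_toLp_toLp hg hg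
  rw [inner_self_eq_norm_sq_to_K] at h
  simp only [RCLike.conj_mul] at h
  have h2 : ∫ x, ((‖g x‖ ^ 2 : ℝ) : ℂ) ∂μ = ((∫ x, ‖g x‖ ^ 2 ∂μ : ℝ) : ℂ) := integral_complex_ofReal
  apply Complex.ofReal_injective
  rw [← h2]
  push_cast
  exact h

end Abstract

variable {m : ℕ}

/-- This is where radiality enters: the integrand separates into functions of t, |ξ| and ξ/|ξ|, so
orthogonality of b and b' alone makes the terms orthogonal. -/
lemma inner_sepFun {a a' : Lp ℂ 2 (volume : Measure (Space (m + 2)))} {F F' : ℝ → ℂ}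
    (ha : a =ᵐ[volume] fun x => F ‖x‖) (ha' : a' =ᵐ[volume] fun x => F' ‖x‖)
    {b b' : SphL2 (m + 2)} {k k' : ℕ} (hb : b ∈ zonSpace m k) (hb' : b' ∈ zonSpace m k')
    (w : Sph (m + 2)) {q q' : ℝ → ℝ} (hq : Measurable q)
    (hq2 : Integrable fun t => q t ^ 2) (hq' : Measurable q') (hq2' : Integrable fun t => q' t ^ 2) :
    ⟪(memLp_sepFun hq hq2 (memLp_mul_sphProj (Lp.memLp a) w (zonProj m k b).continuous)).toLp _,
      (memLp_sepFun hq' hq2' (memLp_mul_sphProj (Lp.memLp a') w (zonProj m k' b').continuous)).toLp _⟫_ℂ =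
      (((surf (m + 2)).real Set.univ)⁻¹ * ∫ t, q t * q' t : ℝ) * (⟪a, a'⟫_ℂ * ⟪b, b'⟫_ℂ) := by
  rw [inner_toLp_toLp, integral_sepFun_mul_sepFun hq hq2 hq' hq2'
    (memLp_mul_sphProj (Lp.memLp a) w (zonProj m k b).continuous)
    (memLp_mul_sphProj (Lp.memLp a') w (zonProj m k' b').continuous)]
  have h := integral_norm_mul_sphProj w (fun r => starRingEnd ℂ (F r) * F' r)
    (fun v => starRingEnd ℂ (zonProj m k b v) * zonProj m k' b' v)
  have e1 : ∫ x : Space (m + 2), starRingEnd ℂ (F ‖x‖) * F' ‖x‖ = ⟪a, a'⟫_ℂ := by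
    rw [← Lp.toLp_coeFn a (Lp.memLp a), ← Lp.toLp_coeFn a' (Lp.memLp a'), inner_toLp_toLp]
    refine integral_congr_ae ?_
    filter_upwards [ha, ha'] with x h1 h2
    rw [h1, h2]
  have e2 : ∫ v, starRingEnd ℂ (zonProj m k b v) * zonProj m k' b' v ∂(surf (m + 2)) = ⟪b, b'⟫_ℂ := by
    rw [← Lp.toLp_coeFn b (Lp.memLp b), ← Lp.toLp_coeFn b' (Lp.memLp b'), inner_toLp_toLp]
    refine integral_congr_ae ?_
    simp only [Lp.toLp_coeFn]
    filter_upwards [coeFn_zonProj k hb, coeFn_zonProj k' hb'] with x h1 h2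
    rw [h1, h2]
  have e3 : ∫ x : Space (m + 2), starRingEnd ℂ (a x * zonProj m k b (sphProj w x)) *
      (a' x * zonProj m k' b' (sphProj w x)) =
      ∫ x : Space (m + 2), starRingEnd ℂ (F ‖x‖) * F' ‖x‖ *
        (starRingEnd ℂ (zonProj m k b (sphProj w x)) * zonProj m k' b' (sphProj w x)) := by
    refine integral_congr_ae ?_
    filter_upwards [ha, ha'] with x h1 h2
    rw [h1, h2, map_mul]
    ring
  have hS : (((surf (m + 2)).real Set.univ : ℝ) : ℂ) ≠ 0 := by
    exact_mod_cast (surf_univ_pos m).ne'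
  simp only [e1] at h
  rw [show (volume : Measure (Space (m + 2))).toSphere = surf (m + 2) from rfl, e2] at h
  rw [e3, ← h]
  push_cast
  field_simp

section Expansion

variable {ι : Type*} [Countable ι] (b : HilbertBasis ι ℂ (SphL2 (m + 2))) {deg : ι → ℕ}

lemma summable_norm_sphCoef_sq (hdeg : ∀ j, b j ∈ zonSpace m (deg j))
    {f : Space (m + 2) × Sph (m + 2) → ℂ} (hf : MemLp f 2 (phase (m + 2))) :
    Summable fun j => ∫ x, ‖sphCoef (zonProj m (deg j) (b j)) f x‖ ^ 2 := by
  have h := tsum_lintegral_sphCoef_sq b (fun j => coeFn_zonProj (deg j) (hdeg j))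
    (fun j => (zonProj m (deg j) (b j)).continuous) hf
  have h2 := lintegral_enorm_sq_ne_top hf
  rw [← h] at h2
  refine (ENNReal.summable_toReal h2).congr fun j => ?_
  have hc := memLp_sphCoef (coeFn_zonProj (deg j) (hdeg j)) (zonProj m (deg j) (b j)).continuous hf
  rw [← enorm_toLp_sq hc, ← norm_toLp_sq hc, ENNReal.toReal_pow, toReal_enorm]

/-- Parseval in v for f and the conjugate of X, integrated in x. Summability of the squared
coefficients of both functions permits the interchange of sum and integral. -/
lemma hasSum_integral_sphCoef_mul (hdeg : ∀ j, b j ∈ zonSpace m (deg j))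
    {f X : Space (m + 2) × Sph (m + 2) → ℂ} (hf : MemLp f 2 (phase (m + 2)))
    (hX : MemLp X 2 (phase (m + 2))) :
    HasSum (fun j => ∫ x, sphCoef (zonProj m (deg j) (b j)) f x *
      ∫ v, zonProj m (deg j) (b j) v * X (x, v) ∂(surf (m + 2))) (∫ p, f p * X p ∂(phase (m + 2))) := by
  set Y : ι → Sph (m + 2) → ℂ := fun j => zonProj m (deg j) (b j) with hY
  have hb : ∀ j, b j =ᵐ[surf (m + 2)] Y j := fun j => coeFn_zonProj (deg j) (hdeg j)
  have hYc : ∀ j, Continuous (Y j) := fun j => (zonProj m (deg j) (b j)).continuous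
  set g : Space (m + 2) × Sph (m + 2) → ℂ := fun p => starRingEnd ℂ (X p) with hg
  have hg2 : MemLp g 2 (phase (m + 2)) := hX.star
  have e : ∀ j x, ∫ v, Y j v * X (x, v) ∂(surf (m + 2)) = starRingEnd ℂ (sphCoef (Y j) g x) := by
    intro j x
    rw [sphCoef, ← integral_conj]
    refine integral_congr_ae (Eventually.of_forall fun v => ?_)
    simp only [hg, map_mul, Complex.conj_conj]
  have hA := fun j => memLp_sphCoef (hb j) (hYc j) hf
  have hB := fun j => memLp_sphCoef (hb j) (hYc j) hg2
  set Fj : ι → Space (m + 2) → ℂ := fun j x =>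
    starRingEnd ℂ (sphCoef (Y j) g x) * sphCoef (Y j) f x with hFj
  have hFint : ∀ j, Integrable (Fj j) := fun j => MemLp.integrable_mul (hB j).star (hA j)
  have hsq : ∀ {u : Space (m + 2) → ℂ}, MemLp u 2 → Integrable fun x => ‖u x‖ ^ 2 := fun hu =>
    (memLp_two_iff_integrable_sq_norm hu.1).1 hu
  have hsum : Summable fun j => ∫ x, ‖Fj j x‖ := by
    refine Summable.of_nonneg_of_le (fun j => integral_nonneg fun x => norm_nonneg _) (fun j => ?_)
      ((summable_norm_sphCoef_sq b hdeg hg2).add (summable_norm_sphCoef_sq b hdeg hf))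
    rw [← integral_add (hsq (hB j)) (hsq (hA j))]
    refine integral_mono (hFint j).norm ((hsq (hB j)).add (hsq (hA j))) fun x => ?_
    simp only [hFj, norm_mul, RCLike.norm_conj]
    nlinarith [sq_nonneg (‖sphCoef (Y j) g x‖ - ‖sphCoef (Y j) f x‖), sq_nonneg ‖sphCoef (Y j) g x‖,
      sq_nonneg ‖sphCoef (Y j) f x‖]
  have hmain := hasSum_integral_of_summable_integral_norm hFint hsum
  have hint : Integrable (fun p => f p * X p) (phase (m + 2)) := MemLp.integrable_mul hf hX
  have e2 : ∫ p, f p * X p ∂(phase (m + 2)) = ∫ x, ∑' j, Fj j x := by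
    rw [phase, integral_prod _ hint]
    refine integral_congr_ae ?_
    filter_upwards [memLp_slice hf, memLp_slice hg2] with x h1 h2
    rw [(hasSum_sphCoef_mul b hb h1 h2).tsum_eq]
    refine integral_congr_ae (Eventually.of_forall fun v => ?_)
    simp only [hg, Complex.conj_conj]
    ring
  rw [e2]
  have e3 : (fun j => ∫ x, sphCoef (Y j) f x * ∫ v, Y j v * X (x, v) ∂(surf (m + 2))) =
      fun j => ∫ x, Fj j x := by
    funext j
    simp only [e]
    exact integral_congr_ae (Eventually.of_forall fun x => mul_comm _ _)
  rw [e3]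
  exact hmain

lemma tsum_sobolev_sphCoef_le (hdeg : ∀ j, b j ∈ zonSpace m (deg j)) (s : ℝ)
    {f : Space (m + 2) × Sph (m + 2) → ℂ} (hf : MemLp f 2 (phase (m + 2))) :
    ∑' j, ENNReal.ofReal ((1 + (sphEig m (deg j) : ℝ)) ^ s) *
      ∫⁻ x, ‖sphCoef (zonProj m (deg j) (b j)) f x‖ₑ ^ 2 ≤
      ∫⁻ x, sphSobolevSq (m + 2) s fun v => f (x, v) := by
  have hm : ∀ j, AEMeasurable fun x => ‖sphCoef (zonProj m (deg j) (b j)) f x‖ₑ ^ 2 := fun j =>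
    (aestronglyMeasurable_sphCoef (zonProj m (deg j) (b j)).continuous hf.1).enorm.pow_const 2
  simp_rw [← fun j => lintegral_const_mul'' (ENNReal.ofReal ((1 + (sphEig m (deg j) : ℝ)) ^ s)) (hm j)]
  rw [← lintegral_tsum fun j => (hm j).const_mul _]
  refine lintegral_mono_ae ?_
  filter_upwards [memLp_slice hf] with x hx
  have h := sphSobolevSq_ge b.orthonormal hdeg s hx
  refine le_trans (le_of_eq (tsum_congr fun j => ?_)) h
  rw [sphCoef_eq_inner (coeFn_zonProj (deg j) (hdeg j)) hx]

end Expansion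

section Synthesis

/-- The element `|ξ|^{-1/2} q(-τ/|ξ|) a(ξ) Y(ξ/|ξ|)` of `L²`, `Y` being the continuous
representative of `b`. -/
def sepLp {q : ℝ → ℝ} (hq : Measurable q) (hq2 : Integrable fun t => q t ^ 2)
    (a : Lp ℂ 2 (volume : Measure (Space (m + 2)))) (w : Sph (m + 2)) (k : ℕ) (b : SphL2 (m + 2)) :
    Lp ℂ 2 (volume : Measure (SpaceTime (m + 2))) :=
  (memLp_sepFun hq hq2 (memLp_mul_sphProj (Lp.memLp a) w (zonProj m k b).continuous)).toLp _

lemma coeFn_sepLp {q : ℝ → ℝ} (hq : Measurable q) (hq2 : Integrable fun t => q t ^ 2)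
    (a : Lp ℂ 2 (volume : Measure (Space (m + 2)))) (w : Sph (m + 2)) (k : ℕ) (b : SphL2 (m + 2)) :
    sepLp hq hq2 a w k b =ᵐ[volume] sepFun q fun ξ => a ξ * zonProj m k b (sphProj w ξ) :=
  MemLp.coeFn_toLp _

variable {η : ℝ → ℝ}

lemma measurable_mul_geg (hη : Measurable η) (k : ℕ) :
    Measurable fun t => η t * (geg m k).eval t :=
  hη.mul (geg m k).continuous.measurable

lemma integrable_mul_geg_sq (hη : Measurable η) (hη2 : Integrable fun t => η t ^ 2)
    (h0 : ∀ t, t ∉ Set.Ioo (-1 : ℝ) 1 → η t = 0) (k : ℕ) :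
    Integrable fun t => (η t * (geg m k).eval t) ^ 2 := by
  refine hη2.mono' ((measurable_mul_geg hη k).pow_const 2).aestronglyMeasurable
    (Eventually.of_forall fun t => ?_)
  rw [Real.norm_of_nonneg (sq_nonneg _)]
  by_cases ht : t ∈ Set.Ioo (-1 : ℝ) 1
  · rw [mul_pow, ← sq_abs (eval t (geg m k))]
    exact mul_le_of_le_one_right (sq_nonneg _)
      (pow_le_one₀ (abs_nonneg _) (abs_geg_eval_le_one m k ⟨ht.1.le, ht.2.le⟩))
  · rw [h0 t ht, zero_mul]

variable {ι : Type*}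

lemma summable_sepLp {b : ι → SphL2 (m + 2)} (hb : Orthonormal ℂ b) {deg : ι → ℕ}
    (hdeg : ∀ j, b j ∈ zonSpace m (deg j)) {a : ι → Lp ℂ 2 (volume : Measure (Space (m + 2)))}
    (ha : ∀ j, ∃ F : ℝ → ℂ, a j =ᵐ[volume] fun x => F ‖x‖) (has : Summable fun j => ‖a j‖ ^ 2)
    (w : Sph (m + 2)) {q : ℕ → ℝ → ℝ} (hq : ∀ k, Measurable (q k))
    (hq2 : ∀ k, Integrable fun t => q k t ^ 2) {C : ℝ} (hC : ∀ k, ∫ t, q k t ^ 2 ≤ C) :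
    Summable (fun j => sepLp (hq (deg j)) (hq2 (deg j)) (a j) w (deg j) (b j)) ∧
    (Summable fun j => ((surf (m + 2)).real Set.univ)⁻¹ * (∫ t, q (deg j) t ^ 2) * ‖a j‖ ^ 2) ∧
    ‖∑' j, sepLp (hq (deg j)) (hq2 (deg j)) (a j) w (deg j) (b j)‖ ^ 2 ≤
      ∑' j, ((surf (m + 2)).real Set.univ)⁻¹ * (∫ t, q (deg j) t ^ 2) * ‖a j‖ ^ 2 := by
  choose F hF using ha
  set V := fun j => sepLp (hq (deg j)) (hq2 (deg j)) (a j) w (deg j) (b j) with hV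
  have hin : ∀ j l, ⟪V j, V l⟫_ℂ = (((surf (m + 2)).real Set.univ)⁻¹ *
      ∫ t, q (deg j) t * q (deg l) t : ℝ) * (⟪a j, a l⟫_ℂ * ⟪b j, b l⟫_ℂ) := fun j l =>
    inner_sepFun (hF j) (hF l) (hdeg j) (hdeg l) w (hq _) (hq2 _) (hq _) (hq2 _)
  have hn : ∀ j, ‖V j‖ ^ 2 =
      ((surf (m + 2)).real Set.univ)⁻¹ * (∫ t, q (deg j) t ^ 2) * ‖a j‖ ^ 2 := by
    intro j
    have h := hin j j
    simp only [inner_self_eq_norm_sq_to_K, hb.1 j, ← sq] at h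
    apply Complex.ofReal_injective
    push_cast
    push_cast at h
    simpa using h
  have hS := surf_univ_pos m
  have hsum : Summable fun j => ‖V j‖ ^ 2 := by
    refine Summable.of_nonneg_of_le (fun j => sq_nonneg _) (fun j => ?_)
      (has.mul_left (((surf (m + 2)).real Set.univ)⁻¹ * C))
    rw [hn j]
    gcongr
    exact hC _
  have h := summable_of_pairwise_orthogonal (V := V) (fun j l hjl => by
    simp only [hin, hb.2 hjl, mul_zero]) hsum
  simp_rw [hn] at hsum h
  exact ⟨h.1, hsum, h.2⟩

end Synthesis

end KineticTransport

end

/-! ### Assembly of the estimate -/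

noncomputable section

namespace KineticTransport

open scoped InnerProductSpace
open Filter Polynomial

variable {m : ℕ} {s βp βm : ℝ}

lemma abs_slope {d : ℕ} (ζ : SpaceTime d) : |slope ζ| = |ζ.snd| / ‖ζ.fst‖ := by
  rw [slope, abs_neg, abs_div, abs_norm]

/-- Homogeneity of degree β₊ + β₋ = 1/2; the factor √(2π) from the normalisation of the frequency is
part of `symb`. -/
lemma hypSymbol_smul {d : ℕ} (hβ : βp + βm = 1 / 2) {ζ : SpaceTime d} (hζ : 0 < ‖ζ.fst‖) :
    hypSymbol d βp βm ((2 * Real.pi) • ζ) = √‖ζ.fst‖ * symb βp βm (slope ζ) := by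
  have hπ : 0 < 2 * Real.pi := by positivity
  have hp : 0 < 2 * Real.pi * ‖ζ.fst‖ := by positivity
  have e1 : ‖((2 * Real.pi) • ζ).fst‖ = 2 * Real.pi * ‖ζ.fst‖ := by
    rw [WithLp.smul_fst, norm_smul, Real.norm_of_nonneg hπ.le]
  have e2 : |((2 * Real.pi) • ζ).snd| = 2 * Real.pi * ‖ζ.fst‖ * |slope ζ| := by
    rw [WithLp.smul_snd, smul_eq_mul, abs_mul, abs_of_pos hπ, abs_slope]
    field_simp
  have e3 : 2 * Real.pi * ‖ζ.fst‖ + 2 * Real.pi * ‖ζ.fst‖ * |slope ζ| =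
      2 * Real.pi * ‖ζ.fst‖ * (1 + |slope ζ|) := by ring
  have e4 : abs (2 * Real.pi * ‖ζ.fst‖ - 2 * Real.pi * ‖ζ.fst‖ * |slope ζ|) =
      2 * Real.pi * ‖ζ.fst‖ * abs (1 - |slope ζ|) := by
    rw [show 2 * Real.pi * ‖ζ.fst‖ - 2 * Real.pi * ‖ζ.fst‖ * |slope ζ| =
      2 * Real.pi * ‖ζ.fst‖ * (1 - |slope ζ|) by ring, abs_mul, abs_of_pos hp]
  rw [hypSymbol, e1, e2, e3, e4, Real.mul_rpow hp.le (by positivity),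
    Real.mul_rpow hp.le (abs_nonneg _), symb]
  have e5 : (2 * Real.pi * ‖ζ.fst‖) ^ βp * (2 * Real.pi * ‖ζ.fst‖) ^ βm =
      √(2 * Real.pi) * √‖ζ.fst‖ := by
    rw [← Real.rpow_add hp, hβ, ← Real.sqrt_eq_rpow, Real.sqrt_mul hπ.le]
  linear_combination ((1 + |slope ζ|) ^ βp * abs (1 - |slope ζ|) ^ βm) * e5

lemma ae_norm_fst_pos : ∀ᵐ ζ : SpaceTime (m + 2), 0 < ‖ζ.fst‖ := by
  have h := WithLp.volume_preserving_ofLp (Space (m + 2)) ℝ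
  have h1 : ∀ᵐ p : Space (m + 2) × ℝ, 0 < ‖p.1‖ :=
    Measure.quasiMeasurePreserving_fst.ae ae_norm_pos
  exact h.quasiMeasurePreserving.ae h1

lemma hasFourierTransform_fourierInv {d : ℕ} (U : Lp ℂ 2 (volume : Measure (SpaceTime d)))
    {G : SpaceTime d → ℂ} (hG : U =ᵐ[volume] G) :
    HasFourierTransform d (𝓕⁻ U : Lp ℂ 2 (volume : Measure (SpaceTime d))) G := by
  intro φ
  have e : (fun ζ => U ζ * φ ζ) =ᵐ[volume] fun ζ => G ζ * φ ζ :=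
    hG.mono fun ζ hζ => by simp only [hζ]
  refine ⟨MemLp.integrable_mul (Lp.memLp _) ((𝓕 φ).memLp 2), ?_, ?_⟩
  · exact (MemLp.integrable_mul (Lp.memLp U) (φ.memLp 2)).congr e
  · rw [integral_Lp_mul_fourier, FourierTransform.fourier_fourierInv_eq]
    exact integral_congr_ae e

lemma hasSum_integral_mul {α ι : Type*} [MeasurableSpace α] {μ : Measure α} {V : ι → Lp ℂ 2 μ}
    (hV : Summable V) {K : α → ℂ} (hK : MemLp K 2 μ) :
    HasSum (fun j => ∫ x, V j x * K x ∂μ) (∫ x, (∑' j, V j : Lp ℂ 2 μ) x * K x ∂μ) := by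
  have hK' : MemLp (fun x => starRingEnd ℂ (K x)) 2 μ := hK.star
  have e : ∀ W : Lp ℂ 2 μ, innerSL ℂ (hK'.toLp _) W = ∫ x, W x * K x ∂μ := by
    intro W
    rw [innerSL_apply_apply]
    conv_lhs => rw [← Lp.toLp_coeFn W (Lp.memLp W)]
    rw [inner_toLp_toLp]
    refine integral_congr_ae (Eventually.of_forall fun x => ?_)
    simp only [Complex.conj_conj, mul_comm]
  have h := hV.hasSum.mapL (innerSL ℂ (hK'.toLp _))
  simpa only [e] using h

set_option maxHeartbeats 1000000 in
-- The series H with profile `etaH` carries the qualitative part: the transform of ρf is a function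
-- G obtained from H by a weight. The series U with profile `etaM` carries the norm estimate, by
-- orthogonality.
theorem exists_hypDeriv_rho {ι : Type*} [Countable ι] (b : HilbertBasis ι ℂ (SphL2 (m + 2)))
    {deg : ι → ℕ} (hdeg : ∀ j, b j ∈ zonSpace m (deg j)) (hβ : βp + βm = 1 / 2)
    (hs : s ≤ 0)
    (hM2 : Integrable fun t => etaM m βp βm t ^ 2) {CM : ℝ} (hCM : 0 ≤ CM)
    (hM : ∀ k, ∫ t, etaM m βp βm t ^ 2 * (geg m k).eval t ^ 2 ≤ CM * (1 + (sphEig m k : ℝ)) ^ s)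
    (hH2 : Integrable fun t => etaH m βp βm t ^ 2) {CH : ℝ}
    (hH : ∀ k, ∫ t, etaH m βp βm t ^ 2 * (geg m k).eval t ^ 2 ≤ CH)
    {f : Space (m + 2) × Sph (m + 2) → ℂ} (hf : MemLp f 2 (phase (m + 2)))
    (hr : IsRadialInSpace (m + 2) f) :
    ∃ u : SpaceTime (m + 2) → ℂ, MemLp u 2 ∧ IsHypDeriv (m + 2) βp βm (rho (m + 2) f) u ∧
      eLpNorm u 2 volume ≤
        ENNReal.ofReal (((surf (m + 2)).real Set.univ)⁻¹ * CM) ^ (1 / 2 : ℝ) *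
          velSobolevNorm (m + 2) s f := by
  -- An arbitrary value of ξ/|ξ| at ξ = 0.
  obtain ⟨w, -⟩ := exists_sphere_inner_eq m (t := 0) (by norm_num)
  set c : ℝ := ((surf (m + 2)).real Set.univ)⁻¹ with hc
  have hc0 : 0 ≤ c := inv_nonneg.2 (surf_univ_pos m).le
  have hb : ∀ j, b j =ᵐ[surf (m + 2)] zonProj m (deg j) (b j) := fun j =>
    coeFn_zonProj (deg j) (hdeg j)
  have hA := fun j => memLp_sphCoef (hb j) (zonProj m (deg j) (b j)).continuous hf
  set A : ι → Lp ℂ 2 (volume : Measure (Space (m + 2))) := fun j => (hA j).toLp _ with hAdef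
  set a : ι → Lp ℂ 2 (volume : Measure (Space (m + 2))) := fun j => 𝓕 (A j) with hadef
  have ha : ∀ j, ∃ F : ℝ → ℂ, a j =ᵐ[volume] fun x => F ‖x‖ := by
    intro j
    obtain ⟨B, hB⟩ := sphCoef_radial (zonProj m (deg j) (b j)) hr
    exact fourier_radial ((hA j).coeFn_toLp.trans hB)
  have has : Summable fun j => ‖a j‖ ^ 2 := by
    refine (summable_norm_sphCoef_sq b hdeg hf).congr fun j => ?_
    rw [← norm_toLp_sq (hA j), hadef]
    simp only [Lp.norm_fourier_eq, hAdef]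
  have hqM := fun k => measurable_mul_geg (m := m) (measurable_etaM m βp βm) k
  have hqH := fun k => measurable_mul_geg (m := m) (measurable_etaH m βp βm) k
  have hqM2 := fun k => integrable_mul_geg_sq (m := m) (measurable_etaM m βp βm) hM2
    (fun _ => etaM_of_notMem m βp βm) k
  have hqH2 := fun k => integrable_mul_geg_sq (m := m) (measurable_etaH m βp βm) hH2
    (fun _ => etaH_of_notMem m βp βm) k
  simp_rw [← mul_pow] at hM hH
  have hM' : ∀ k, ∫ t, (etaM m βp βm t * (geg m k).eval t) ^ 2 ≤ CM := fun k =>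
    (hM k).trans (mul_le_of_le_one_right hCM
      (Real.rpow_le_one_of_one_le_of_nonpos (by linarith [(sphEig m k).2]) hs))
  obtain ⟨hsM, hsM2, hUle⟩ := summable_sepLp b.orthonormal hdeg ha has w hqM hqM2 hM'
  obtain ⟨hsH, -, -⟩ := summable_sepLp b.orthonormal hdeg ha has w hqH hqH2 hH
  set VM := fun j => sepLp (hqM (deg j)) (hqM2 (deg j)) (a j) w (deg j) (b j) with hVM
  set VH := fun j => sepLp (hqH (deg j)) (hqH2 (deg j)) (a j) w (deg j) (b j) with hVH
  set U := ∑' j, VM j with hU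
  set H := ∑' j, VH j with hHdef
  -- A bounded multiplication sending the terms of H to those of U. It gives symbol · G = U almost
  -- everywhere without applying the unbounded symbol term by term.
  obtain ⟨T, hT⟩ := exists_clm_mul (μ := (volume : Measure (SpaceTime (m + 2))))
    (M := fun ζ => ((symb βp βm (slope ζ) * invWeight m βp βm (slope ζ) : ℝ) : ℂ))
    (Complex.measurable_ofReal.comp (((measurable_symb βp βm).comp measurable_slope).mul
      ((measurable_invWeight m βp βm).comp measurable_slope)))
    (fun ζ => by
      rw [Complex.norm_real, Real.norm_of_nonneg (mul_nonneg (symb_nonneg _ _ _)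
        (invWeight_nonneg _ _ _ _))]
      exact symb_mul_invWeight_le_one m βp βm (slope ζ))
  have hTV : ∀ j, T (VH j) = VM j := by
    intro j
    ext1
    filter_upwards [hT (VH j), coeFn_sepLp (hqH (deg j)) (hqH2 (deg j)) (a j) w (deg j) (b j),
      coeFn_sepLp (hqM (deg j)) (hqM2 (deg j)) (a j) w (deg j) (b j)] with ζ h1 h2 h3
    rw [h1, h2, h3]
    simp only [sepFun, ← symb_mul_invWeight_mul_etaH m βp βm]
    push_cast
    ring
  have hTH : T H = U := by
    rw [hHdef, T.map_tsum hsH]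
    exact tsum_congr hTV
  set G : SpaceTime (m + 2) → ℂ := fun ζ =>
    H ζ * (((√‖ζ.fst‖)⁻¹ * invWeight m βp βm (slope ζ) : ℝ) : ℂ) with hG
  have hUG : U =ᵐ[volume] fun ζ =>
      (hypSymbol (m + 2) βp βm ((2 * Real.pi) • ζ) : ℂ) * G ζ := by
    rw [← hTH]
    filter_upwards [hT H, ae_norm_fst_pos] with ζ h1 h2
    have hr0 : ((√‖ζ.fst‖ : ℝ) : ℂ) ≠ 0 := by exact_mod_cast (Real.sqrt_pos.2 h2).ne'
    rw [h1, hypSymbol_smul hβ h2]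
    simp only [hG]
    push_cast
    field_simp
  have hFG : HasFourierTransform (m + 2) (rho (m + 2) f) G := by
    intro φ
    obtain ⟨hi, he⟩ := integrable_rho_mul hf (𝓕 φ)
    have hK := memLp_testWeight (m := m) (βp := βp) (βm := βm) φ
    have eG : (fun ζ => G ζ * φ ζ) = fun ζ => H ζ * testWeight m βp βm φ ζ := by
      funext ζ
      simp only [hG, testWeight]
      ring
    refine ⟨hi, ?_, ?_⟩
    · rw [eG]
      exact MemLp.integrable_mul (Lp.memLp H) hK
    · rw [eG, he]
      -- Both pairings are sums of series indexed by the basis, and these agree term by term.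
      have h1 := hasSum_integral_sphCoef_mul b hdeg hf (memLp_rayTransform (𝓕 φ))
      have h2 := hasSum_integral_mul hsH hK
      refine h1.unique ?_
      convert h2 using 1
      funext j
      have h3 := integral_sepFun_mul_testWeight (deg j) (hdeg j) w (A j)
        (q := fun t => etaH m βp βm t * (geg m (deg j)).eval t) (fun _ => rfl)
        (hqH (deg j)) (hqH2 (deg j)) φ
      refine Eq.trans ?_ (h3.symm.trans ?_)
      · refine integral_congr_ae ?_
        filter_upwards [(hA j).coeFn_toLp] with x hx
        simp only [hAdef, hx]
      · refine integral_congr_ae ?_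
        filter_upwards [coeFn_sepLp (hqH (deg j)) (hqH2 (deg j)) (a j) w (deg j) (b j)] with ζ h4
        rw [h4]
  refine ⟨(𝓕⁻ U : Lp ℂ 2 (volume : Measure (SpaceTime (m + 2)))), Lp.memLp _,
    ⟨G, hFG, hasFourierTransform_fourierInv U hUG⟩, ?_⟩
  have hnorm : ‖(𝓕⁻ U : Lp ℂ 2 (volume : Measure (SpaceTime (m + 2))))‖ = ‖U‖ := by
    rw [← Lp.norm_fourier_eq, FourierTransform.fourier_fourierInv_eq]
  have hU2 : ‖U‖ₑ ^ 2 ≤ ENNReal.ofReal (c * CM) *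
      ∫⁻ x, sphSobolevSq (m + 2) s fun v => f (x, v) := by
    rw [← ofReal_norm, ← ENNReal.ofReal_pow (norm_nonneg _)]
    refine (ENNReal.ofReal_le_ofReal hUle).trans ?_
    rw [ENNReal.ofReal_tsum_of_nonneg (fun j => mul_nonneg (mul_nonneg hc0
      (integral_nonneg fun t => sq_nonneg _)) (sq_nonneg _)) hsM2]
    refine le_trans ?_ (mul_le_mul_right (tsum_sobolev_sphCoef_le b hdeg s hf) _)
    rw [← ENNReal.tsum_mul_left]
    refine ENNReal.tsum_le_tsum fun j => ?_
    have hnn : 0 ≤ (1 + (sphEig m (deg j) : ℝ)) ^ s := by positivity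
    rw [← enorm_toLp_sq (hA j), ← ofReal_norm, ← ENNReal.ofReal_pow (norm_nonneg _),
      ← ENNReal.ofReal_mul hnn, ← ENNReal.ofReal_mul (mul_nonneg hc0 hCM)]
    refine ENNReal.ofReal_le_ofReal ?_
    have e : ‖a j‖ = ‖(hA j).toLp _‖ := by simp only [hadef, hAdef, Lp.norm_fourier_eq]
    rw [e]
    calc _ ≤ c * (CM * (1 + (sphEig m (deg j) : ℝ)) ^ s) * ‖(hA j).toLp _‖ ^ 2 := by
          gcongr
          exact hM _
      _ = _ := by ring
  have hfin : eLpNorm (𝓕⁻ U : Lp ℂ 2 (volume : Measure (SpaceTime (m + 2)))) 2 volume =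
      (‖U‖ₑ ^ 2) ^ (1 / 2 : ℝ) := by
    rw [← Lp.enorm_def, ← ofReal_norm, hnorm, ofReal_norm, ← ENNReal.rpow_natCast,
      ← ENNReal.rpow_mul]
    norm_num
  rw [hfin, velSobolevNorm, ← ENNReal.mul_rpow_of_nonneg _ _ (by norm_num)]
  exact ENNReal.rpow_le_rpow hU2 (by norm_num)

end KineticTransport

end

theorem theorem7p2 (d : ℕ) (hd : 2 ≤ d) (s βp βm : ℝ)
    (hs : s ∈ Set.Icc (-(((d : ℝ) - 2) / 2)) 0)
    (hβ : βp + βm = 1 / 2) (hβm : -s - ((d : ℝ) - 2) / 2 < βm) :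
    ∃ C : NNReal, ∀ f : KineticTransport.Space d × KineticTransport.Sph d → ℂ,
      MeasureTheory.MemLp f 2 (KineticTransport.phase d) →
      KineticTransport.IsRadialInSpace d f →
      ∃ u : KineticTransport.SpaceTime d → ℂ,
        MeasureTheory.MemLp u 2 MeasureTheory.volume ∧
        KineticTransport.IsHypDeriv d βp βm (KineticTransport.rho d f) u ∧
        MeasureTheory.eLpNorm u 2 MeasureTheory.volume ≤
          (C : ENNReal) * KineticTransport.velSobolevNorm d s f := by
  obtain ⟨m, rfl⟩ : ∃ m, d = m + 2 := ⟨d - 2, by omega⟩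
  have hm : ((m + 2 : ℕ) : ℝ) - 2 = m := by push_cast; ring
  rw [hm] at hs hβm
  obtain ⟨ι, hι, b, deg, hdeg⟩ := KineticTransport.exists_hilbertBasis_zonSpace m
  obtain ⟨hM2, CM, hCM, hM⟩ := KineticTransport.exists_etaM_bound (βp := βp) hs hβm
  obtain ⟨hH2, CH, -, hH⟩ := KineticTransport.exists_etaH_bound (βp := βp) hs hβm
  set K : ENNReal := ENNReal.ofReal
    (((KineticTransport.surf (m + 2)).real Set.univ)⁻¹ * CM) ^ (1 / 2 : ℝ) with hK
  have hKtop : K ≠ ⊤ := ENNReal.rpow_ne_top_of_nonneg (by norm_num) ENNReal.ofReal_ne_top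
  refine ⟨K.toNNReal, fun f hf hr => ?_⟩
  rw [ENNReal.coe_toNNReal hKtop]
  exact KineticTransport.exists_hypDeriv_rho b hdeg hβ hs.2 hM2 hCM hM hH2 hH hf hr
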